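/- Let $D\subset\mathbb{R}^n$ be a convex domain, let $1\le q\le n$, let $E=D\times\mathbb{R}^r$ be the trivial flat vector bundle with frame $e_1,\dots,e_r$, and let $g=(g_{\tau\xi})$, $g_{\tau\xi}=\langle e_\tau,e_\xi\rangle$, be a $C^2$ Riemannian metric on $E$, i.e. a $C^2$ map from $D$ to the positive definite symmetric $r\times r$ matrices. For $E$-valued $q$-forms $\alpha=\sum_{\tau,I}\alpha_{I,\tau}\,dx_I\otimes e_\tau$ and $\beta$ ($I$ running over increasing multi-indices) put $\langle\alpha,\beta\rangle_g=\sum_{I,\tau,\xi}\alpha_{I,\tau}\beta_{I,\xi}g_{\tau\xi}$ and $|\alpha|_g^2=\langle\alpha,\alpha\rangle_g$; let $L^2_q(D,E)$ be the Hilbert space of measurable $E$-valued $q$-forms with $\int_D|\alpha|_g^2\,d\lambda<\infty$, let $d:L^2_{q-1}(D,E)\to L^2_q(D,E)$ be the maximal (weak) exterior derivative and $d^*$ its Hilbert space adjoint. Let $$\Theta_E=-\sum_{i,j=1}^n\frac{\partial}{\partial x_i}\Big(g^{-1}\frac{\partial g}{\partial x_j}\Big)\,dx_i\wedge\frac{\partial}{\partial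 x_j}\lrcorner$$ be the curvature operator on $E$-valued $q$-forms, which at each point is symmetric with respect to $\langle\cdot,\cdot\rangle_g$. Assume that $(E,g)$ is Nakano $q$-semipositive, i.e. $\langle\Theta_E\alpha,\alpha\rangle_g\ge 0$ at every point of $D$ for every $E$-valued $q$-form $\alpha$. At each point, $\langle\Theta_E^{-1}f,f\rangle_g\in[0,+\infty]$ denotes $\langle w,f\rangle_g$ for any $w$ with $\Theta_E w=f$ (the value does not depend on $w$), and $+\infty$ if $f$ is not in the range of $\Theta_E$. Then for every $d$-closed $E$-valued $q$-form $f$ that is smooth on $\overline D$ (up to the boundary), belongs to $\mathrm{Dom}(d^*)$, and satisfies $$\int_D\langle\Theta_E^{-1}f,f\rangle_g\,d\lambda<+\infty,$$ there is $u\in L^2_{q-1}(D,E)$ with $du=f$ in the sense of distributions on $D$ and $$\int_D|u|_g^2\,d\lambda\le\int_D\langle\Theta_E^{-1}f,f\rangle_g\,d\lambda.$$ -/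

import Mathlib

open scoped ContDiff
open MeasureTheory

/-- The space of exterior `q`-forms on `ℝⁿ` with values in the fibre `ℝʳ`, i.e. the fibre of
`⋀^q T^*D ⊗ E` for the trivial (flat) bundle `E = D × ℝʳ`. An `E`-valued `q`-form on `D` is a
function from `ℝⁿ` to this space of which only the values on `D` matter. -/
abbrev EForm (n r q : ℕ) : Type :=
  EuclideanSpace ℝ (Fin n) [⋀^Fin q]→L[ℝ] (Fin r → ℝ)

namespace FlatBundle

/-- The coordinate vector field `∂/∂x_i`. -/
noncomputable def coordVec {n : ℕ} (i : Fin n) : EuclideanSpace ℝ (Fin n) :=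
  EuclideanSpace.single i (1 : ℝ)

/-- The coefficient `α_{I,τ}` of `α = ∑_τ ∑_I α_{I,τ} dx_I ⊗ e_τ`, for an increasing
multi-index `I`. -/
noncomputable def coeff {n r q : ℕ} (α : EForm n r q) (I : Fin q ↪o Fin n) (τ : Fin r) : ℝ :=
  α (fun k => coordVec (I k)) τ

/-- The pointwise inner product `⟨α, β⟩_g = ∑_{τ,ξ} ∑_I α_{I,τ} β_{I,ξ} g_{τξ}`, the sum being over
increasing multi-indices `I`; `G` is the value of the metric at the point. -/
noncomputable def formInner {n r q : ℕ} (G : Matrix (Fin r) (Fin r) ℝ) (α β : EForm n r q) : ℝ :=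
  ∑ τ : Fin r, ∑ ξ : Fin r, ∑ I : Fin q ↪o Fin n, coeff α I τ * coeff β I ξ * G τ ξ

/-- `g` is a `C²` Riemannian metric on `E = D × ℝʳ`: a `C²` map on `D` into the positive definite
symmetric matrices, `g_{τξ} = ⟨e_τ, e_ξ⟩`. -/
def IsC2Metric {n r : ℕ} (D : Set (EuclideanSpace ℝ (Fin n)))
    (g : EuclideanSpace ℝ (Fin n) → Matrix (Fin r) (Fin r) ℝ) : Prop :=
  (∀ x ∈ D, (g x).PosDef) ∧ ∀ τ ξ : Fin r, ContDiffOn ℝ 2 (fun x => g x τ ξ) D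

/-- Entrywise partial derivative `∂M/∂x_j` of a matrix-valued function. -/
noncomputable def matrixPartial {n r : ℕ}
    (M : EuclideanSpace ℝ (Fin n) → Matrix (Fin r) (Fin r) ℝ) (j : Fin n)
    (x : EuclideanSpace ℝ (Fin n)) : Matrix (Fin r) (Fin r) ℝ :=
  Matrix.of fun τ ξ => fderiv ℝ (fun y => M y τ ξ) x (coordVec j)

/-- The wedge product `θ ∧ β` of a covector with an `E`-valued `q`-form:
`(θ ∧ β)(v₀, …, v_q) = ∑_k (-1)^k θ(v_k) β(v₀, …, v̂_k, …, v_q)`. -/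
noncomputable def wedgeCovector {n r q : ℕ} (θ : EuclideanSpace ℝ (Fin n) →L[ℝ] ℝ)
    (β : EForm n r q) : EForm n r (q + 1) :=
  ContinuousAlternatingMap.alternatizeUncurryFin (θ.smulRight β)

/-- The interior product `v ⌟ α`. -/
noncomputable def contract {n r q : ℕ} (v : EuclideanSpace ℝ (Fin n)) (α : EForm n r (q + 1)) :
    EForm n r q :=
  α.curryLeft v

/-- A matrix acting on the values of an `E`-valued form (endomorphism of the fibre). -/
noncomputable def matrixAct {n r q : ℕ} (M : Matrix (Fin r) (Fin r) ℝ) (α : EForm n r q) :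
    EForm n r q :=
  (LinearMap.toContinuousLinearMap (Matrix.mulVecLin M)).compContinuousAlternatingMap α

/-- The curvature operator of the metric `g` at the point `x`, on `(q+1)`-forms:
`Θ_E α = - ∑_{i,j} ∂_i (g⁻¹ ∂_j g) dx_i ∧ (∂_j ⌟ α)`, the product `g⁻¹ ∂_j g` being the matrix
product. -/
noncomputable def curvatureOp {n r q : ℕ}
    (g : EuclideanSpace ℝ (Fin n) → Matrix (Fin r) (Fin r) ℝ) (x : EuclideanSpace ℝ (Fin n))
    (α : EForm n r (q + 1)) : EForm n r (q + 1) :=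
  -∑ i : Fin n, ∑ j : Fin n,
    matrixAct (matrixPartial (fun y => (g y)⁻¹ * matrixPartial g j y) i x)
      (wedgeCovector (EuclideanSpace.proj i) (contract (coordVec j) α))

/-- `(E, g)` is Nakano `(q+1)`-semipositive over `D`: at every point of `D` the form
`⟨Θ_E α, α⟩_g` is nonnegative on `(q+1)`-forms. -/
def NakanoSemipositive {n r : ℕ} (q : ℕ) (D : Set (EuclideanSpace ℝ (Fin n)))
    (g : EuclideanSpace ℝ (Fin n) → Matrix (Fin r) (Fin r) ℝ) : Prop :=
  ∀ x ∈ D, ∀ α : EForm n r (q + 1), 0 ≤ formInner (g x) (curvatureOp g x α) α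

/-- The quantity `⟨Θ_E⁻¹ β, β⟩_g ∈ [0, ∞]` at the point `x`: it is `⟨w, β⟩_g` where `Θ_E w = β`, and
`+∞` if `β` is not in the range of `Θ_E`. As `Θ_E` is symmetric for `⟨·,·⟩_g`, the value does not
depend on the choice of `w`; if `Θ_E` is invertible then `w = Θ_E⁻¹ β`. -/
noncomputable def curvatureInvForm {n r q : ℕ}
    (g : EuclideanSpace ℝ (Fin n) → Matrix (Fin r) (Fin r) ℝ) (x : EuclideanSpace ℝ (Fin n))
    (β : EForm n r (q + 1)) : ENNReal :=
  ⨅ (w : EForm n r (q + 1)) (_ : curvatureOp g x w = β), ENNReal.ofReal (formInner (g x) w β)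

/-- The square `∫_D |u|²_g dλ ∈ [0, ∞]` of the `L²` norm. -/
noncomputable def normSq {n r q : ℕ} (D : Set (EuclideanSpace ℝ (Fin n)))
    (g : EuclideanSpace ℝ (Fin n) → Matrix (Fin r) (Fin r) ℝ)
    (u : EuclideanSpace ℝ (Fin n) → EForm n r q) : ENNReal :=
  ∫⁻ x in D, ENNReal.ofReal (formInner (g x) (u x) (u x))

/-- `u ∈ L²_q(D, E)` with respect to the metric `g`. -/
def MemL2 {n r q : ℕ} (D : Set (EuclideanSpace ℝ (Fin n)))
    (g : EuclideanSpace ℝ (Fin n) → Matrix (Fin r) (Fin r) ℝ)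
    (u : EuclideanSpace ℝ (Fin n) → EForm n r q) : Prop :=
  AEStronglyMeasurable u (volume.restrict D) ∧ normSq D g u < ⊤

/-- `du = v` on `D` in the sense of distributions: `u`, `v` are locally integrable on `D` and
`∫_D φ v dλ = - ∫_D dφ ∧ u dλ` (coefficientwise) for every test function `φ ∈ C_c^∞(D)`. -/
def IsWeakD {n r q : ℕ} (D : Set (EuclideanSpace ℝ (Fin n)))
    (u : EuclideanSpace ℝ (Fin n) → EForm n r q)
    (v : EuclideanSpace ℝ (Fin n) → EForm n r (q + 1)) : Prop :=
  LocallyIntegrableOn u D ∧ LocallyIntegrableOn v D ∧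
    ∀ φ : EuclideanSpace ℝ (Fin n) → ℝ, ContDiff ℝ ∞ φ → HasCompactSupport φ → tsupport φ ⊆ D →
      ∫ x in D, φ x • v x = -∫ x in D, wedgeCovector (fderiv ℝ φ x) (u x)

/-- `f ∈ Dom(d^*)`, where `d^*` is the Hilbert space adjoint of the maximal (weak) operator
`d : L²_q(D, E) → L²_{q+1}(D, E)`: there is `h ∈ L²_q(D, E)` with `⟨⟨du, f⟩⟩_g = ⟨⟨u, h⟩⟩_g` for all
`u ∈ Dom(d)`. -/
def MemDomAdjoint {n r q : ℕ} (D : Set (EuclideanSpace ℝ (Fin n)))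
    (g : EuclideanSpace ℝ (Fin n) → Matrix (Fin r) (Fin r) ℝ)
    (f : EuclideanSpace ℝ (Fin n) → EForm n r (q + 1)) : Prop :=
  MemL2 D g f ∧ ∃ h : EuclideanSpace ℝ (Fin n) → EForm n r q, MemL2 D g h ∧
    ∀ (u : EuclideanSpace ℝ (Fin n) → EForm n r q)
      (v : EuclideanSpace ℝ (Fin n) → EForm n r (q + 1)),
      MemL2 D g u → MemL2 D g v → IsWeakD D u v →
        ∫ x in D, formInner (g x) (v x) (f x) = ∫ x in D, formInner (g x) (u x) (h x)

end FlatBundle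

/-!
The proof is the `L²` method of Hörmander and Demailly for the flat bundle `E`. Write `δ` for the
formal adjoint of `d` for the flat metrics. By the Riesz representation theorem (`exists_solution`),
it is enough to prove the dual inequality
`|∫ ⟨f, γ⟩|² ≤ ∫ ⟨Θ⁻¹ f, f⟩_g · ∫ |g⁻¹ δγ|²_g` for all `C²` test forms `γ` with compact support in `D`
(`sq_setIntegral_flatInner_le`); here `⟨f, γ⟩` is the flat pairing, so that `γ` plays the role of
`g` applied to an `E`-valued form, and `g⁻¹ δγ` that of the adjoint of `d` on that form.

The curvature enters through the Bochner inequality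
`∫ |dβ|²_G + |d*_G β|²_G - ⟨Θ_G β, β⟩_G ≥ 0` for `β` with compact support in `D`. For `C²` forms the
integrand is a sum of squares plus a divergence (`integral_bochnerForm_nonneg`). As `d` and `δ` have
constant coefficients, mollification and Fatou's lemma extend the inequality to square integrable
`β` with compact support for which `dβ` and `δβ` are square integrable
(`setIntegral_bochnerForm_nonneg_of_weak`).

Given `γ`, let `α` be the orthogonal projection of `G⁻¹ γ` to the weakly closed forms. Then `dα = 0`,
`δ(Gα) = δγ`, and, as `f` is closed, `∫ ⟨γ, f⟩ = ⟨⟨α, f⟩⟩_G` (`exists_isWeakSolution`). If the Bochner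
inequality could be applied to `α`, it would give `∫ ⟨Θ_G α, α⟩_G ≤ ∫ |G⁻¹ δγ|²_G`, and the dual
inequality would follow from `2⟨f, α⟩ - ⟨Θα, α⟩ ≤ ⟨Θ⁻¹ f, f⟩` (`ofReal_le_curvatureInvForm`). But `α`
does not have compact support, and with a cut-off function `η` there is an error term
`∫ |dη|² |α|²_G` (`IsWeakSolution.setIntegral_curvature_le`).

The error is absorbed by a weight. A convex domain has, for a given compact subset, a strictly convex
function `p` which is negative there and positive outside of a larger compact subset
(`exists_exhaustion`). For `G = exp (-χ) g` with `χ = exp (t p)`, the curvature of `G` exceeds that of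
`g` by the Hessian of `χ` (`formInner_curvatureOp_weight`). For large `t` this is large where `p > 0`,
in particular on the support of `dη`, while `χ` is close to `0` on the support of `γ`. The curvature
inequality for a second, larger cut-off function then shows that the error of the first one is
`O(1/t)` (`two_mul_setIntegral_flatInner_le`), and the limit `t → ∞` gives the inequality for `g`
itself (`two_mul_setIntegral_flatInner_le_add`).
-/


namespace FlatBundle

/-! ### Pointwise algebra of `E`-valued forms -/

section Algebra

variable {n r q : ℕ}

/-- The inner product of `E`-valued forms for the standard metric of the fibre `ℝʳ`. -/
noncomputable def flatInner (α β : EForm n r q) : ℝ :=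
  ∑ τ : Fin r, ∑ I : Fin q ↪o Fin n, coeff α I τ * coeff β I τ

theorem coeff_add (α β : EForm n r q) (I : Fin q ↪o Fin n) (τ : Fin r) :
    coeff (α + β) I τ = coeff α I τ + coeff β I τ := by simp [coeff]

theorem coeff_smul (c : ℝ) (α : EForm n r q) (I : Fin q ↪o Fin n) (τ : Fin r) :
    coeff (c • α) I τ = c * coeff α I τ := by simp [coeff]

theorem flatInner_add_left (α β γ : EForm n r q) :
    flatInner (α + β) γ = flatInner α γ + flatInner β γ := by
  simp [flatInner, coeff_add, add_mul, Finset.sum_add_distrib]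

theorem flatInner_smul_left (c : ℝ) (α γ : EForm n r q) :
    flatInner (c • α) γ = c * flatInner α γ := by
  simp [flatInner, coeff_smul, Finset.mul_sum, mul_assoc]

theorem flatInner_comm (α β : EForm n r q) : flatInner α β = flatInner β α := by
  simp [flatInner, mul_comm]

theorem flatInner_self_nonneg (α : EForm n r q) : 0 ≤ flatInner α α :=
  Finset.sum_nonneg fun _ _ => Finset.sum_nonneg fun _ _ => mul_self_nonneg _

/-- A form vanishes as soon as its values on increasing tuples of coordinate vectors vanish: any
other tuple of coordinate vectors has a repetition or is a permutation of an increasing one. -/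
theorem eq_zero_of_coeff_eq_zero (α : EForm n r q) (h : ∀ I τ, coeff α I τ = 0) : α = 0 := by
  have h1 : ∀ K : Fin q → Fin n, α (fun k => coordVec (K k)) = 0 := by
    intro K
    by_cases hK : Function.Injective K
    · have hs : StrictMono (K ∘ Tuple.sort K) :=
        (Tuple.monotone_sort K).strictMono_of_injective (hK.comp (Tuple.sort K).injective)
      have h2 : α (fun k => coordVec ((K ∘ Tuple.sort K) k)) = 0 := by
        ext τ
        exact h (OrderEmbedding.ofStrictMono _ hs) τ
      have h3 := α.toAlternatingMap.map_perm (fun k => coordVec (K k)) (Tuple.sort K)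
      have h4 : α.toAlternatingMap ((fun k => coordVec (K k)) ∘ Tuple.sort K) = 0 := h2
      rw [h4] at h3
      have h5 := h3.symm
      rcases Int.units_eq_one_or (Equiv.Perm.sign (Tuple.sort K)) with h6 | h6 <;>
        rw [h6] at h5 <;> simpa using h5
    · simp only [Function.Injective, not_forall] at hK
      obtain ⟨i, j, hij, hne⟩ := hK
      exact α.map_eq_zero_of_eq _ (by simp [hij]) hne
  apply ContinuousAlternatingMap.toAlternatingMap_injective
  apply Module.Basis.ext_alternating (EuclideanSpace.basisFun (Fin n) ℝ).toBasis
  intro K _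
  simpa [coordVec] using h1 K

theorem eq_zero_of_flatInner_self (α : EForm n r q) (h : flatInner α α = 0) : α = 0 := by
  apply eq_zero_of_coeff_eq_zero
  intro I τ
  have h1 := (Finset.sum_eq_zero_iff_of_nonneg
    (fun _ _ => Finset.sum_nonneg fun _ _ => mul_self_nonneg _)).1 h τ (Finset.mem_univ _)
  have h2 := (Finset.sum_eq_zero_iff_of_nonneg
    (fun _ _ => mul_self_nonneg _)).1 h1 I (Finset.mem_univ _)
  simpa using h2

theorem coeff_matrixAct (M : Matrix (Fin r) (Fin r) ℝ) (α : EForm n r q) (I : Fin q ↪o Fin n)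
    (τ : Fin r) : coeff (matrixAct M α) I τ = ∑ ξ, M τ ξ * coeff α I ξ := by
  simp [coeff, matrixAct, Matrix.mulVec, dotProduct]

/-- Everything below is reduced to the flat pairing by this formula: the metric on forms is the flat
pairing twisted by the matrix of the metric on the fibre. -/
theorem formInner_eq (G : Matrix (Fin r) (Fin r) ℝ) (α β : EForm n r q) :
    formInner G α β = flatInner α (matrixAct G β) := by
  simp only [formInner, flatInner, coeff_matrixAct]
  refine Finset.sum_congr rfl fun τ _ => ?_
  rw [Finset.sum_comm]
  refine Finset.sum_congr rfl fun I _ => ?_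
  rw [Finset.mul_sum]
  exact Finset.sum_congr rfl fun ξ _ => by ring

theorem flatInner_matrixAct (M : Matrix (Fin r) (Fin r) ℝ) (α β : EForm n r q) :
    flatInner (matrixAct M α) β = flatInner α (matrixAct M.transpose β) := by
  rw [← formInner_eq, flatInner_comm, ← formInner_eq]
  simp only [formInner]
  rw [Finset.sum_comm]
  refine Finset.sum_congr rfl fun τ _ => Finset.sum_congr rfl fun ξ _ =>
    Finset.sum_congr rfl fun I _ => ?_
  simp only [Matrix.transpose_apply]
  ring

theorem matrixAct_apply (M : Matrix (Fin r) (Fin r) ℝ) (α : EForm n r q)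
    (v : Fin q → EuclideanSpace ℝ (Fin n)) : matrixAct M α v = M.mulVec (α v) := by
  simp [matrixAct]

theorem matrixAct_mul (M N : Matrix (Fin r) (Fin r) ℝ) (α : EForm n r q) :
    matrixAct (M * N) α = matrixAct M (matrixAct N α) := by
  ext v : 1
  simp [matrixAct_apply]

@[simp]
theorem matrixAct_one (α : EForm n r q) : matrixAct 1 α = α := by
  ext v : 1
  simp [matrixAct_apply]

theorem matrixAct_add_left (M N : Matrix (Fin r) (Fin r) ℝ) (α : EForm n r q) :
    matrixAct (M + N) α = matrixAct M α + matrixAct N α := by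
  ext v : 1
  simp [matrixAct_apply, Matrix.add_mulVec]

theorem matrixAct_smul_left (c : ℝ) (M : Matrix (Fin r) (Fin r) ℝ) (α : EForm n r q) :
    matrixAct (c • M) α = c • matrixAct M α := by
  ext v : 1
  simp [matrixAct_apply, Matrix.smul_mulVec]

theorem matrixAct_add (M : Matrix (Fin r) (Fin r) ℝ) (α β : EForm n r q) :
    matrixAct M (α + β) = matrixAct M α + matrixAct M β := by
  ext v : 1
  simp [matrixAct_apply, Matrix.mulVec_add]

theorem matrixAct_smul (c : ℝ) (M : Matrix (Fin r) (Fin r) ℝ) (α : EForm n r q) :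
    matrixAct M (c • α) = c • matrixAct M α := by
  ext v : 1
  simp [matrixAct_apply, Matrix.mulVec_smul]

theorem contract_apply (v : EuclideanSpace ℝ (Fin n)) (α : EForm n r (q + 1))
    (w : Fin q → EuclideanSpace ℝ (Fin n)) : contract v α w = α (Matrix.vecCons v w) := rfl

theorem wedgeCovector_apply (θ : EuclideanSpace ℝ (Fin n) →L[ℝ] ℝ) (β : EForm n r q)
    (w : Fin (q + 1) → EuclideanSpace ℝ (Fin n)) :
    wedgeCovector θ β w = ∑ k : Fin (q + 1), (-1 : ℝ) ^ (k : ℕ) • θ (w k) • β (k.removeNth w) := by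
  rw [wedgeCovector, ContinuousAlternatingMap.alternatizeUncurryFin_apply]
  refine Finset.sum_congr rfl fun k _ => ?_
  rcases Nat.even_or_odd (k : ℕ) with h | h <;> simp [h.neg_one_pow]

theorem contract_add (v : EuclideanSpace ℝ (Fin n)) (α β : EForm n r (q + 1)) :
    contract v (α + β) = contract v α + contract v β := by
  ext w : 1
  simp [contract_apply]

theorem contract_smul (v : EuclideanSpace ℝ (Fin n)) (c : ℝ) (α : EForm n r (q + 1)) :
    contract v (c • α) = c • contract v α := by
  ext w : 1
  simp [contract_apply]

theorem contract_add_left (v w : EuclideanSpace ℝ (Fin n)) (α : EForm n r (q + 1)) :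
    contract (v + w) α = contract v α + contract w α := by
  simp [contract]

theorem contract_smul_left (c : ℝ) (v : EuclideanSpace ℝ (Fin n)) (α : EForm n r (q + 1)) :
    contract (c • v) α = c • contract v α := by
  simp [contract]

theorem wedgeCovector_add (θ : EuclideanSpace ℝ (Fin n) →L[ℝ] ℝ) (α β : EForm n r q) :
    wedgeCovector θ (α + β) = wedgeCovector θ α + wedgeCovector θ β := by
  ext w : 1
  simp only [wedgeCovector_apply, ContinuousAlternatingMap.add_apply, smul_add,
    Finset.sum_add_distrib]

theorem wedgeCovector_smul (θ : EuclideanSpace ℝ (Fin n) →L[ℝ] ℝ) (c : ℝ) (α : EForm n r q) :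
    wedgeCovector θ (c • α) = c • wedgeCovector θ α := by
  ext w : 1
  simp only [wedgeCovector_apply, ContinuousAlternatingMap.smul_apply, Finset.smul_sum]
  refine Finset.sum_congr rfl fun k _ => ?_
  simp only [smul_smul]
  ring_nf

theorem wedgeCovector_add_left (θ η : EuclideanSpace ℝ (Fin n) →L[ℝ] ℝ) (α : EForm n r q) :
    wedgeCovector (θ + η) α = wedgeCovector θ α + wedgeCovector η α := by
  ext w : 1
  simp only [wedgeCovector_apply, ContinuousAlternatingMap.add_apply, add_apply,
    add_smul, smul_add, Finset.sum_add_distrib]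

theorem wedgeCovector_smul_left (c : ℝ) (θ : EuclideanSpace ℝ (Fin n) →L[ℝ] ℝ) (α : EForm n r q) :
    wedgeCovector (c • θ) α = c • wedgeCovector θ α := by
  ext w : 1
  simp only [wedgeCovector_apply, ContinuousAlternatingMap.smul_apply,
    _root_.smul_apply, Finset.smul_sum]
  refine Finset.sum_congr rfl fun k _ => ?_
  simp only [smul_smul, smul_eq_mul]
  ring_nf

/-- The Clifford relation `v ⌟ (θ ∧ β) + θ ∧ (v ⌟ β) = θ(v) β`. -/
theorem contract_wedgeCovector (v : EuclideanSpace ℝ (Fin n))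
    (θ : EuclideanSpace ℝ (Fin n) →L[ℝ] ℝ) (β : EForm n r (q + 1)) :
    contract v (wedgeCovector θ β) = θ v • β - wedgeCovector θ (contract v β) := by
  ext w : 1
  rw [contract_apply, ContinuousAlternatingMap.sub_apply, ContinuousAlternatingMap.smul_apply,
    wedgeCovector_apply, wedgeCovector_apply, Fin.sum_univ_succ, sub_eq_add_neg,
    ← Finset.sum_neg_distrib]
  congr 1
  · simp [Fin.removeNth_zero]
  · refine Finset.sum_congr rfl fun k _ => ?_
    have h : k.succ.removeNth (Matrix.vecCons v w) = Matrix.vecCons v (k.removeNth w) := by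
      ext j : 1
      refine Fin.cases ?_ (fun j => ?_) j <;> simp [Fin.removeNth, Matrix.vecCons]
    rw [h, contract_apply]
    simp [pow_succ]

theorem matrixAct_contract (M : Matrix (Fin r) (Fin r) ℝ) (v : EuclideanSpace ℝ (Fin n))
    (α : EForm n r (q + 1)) : matrixAct M (contract v α) = contract v (matrixAct M α) := by
  ext w : 1
  simp [matrixAct_apply, contract_apply]

theorem matrixAct_wedgeCovector (M : Matrix (Fin r) (Fin r) ℝ)
    (θ : EuclideanSpace ℝ (Fin n) →L[ℝ] ℝ) (α : EForm n r q) :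
    matrixAct M (wedgeCovector θ α) = wedgeCovector θ (matrixAct M α) := by
  ext w : 1
  simp only [matrixAct_apply, wedgeCovector_apply, Matrix.mulVec_sum, Matrix.mulVec_smul]

/-- Summing a symmetric expression over all tuples counts each increasing tuple `q!` times. -/
theorem sum_tuples_eq (α β : EForm n r q) (τ : Fin r) :
    ∑ K : Fin q → Fin n, α (fun k => coordVec (K k)) τ * β (fun k => coordVec (K k)) τ =
      (q.factorial : ℝ) * ∑ I : Fin q ↪o Fin n, coeff α I τ * coeff β I τ := by
  classical
  have hperm : ∀ (γ : EForm n r q) (K : Fin q → Fin n) (σ : Equiv.Perm (Fin q)),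
      γ (fun k => coordVec (K (σ k))) τ =
        ((Equiv.Perm.sign σ : ℤ) : ℝ) * γ (fun k => coordVec (K k)) τ := by
    intro γ K σ
    have h := congrFun (γ.toAlternatingMap.map_perm (fun k => coordVec (K k)) σ) τ
    rcases Int.units_eq_one_or (Equiv.Perm.sign σ) with h6 | h6 <;> rw [h6] at h ⊢ <;>
      simpa [Function.comp_def] using h
  -- the two signs cancel
  have hsq : ∀ (K : Fin q → Fin n) (σ : Equiv.Perm (Fin q)),
      α (fun k => coordVec (K (σ k))) τ * β (fun k => coordVec (K (σ k))) τ =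
        α (fun k => coordVec (K k)) τ * β (fun k => coordVec (K k)) τ := by
    intro K σ
    rw [hperm α, hperm β]
    rcases Int.units_eq_one_or (Equiv.Perm.sign σ) with h6 | h6 <;> rw [h6] <;> simp
  have h1 : ∑ K : Fin q → Fin n,
        α (fun k => coordVec (K k)) τ * β (fun k => coordVec (K k)) τ =
      ∑ K ∈ Finset.univ.filter (fun K : Fin q → Fin n => Function.Injective K),
        α (fun k => coordVec (K k)) τ * β (fun k => coordVec (K k)) τ := by
    symm
    apply Finset.sum_subset (Finset.subset_univ _)
    intro K _ hK
    simp only [Finset.mem_filter, Finset.mem_univ, true_and] at hK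
    simp only [Function.Injective, not_forall] at hK
    obtain ⟨i, j, hij, hne⟩ := hK
    rw [α.map_eq_zero_of_eq (fun k => coordVec (K k)) (by simp [hij]) hne]
    simp
  rw [h1]
  -- an injective tuple is an increasing one composed with a permutation, in a unique way
  have h2 : ∑ K ∈ Finset.univ.filter (fun K : Fin q → Fin n => Function.Injective K),
        α (fun k => coordVec (K k)) τ * β (fun k => coordVec (K k)) τ =
      ∑ x : (Fin q ↪o Fin n) × Equiv.Perm (Fin q), coeff α x.1 τ * coeff β x.1 τ := by
    symm
    refine Finset.sum_bij (fun x _ => fun k => x.1 (x.2 k)) ?_ ?_ ?_ ?_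
    · rintro ⟨I, σ⟩ _
      rw [Finset.mem_filter]
      exact ⟨Finset.mem_univ _, I.injective.comp σ.injective⟩
    · rintro ⟨I, σ⟩ _ ⟨J, ρ⟩ _ h
      have hr : Set.range I = Set.range J := by
        rw [← σ.surjective.range_comp I, ← ρ.surjective.range_comp J]
        exact congrArg Set.range h
      have hIJ : I = J := by
        have : (I : Fin q → Fin n) = J :=
          (StrictMono.range_inj I.strictMono J.strictMono).1 hr
        exact DFunLike.coe_injective this
      subst hIJ
      congr 1
      ext k : 1
      exact I.injective (congrFun h k)
    · intro K hK
      simp only [Finset.mem_filter, Finset.mem_univ, true_and] at hK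
      have hs : StrictMono (K ∘ Tuple.sort K) :=
        (Tuple.monotone_sort K).strictMono_of_injective (hK.comp (Tuple.sort K).injective)
      refine ⟨(OrderEmbedding.ofStrictMono _ hs, (Tuple.sort K)⁻¹), Finset.mem_univ _, ?_⟩
      ext k : 1
      simp
    · rintro ⟨I, σ⟩ _
      exact (hsq I σ).symm
  rw [h2, Fintype.sum_prod_type]
  simp only [Finset.sum_const, Finset.card_univ, Fintype.card_perm, Fintype.card_fin,
    nsmul_eq_mul, ← Finset.mul_sum]

/-- `∂_i ⌟` is adjoint to `dx_i ∧` for the flat pairing. Both sides are turned into sums over all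
tuples, where inserting `i` at position `k` removes the sign `(-1)^k` of the wedge product; the
`q + 1` positions account for the quotient of the factorials. -/
theorem flatInner_wedgeCovector_proj (i : Fin n) (β : EForm n r q) (α : EForm n r (q + 1)) :
    flatInner (wedgeCovector (EuclideanSpace.proj i) β) α =
      flatInner β (contract (coordVec i) α) := by
  unfold flatInner
  refine Finset.sum_congr rfl fun τ _ => ?_
  have hfac : ((q + 1).factorial : ℝ) ≠ 0 := by positivity
  apply mul_left_cancel₀ hfac
  rw [← sum_tuples_eq, Nat.factorial_succ, Nat.cast_mul, mul_assoc, ← sum_tuples_eq]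
  have h1 : ∀ K : Fin (q + 1) → Fin n,
      (wedgeCovector (EuclideanSpace.proj i) β) (fun k => coordVec (K k)) τ *
          α (fun k => coordVec (K k)) τ =
      ∑ k : Fin (q + 1), (-1 : ℝ) ^ (k : ℕ) * (if K k = i then 1 else 0) *
        β (fun j => coordVec (k.removeNth K j)) τ * α (fun k => coordVec (K k)) τ := by
    intro K
    rw [wedgeCovector_apply, Finset.sum_apply, Finset.sum_mul]
    refine Finset.sum_congr rfl fun k _ => ?_
    have : k.removeNth (fun k => coordVec (K k)) =
      fun j => (coordVec (k.removeNth K j) : EuclideanSpace ℝ (Fin n)) := rfl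
    rw [this]
    rcases eq_or_ne (K k) i with h | h
    · simp [coordVec, h, mul_assoc]
    · simp [coordVec, h, h.symm]
  simp_rw [h1]
  rw [Finset.sum_comm]
  have h2 : ∀ k : Fin (q + 1), ∑ K : Fin (q + 1) → Fin n,
      (-1 : ℝ) ^ (k : ℕ) * (if K k = i then 1 else 0) *
        β (fun j => coordVec (k.removeNth K j)) τ * α (fun k => coordVec (K k)) τ =
      ∑ K : Fin q → Fin n, β (fun j => coordVec (K j)) τ *
        contract (coordVec i) α (fun j => coordVec (K j)) τ := by
    intro k
    rw [← (Fin.insertNthEquiv (fun _ => Fin n) k).sum_comp, Fintype.sum_prod_type,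
      Finset.sum_eq_single i]
    · refine Finset.sum_congr rfl fun K _ => ?_
      have h3 : (fun k' => (coordVec ((Fin.insertNthEquiv (fun _ => Fin n) k) (i, K) k') :
          EuclideanSpace ℝ (Fin n))) = k.insertNth (coordVec i) (fun j => coordVec (K j)) := by
        ext k' : 1
        refine Fin.succAboveCases k ?_ (fun j => ?_) k' <;> simp
      have h4 := congrFun (α.toAlternatingMap.neg_one_pow_smul_map_insertNth k (coordVec i)
        (fun j => coordVec (K j))) τ
      rw [h3, contract_apply]
      have h5 : α (Matrix.vecCons (coordVec i) fun j => coordVec (K j)) τ =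
          (-1 : ℝ) ^ (k : ℕ) * α (k.insertNth (coordVec i) (fun j => coordVec (K j))) τ := by
        refine h4.symm.trans ?_
        rcases Nat.even_or_odd (k : ℕ) with h | h <;> simp [h.neg_one_pow]
      have h6 : (fun j => (coordVec (k.removeNth ((Fin.insertNthEquiv (fun _ => Fin n) k) (i, K)) j) :
          EuclideanSpace ℝ (Fin n))) = fun j => coordVec (K j) := by
        ext j : 1
        simp [Fin.removeNth]
      rw [h5, h6]
      simp
      ring
    · intro j _ hj
      refine Finset.sum_eq_zero fun K _ => ?_
      simp [hj]
    · simp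
  simp_rw [h2]
  simp

theorem covector_eq_sum (θ : EuclideanSpace ℝ (Fin n) →L[ℝ] ℝ) :
    θ = ∑ i, θ (coordVec i) • (EuclideanSpace.proj i : EuclideanSpace ℝ (Fin n) →L[ℝ] ℝ) := by
  ext v
  have hv : v = ∑ i, v i • coordVec i := by
    have := ((EuclideanSpace.basisFun (Fin n) ℝ).sum_repr v).symm
    simpa [coordVec] using this
  conv_lhs => rw [hv]
  simp [mul_comm]

end Algebra

/-! ### Continuity and differentiation of the fibrewise operations -/

section Calculus

variable {n r q : ℕ}

attribute [local instance] Matrix.normedAddCommGroup Matrix.normedSpace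

/-- A form is determined by its finitely many coefficients. -/
instance : FiniteDimensional ℝ (EForm n r q) := by
  let L : EForm n r q →ₗ[ℝ] ((Fin q ↪o Fin n) → Fin r → ℝ) :=
    { toFun := fun α I τ => coeff α I τ
      map_add' := fun α β => by ext I τ; simp [coeff_add]
      map_smul' := fun c α => by ext I τ; simp [coeff_smul] }
  refine FiniteDimensional.of_injective L ?_
  rw [injective_iff_map_eq_zero]
  intro α h
  exact eq_zero_of_coeff_eq_zero α fun I τ => congrFun (congrFun h I) τ

/-- The flat pairing as a continuous bilinear map. -/
noncomputable def flatInnerL : EForm n r q →L[ℝ] EForm n r q →L[ℝ] ℝ :=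
  (LinearMap.mk₂ ℝ flatInner flatInner_add_left flatInner_smul_left
    (fun a b c => by rw [flatInner_comm, flatInner_add_left, flatInner_comm b, flatInner_comm c])
    (fun c a b => by
      rw [flatInner_comm, flatInner_smul_left, flatInner_comm b, smul_eq_mul])).toContinuousBilinearMap

/-- The action of matrices on forms as a continuous bilinear map. -/
noncomputable def matrixActL : Matrix (Fin r) (Fin r) ℝ →L[ℝ] EForm n r q →L[ℝ] EForm n r q :=
  (LinearMap.mk₂ ℝ matrixAct matrixAct_add_left matrixAct_smul_left matrixAct_add
    matrixAct_smul).toContinuousBilinearMap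

@[simp]
theorem matrixActL_apply (M : Matrix (Fin r) (Fin r) ℝ) (α : EForm n r q) :
    matrixActL M α = matrixAct M α := rfl

/-- The interior product as a continuous bilinear map. -/
noncomputable def contractL :
    EuclideanSpace ℝ (Fin n) →L[ℝ] EForm n r (q + 1) →L[ℝ] EForm n r q :=
  (LinearMap.mk₂ ℝ contract contract_add_left contract_smul_left contract_add
    (fun c v α => contract_smul v c α)).toContinuousBilinearMap

@[simp]
theorem contractL_apply (v : EuclideanSpace ℝ (Fin n)) (α : EForm n r (q + 1)) :
    contractL v α = contract v α := rfl

/-- The wedge product with a covector as a continuous bilinear map. -/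
noncomputable def wedgeL :
    (EuclideanSpace ℝ (Fin n) →L[ℝ] ℝ) →L[ℝ] EForm n r q →L[ℝ] EForm n r (q + 1) :=
  (LinearMap.mk₂ ℝ wedgeCovector wedgeCovector_add_left wedgeCovector_smul_left wedgeCovector_add
    (fun c v α => wedgeCovector_smul v c α)).toContinuousBilinearMap

@[simp]
theorem wedgeL_apply (θ : EuclideanSpace ℝ (Fin n) →L[ℝ] ℝ) (α : EForm n r q) :
    wedgeL θ α = wedgeCovector θ α := rfl

/-- Matrix multiplication as a continuous bilinear map. -/
noncomputable def matrixMulL :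
    Matrix (Fin r) (Fin r) ℝ →L[ℝ] Matrix (Fin r) (Fin r) ℝ →L[ℝ] Matrix (Fin r) (Fin r) ℝ :=
  (LinearMap.mul ℝ (Matrix (Fin r) (Fin r) ℝ)).toContinuousBilinearMap

theorem flatInner_add_right (α β γ : EForm n r q) :
    flatInner α (β + γ) = flatInner α β + flatInner α γ := map_add (flatInnerL α) β γ

theorem flatInner_sub_right (α β γ : EForm n r q) :
    flatInner α (β - γ) = flatInner α β - flatInner α γ := map_sub (flatInnerL α) β γ

theorem flatInner_neg_right (α β : EForm n r q) :
    flatInner α (-β) = -flatInner α β := map_neg (flatInnerL α) β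

theorem flatInner_smul_right (c : ℝ) (α β : EForm n r q) :
    flatInner α (c • β) = c * flatInner α β := map_smul (flatInnerL α) c β

theorem flatInner_zero_right (α : EForm n r q) : flatInner α 0 = 0 := map_zero (flatInnerL α)

theorem flatInner_zero_left (α : EForm n r q) : flatInner 0 α = 0 := by
  rw [flatInner_comm, flatInner_zero_right]

theorem flatInner_sub_left (α β γ : EForm n r q) :
    flatInner (α - β) γ = flatInner α γ - flatInner β γ := by
  simp only [flatInner_comm _ γ, flatInner_sub_right]

theorem flatInner_neg_left (α β : EForm n r q) : flatInner (-α) β = -flatInner α β := by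
  simp only [flatInner_comm _ β, flatInner_neg_right]

theorem flatInner_sum_right {ι : Type*} (s : Finset ι) (α : EForm n r q) (f : ι → EForm n r q) :
    flatInner α (∑ i ∈ s, f i) = ∑ i ∈ s, flatInner α (f i) := map_sum (flatInnerL α) f s

theorem flatInner_sum_left {ι : Type*} (s : Finset ι) (f : ι → EForm n r q) (α : EForm n r q) :
    flatInner (∑ i ∈ s, f i) α = ∑ i ∈ s, flatInner (f i) α := by
  simp only [flatInner_comm _ α, flatInner_sum_right]

theorem matrixAct_sum {ι : Type*} (s : Finset ι) (M : Matrix (Fin r) (Fin r) ℝ)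
    (f : ι → EForm n r q) : matrixAct M (∑ i ∈ s, f i) = ∑ i ∈ s, matrixAct M (f i) :=
  map_sum (matrixActL M) f s

theorem matrixAct_sub (M : Matrix (Fin r) (Fin r) ℝ) (α β : EForm n r q) :
    matrixAct M (α - β) = matrixAct M α - matrixAct M β := map_sub (matrixActL M) α β

theorem matrixAct_neg (M : Matrix (Fin r) (Fin r) ℝ) (α : EForm n r q) :
    matrixAct M (-α) = -matrixAct M α := map_neg (matrixActL M) α

theorem matrixAct_zero (M : Matrix (Fin r) (Fin r) ℝ) :
    matrixAct M (0 : EForm n r q) = 0 := map_zero (matrixActL M)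

theorem matrixAct_neg_left (M : Matrix (Fin r) (Fin r) ℝ) (α : EForm n r q) :
    matrixAct (-M) α = -matrixAct M α := by
  rw [← matrixActL_apply, map_neg]; rfl

theorem matrixAct_sub_left (M N : Matrix (Fin r) (Fin r) ℝ) (α : EForm n r q) :
    matrixAct (M - N) α = matrixAct M α - matrixAct N α := by
  rw [← matrixActL_apply, map_sub]; rfl

theorem contract_zero (v : EuclideanSpace ℝ (Fin n)) :
    contract v (0 : EForm n r (q + 1)) = 0 := map_zero (contractL v)

theorem wedgeCovector_zero (θ : EuclideanSpace ℝ (Fin n) →L[ℝ] ℝ) :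
    wedgeCovector θ (0 : EForm n r q) = 0 := map_zero (wedgeL θ)

theorem wedgeCovector_zero_left (α : EForm n r q) :
    wedgeCovector (0 : EuclideanSpace ℝ (Fin n) →L[ℝ] ℝ) α = 0 := by
  rw [← wedgeL_apply, map_zero]; rfl

theorem wedgeCovector_sum_left {ι : Type*} (s : Finset ι)
    (θ : ι → EuclideanSpace ℝ (Fin n) →L[ℝ] ℝ) (α : EForm n r q) :
    wedgeCovector (∑ i ∈ s, θ i) α = ∑ i ∈ s, wedgeCovector (θ i) α := by
  rw [← wedgeL_apply, map_sum, _root_.sum_apply]; rfl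

/-- The partial derivative `∂F/∂x_i`. -/
noncomputable def partialDeriv {X : Type*} [NormedAddCommGroup X] [NormedSpace ℝ X] (i : Fin n)
    (F : EuclideanSpace ℝ (Fin n) → X) (x : EuclideanSpace ℝ (Fin n)) : X :=
  fderiv ℝ F x (coordVec i)

theorem partialDeriv_clm {X Y : Type*} [NormedAddCommGroup X] [NormedSpace ℝ X]
    [NormedAddCommGroup Y] [NormedSpace ℝ Y] (L : X →L[ℝ] Y) (i : Fin n)
    {F : EuclideanSpace ℝ (Fin n) → X} {x : EuclideanSpace ℝ (Fin n)}
    (hF : DifferentiableAt ℝ F x) :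
    partialDeriv i (fun y => L (F y)) x = L (partialDeriv i F x) := by
  have h : HasFDerivAt (fun y => L (F y)) (L.comp (fderiv ℝ F x)) x :=
    L.hasFDerivAt.comp x hF.hasFDerivAt
  unfold partialDeriv
  rw [h.fderiv]
  rfl

theorem partialDeriv_bilin {X Y Z : Type*} [NormedAddCommGroup X] [NormedSpace ℝ X]
    [NormedAddCommGroup Y] [NormedSpace ℝ Y] [NormedAddCommGroup Z] [NormedSpace ℝ Z]
    (B : X →L[ℝ] Y →L[ℝ] Z) (i : Fin n)
    {F : EuclideanSpace ℝ (Fin n) → X} {H : EuclideanSpace ℝ (Fin n) → Y}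
    {x : EuclideanSpace ℝ (Fin n)}
    (hF : DifferentiableAt ℝ F x) (hH : DifferentiableAt ℝ H x) :
    partialDeriv i (fun y => B (F y) (H y)) x =
      B (F x) (partialDeriv i H x) + B (partialDeriv i F x) (H x) := by
  unfold partialDeriv
  rw [B.fderiv_of_bilinear hF hH]
  simp

theorem contDiffOn_partialDeriv {X : Type*} [NormedAddCommGroup X] [NormedSpace ℝ X]
    {D : Set (EuclideanSpace ℝ (Fin n))} (hD : IsOpen D) {F : EuclideanSpace ℝ (Fin n) → X}
    {k m : ℕ∞ω} (hF : ContDiffOn ℝ k F D) (hk : m + 1 ≤ k) (i : Fin n) :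
    ContDiffOn ℝ m (partialDeriv i F) D :=
  (hF.fderiv_of_isOpen hD hk).clm_apply contDiffOn_const

theorem partialDeriv_comm {X : Type*} [NormedAddCommGroup X] [NormedSpace ℝ X]
    {D : Set (EuclideanSpace ℝ (Fin n))} (hD : IsOpen D) {F : EuclideanSpace ℝ (Fin n) → X}
    (hF : ContDiffOn ℝ 2 F D) {x : EuclideanSpace ℝ (Fin n)} (hx : x ∈ D) (i j : Fin n) :
    partialDeriv i (partialDeriv j F) x = partialDeriv j (partialDeriv i F) x := by
  have h1 : ContDiffAt ℝ 2 F x := hF.contDiffAt (hD.mem_nhds hx)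
  have h2 : DifferentiableAt ℝ (fderiv ℝ F) x :=
    (h1.fderiv_right (m := 1) (by norm_num)).differentiableAt one_ne_zero
  have h3 : ∀ i j : Fin n, partialDeriv i (partialDeriv j F) x =
      fderiv ℝ (fderiv ℝ F) x (coordVec i) (coordVec j) := by
    intro i j
    change fderiv ℝ (fun y => fderiv ℝ F y (coordVec j)) x (coordVec i) = _
    rw [fderiv_clm_apply h2 (differentiableAt_const _)]
    simp
  rw [h3, h3]
  exact (h1.isSymmSndFDerivAt (by simp)) _ _

theorem contDiffOn_matrix {k : ℕ∞ω} {D : Set (EuclideanSpace ℝ (Fin n))}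
    {M : EuclideanSpace ℝ (Fin n) → Matrix (Fin r) (Fin r) ℝ} :
    ContDiffOn ℝ k M D ↔ ∀ τ ξ, ContDiffOn ℝ k (fun x => M x τ ξ) D := by
  have h1 : ContDiffOn ℝ k M D ↔ ∀ τ, ContDiffOn ℝ k (fun x => M x τ) D :=
    contDiffOn_pi (F' := fun _ : Fin r => Fin r → ℝ)
  rw [h1]
  exact forall_congr' fun τ => contDiffOn_pi

theorem matrixPartial_eq {M : EuclideanSpace ℝ (Fin n) → Matrix (Fin r) (Fin r) ℝ} {j : Fin n}
    {x : EuclideanSpace ℝ (Fin n)} (hM : DifferentiableAt ℝ M x) :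
    matrixPartial M j x = partialDeriv j M x := by
  ext τ ξ
  have h1 : HasFDerivAt M (fderiv ℝ M x) x := hM.hasFDerivAt
  let L : Matrix (Fin r) (Fin r) ℝ →ₗ[ℝ] ℝ := Matrix.entryLinearMap ℝ ℝ τ ξ
  have h2 := (LinearMap.toContinuousLinearMap L).hasFDerivAt.comp x h1
  change fderiv ℝ (fun y => M y τ ξ) x (coordVec j) = _
  rw [show (fun y => M y τ ξ) = (LinearMap.toContinuousLinearMap L) ∘ M from rfl, h2.fderiv]
  rfl

theorem contDiffOn_matrixPartial {D : Set (EuclideanSpace ℝ (Fin n))} (hD : IsOpen D)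
    {M : EuclideanSpace ℝ (Fin n) → Matrix (Fin r) (Fin r) ℝ}
    {k m : ℕ∞ω} (hM : ContDiffOn ℝ k M D) (hk : m + 1 ≤ k) (i : Fin n) :
    ContDiffOn ℝ m (matrixPartial M i) D :=
  contDiffOn_matrix.2 fun τ ξ =>
    contDiffOn_partialDeriv hD (contDiffOn_matrix.1 hM τ ξ) hk i

theorem contDiffOn_matrix_det {k : ℕ∞ω} {D : Set (EuclideanSpace ℝ (Fin n))}
    {M : EuclideanSpace ℝ (Fin n) → Matrix (Fin r) (Fin r) ℝ} (hM : ContDiffOn ℝ k M D) :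
    ContDiffOn ℝ k (fun x => (M x).det) D := by
  simp only [Matrix.det_apply]
  refine ContDiffOn.sum fun σ _ => ContDiffOn.const_smul _ ?_
  exact contDiffOn_prod fun i _ => contDiffOn_matrix.1 hM _ _

theorem contDiffOn_matrix_inv {k : ℕ∞ω} {D : Set (EuclideanSpace ℝ (Fin n))}
    {M : EuclideanSpace ℝ (Fin n) → Matrix (Fin r) (Fin r) ℝ} (hM : ContDiffOn ℝ k M D)
    (hdet : ∀ x ∈ D, (M x).det ≠ 0) : ContDiffOn ℝ k (fun x => (M x)⁻¹) D := by
  rw [contDiffOn_matrix]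
  intro τ ξ
  have h : ∀ x, (M x)⁻¹ τ ξ =
      (M x).det⁻¹ * ((M x).updateRow ξ (Pi.single τ 1)).det := by
    intro x
    rw [Matrix.inv_def, Matrix.smul_apply, Matrix.adjugate_apply, Ring.inverse_eq_inv', smul_eq_mul]
  simp only [h]
  refine ContDiffOn.mul ((contDiffOn_matrix_det hM).inv hdet) (contDiffOn_matrix_det ?_)
  rw [contDiffOn_matrix]
  intro a b
  by_cases ha : a = ξ
  · subst ha
    simpa using contDiffOn_const
  · simpa [Matrix.updateRow_ne ha] using contDiffOn_matrix.1 hM a b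

/-- The divergence theorem for functions with compact support. -/
theorem setIntegral_partialDeriv_eq_zero {D : Set (EuclideanSpace ℝ (Fin n))} (hD : IsOpen D)
    {h : EuclideanSpace ℝ (Fin n) → ℝ} (hh : ContDiffOn ℝ 1 h D) (hc : HasCompactSupport h)
    (hs : tsupport h ⊆ D) (i : Fin n) :
    Integrable (partialDeriv i h) ∧ ∫ x in D, partialDeriv i h x = 0 := by
  have hh' : ContDiff ℝ 1 h := by
    refine contDiff_iff_contDiffAt.2 fun x => ?_
    by_cases hx : x ∈ D
    · exact hh.contDiffAt (hD.mem_nhds hx)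
    · have : h =ᶠ[nhds x] fun _ => 0 := notMem_tsupport_iff_eventuallyEq.1 fun hx' => hx (hs hx')
      exact contDiffAt_const.congr_of_eventuallyEq this
  have hcont : Continuous (partialDeriv i h) :=
    (hh'.continuous_fderiv one_ne_zero).clm_apply continuous_const
  have hcs : HasCompactSupport (partialDeriv i h) :=
    hc.fderiv_apply (𝕜 := ℝ) (coordVec i)
  have hint : Integrable (partialDeriv i h) := hcont.integrable_of_hasCompactSupport hcs
  refine ⟨hint, ?_⟩
  rw [setIntegral_eq_integral_of_forall_compl_eq_zero]
  · have := integral_mul_fderiv_eq_neg_fderiv_mul_of_integrable (μ := volume)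
      (f := fun _ : EuclideanSpace ℝ (Fin n) => (1 : ℝ)) (g := h) (v := coordVec i)
      (by simp) (by simp only [one_mul]; exact hint)
      (by simpa using hh'.continuous.integrable_of_hasCompactSupport hc)
      (fun x _ => differentiableAt_const _)
      (fun x _ => (hh'.differentiable one_ne_zero) x)
    simpa [partialDeriv] using this
  · intro x hx
    have hx' : x ∉ tsupport h := fun h' => hx (hs h')
    have : h =ᶠ[nhds x] fun _ => 0 := notMem_tsupport_iff_eventuallyEq.1 hx'
    simp [partialDeriv, this.fderiv_eq]

end Calculus

/-! ### The Bochner inequality for compactly supported forms -/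

section Bochner

variable {n r q : ℕ}

attribute [local instance] Matrix.normedAddCommGroup Matrix.normedSpace

/-- The formal adjoint `δγ = -∑_i ∂_i ⌟ ∂γ/∂x_i` of the exterior derivative for the flat metric. -/
noncomputable def codiff (γ : EuclideanSpace ℝ (Fin n) → EForm n r (q + 1))
    (x : EuclideanSpace ℝ (Fin n)) : EForm n r q :=
  -∑ i, contract (coordVec i) (partialDeriv i γ x)

/-- The connection matrix `Γ_i = G⁻¹ ∂_i G` of the metric `G`. -/
noncomputable def connection (G : EuclideanSpace ℝ (Fin n) → Matrix (Fin r) (Fin r) ℝ) (i : Fin n)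
    (x : EuclideanSpace ℝ (Fin n)) : Matrix (Fin r) (Fin r) ℝ :=
  (G x)⁻¹ * matrixPartial G i x

theorem formInner_eq_sum (G : Matrix (Fin r) (Fin r) ℝ) (α β : EForm n r q) :
    formInner G α β = ∑ I : Fin q ↪o Fin n,
      (fun τ => coeff α I τ) ⬝ᵥ (G.mulVec fun τ => coeff β I τ) := by
  rw [formInner_eq, flatInner, Finset.sum_comm]
  simp only [coeff_matrixAct]
  rfl

theorem formInner_self_nonneg {G : Matrix (Fin r) (Fin r) ℝ} (hG : G.PosSemidef)
    (α : EForm n r q) : 0 ≤ formInner G α α := by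
  rw [formInner_eq_sum]
  exact Finset.sum_nonneg fun I _ => by simpa using hG.dotProduct_mulVec_nonneg _

theorem formInner_self_pos {G : Matrix (Fin r) (Fin r) ℝ} (hG : G.PosDef)
    {α : EForm n r q} (hα : α ≠ 0) : 0 < formInner G α α := by
  refine lt_of_le_of_ne (formInner_self_nonneg hG.posSemidef α) fun h => hα ?_
  apply eq_zero_of_coeff_eq_zero
  intro I τ
  rw [formInner_eq_sum] at h
  have h1 := (Finset.sum_eq_zero_iff_of_nonneg fun I _ => by
    simpa using hG.posSemidef.dotProduct_mulVec_nonneg _).1 h.symm I (Finset.mem_univ _)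
  by_contra hne
  have h2 : (fun τ => coeff α I τ) ≠ 0 := fun h0 => hne (congrFun h0 τ)
  have h3 := hG.dotProduct_mulVec_pos h2
  simp at h3
  exact h3.ne' h1

theorem wedgeCovector_eq_sum (θ : EuclideanSpace ℝ (Fin n) →L[ℝ] ℝ) (α : EForm n r q) :
    wedgeCovector θ α = ∑ i, θ (coordVec i) • wedgeCovector (EuclideanSpace.proj i) α := by
  conv_lhs => rw [covector_eq_sum θ]
  rw [wedgeCovector_sum_left]
  exact Finset.sum_congr rfl fun i _ => wedgeCovector_smul_left _ _ _

theorem extDeriv_eq_sum (α : EuclideanSpace ℝ (Fin n) → EForm n r q)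
    (x : EuclideanSpace ℝ (Fin n)) :
    extDeriv α x = ∑ i, wedgeCovector (EuclideanSpace.proj i) (partialDeriv i α x) := by
  have h : fderiv ℝ α x = ∑ i, ((EuclideanSpace.proj i :
      EuclideanSpace ℝ (Fin n) →L[ℝ] ℝ)).smulRight (partialDeriv i α x) := by
    ext1 v
    have hv : v = ∑ i, v i • coordVec i := by
      have := ((EuclideanSpace.basisFun (Fin n) ℝ).sum_repr v).symm
      simpa [coordVec] using this
    conv_lhs => rw [hv]
    simp [partialDeriv, _root_.sum_apply]
  unfold extDeriv wedgeCovector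
  rw [h]
  exact map_sum (ContinuousAlternatingMap.alternatizeUncurryFinCLM ℝ (EuclideanSpace ℝ (Fin n))
    (Fin r → ℝ)) _ _

theorem contDiffOn_bilin {X Y Z : Type*} [NormedAddCommGroup X] [NormedSpace ℝ X]
    [NormedAddCommGroup Y] [NormedSpace ℝ Y] [NormedAddCommGroup Z] [NormedSpace ℝ Z]
    (B : X →L[ℝ] Y →L[ℝ] Z) {k : ℕ∞ω} {D : Set (EuclideanSpace ℝ (Fin n))}
    {F : EuclideanSpace ℝ (Fin n) → X} {H : EuclideanSpace ℝ (Fin n) → Y}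
    (hF : ContDiffOn ℝ k F D) (hH : ContDiffOn ℝ k H D) :
    ContDiffOn ℝ k (fun x => B (F x) (H x)) D :=
  ContDiffOn.clm_apply (f := fun x => B (F x)) (B.contDiff.comp_contDiffOn hF) hH

theorem contDiffOn_flatInner {k : ℕ∞ω} {D : Set (EuclideanSpace ℝ (Fin n))}
    {α β : EuclideanSpace ℝ (Fin n) → EForm n r q} (hα : ContDiffOn ℝ k α D)
    (hβ : ContDiffOn ℝ k β D) : ContDiffOn ℝ k (fun x => flatInner (α x) (β x)) D :=
  contDiffOn_bilin flatInnerL hα hβ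

theorem contDiffOn_matrixAct {k : ℕ∞ω} {D : Set (EuclideanSpace ℝ (Fin n))}
    {M : EuclideanSpace ℝ (Fin n) → Matrix (Fin r) (Fin r) ℝ}
    {β : EuclideanSpace ℝ (Fin n) → EForm n r q} (hM : ContDiffOn ℝ k M D)
    (hβ : ContDiffOn ℝ k β D) : ContDiffOn ℝ k (fun x => matrixAct (M x) (β x)) D :=
  contDiffOn_bilin matrixActL hM hβ

theorem contDiffOn_contract {k : ℕ∞ω} {D : Set (EuclideanSpace ℝ (Fin n))}
    {β : EuclideanSpace ℝ (Fin n) → EForm n r (q + 1)} (v : EuclideanSpace ℝ (Fin n))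
    (hβ : ContDiffOn ℝ k β D) : ContDiffOn ℝ k (fun x => contract v (β x)) D :=
  (contractL v).contDiff.comp_contDiffOn hβ

theorem contDiffOn_wedgeCovector {k : ℕ∞ω} {D : Set (EuclideanSpace ℝ (Fin n))}
    {β : EuclideanSpace ℝ (Fin n) → EForm n r q} (θ : EuclideanSpace ℝ (Fin n) →L[ℝ] ℝ)
    (hβ : ContDiffOn ℝ k β D) : ContDiffOn ℝ k (fun x => wedgeCovector θ (β x)) D :=
  (wedgeL θ).contDiff.comp_contDiffOn hβ

theorem contDiffOn_matrixMul {k : ℕ∞ω} {D : Set (EuclideanSpace ℝ (Fin n))}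
    {M N : EuclideanSpace ℝ (Fin n) → Matrix (Fin r) (Fin r) ℝ} (hM : ContDiffOn ℝ k M D)
    (hN : ContDiffOn ℝ k N D) : ContDiffOn ℝ k (fun x => M x * N x) D :=
  contDiffOn_bilin matrixMulL hM hN

theorem partialDeriv_matrixAct (i : Fin n)
    {M : EuclideanSpace ℝ (Fin n) → Matrix (Fin r) (Fin r) ℝ}
    {β : EuclideanSpace ℝ (Fin n) → EForm n r q} {x : EuclideanSpace ℝ (Fin n)}
    (hM : DifferentiableAt ℝ M x) (hβ : DifferentiableAt ℝ β x) :
    partialDeriv i (fun y => matrixAct (M y) (β y)) x =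
      matrixAct (M x) (partialDeriv i β x) + matrixAct (partialDeriv i M x) (β x) :=
  partialDeriv_bilin matrixActL i hM hβ

theorem partialDeriv_flatInner (i : Fin n)
    {α β : EuclideanSpace ℝ (Fin n) → EForm n r q} {x : EuclideanSpace ℝ (Fin n)}
    (hα : DifferentiableAt ℝ α x) (hβ : DifferentiableAt ℝ β x) :
    partialDeriv i (fun y => flatInner (α y) (β y)) x =
      flatInner (α x) (partialDeriv i β x) + flatInner (partialDeriv i α x) (β x) :=
  partialDeriv_bilin flatInnerL i hα hβ

theorem partialDeriv_contract (i : Fin n) (v : EuclideanSpace ℝ (Fin n))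
    {β : EuclideanSpace ℝ (Fin n) → EForm n r (q + 1)} {x : EuclideanSpace ℝ (Fin n)}
    (hβ : DifferentiableAt ℝ β x) :
    partialDeriv i (fun y => contract v (β y)) x = contract v (partialDeriv i β x) :=
  partialDeriv_clm (contractL v) i hβ

theorem partialDeriv_wedgeCovector (i : Fin n) (θ : EuclideanSpace ℝ (Fin n) →L[ℝ] ℝ)
    {β : EuclideanSpace ℝ (Fin n) → EForm n r q} {x : EuclideanSpace ℝ (Fin n)}
    (hβ : DifferentiableAt ℝ β x) :
    partialDeriv i (fun y => wedgeCovector θ (β y)) x = wedgeCovector θ (partialDeriv i β x) :=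
  partialDeriv_clm (wedgeL θ) i hβ

theorem contDiffOn_connection {D : Set (EuclideanSpace ℝ (Fin n))} (hD : IsOpen D)
    {G : EuclideanSpace ℝ (Fin n) → Matrix (Fin r) (Fin r) ℝ} (hG : IsC2Metric D G) (i : Fin n) :
    ContDiffOn ℝ 1 (connection G i) D := by
  have hG2 : ContDiffOn ℝ 2 G D := contDiffOn_matrix.2 hG.2
  refine contDiffOn_matrixMul ?_ (contDiffOn_matrixPartial hD hG2 (by norm_num) i)
  exact contDiffOn_matrix_inv (hG2.of_le (by norm_num)) fun x hx => (hG.1 x hx).det_pos.ne'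

/-- The pointwise integrand `|μ|²_G + |ν - ∑_i Γ_i ∂_i ⌟ β|²_G - ⟨Θ_G β, β⟩_G`. For `μ = dβ` and
`ν = δβ` the form `ν - ∑_i Γ_i ∂_i ⌟ β` is the adjoint `d*_G β`. The derivatives are separate
arguments, so that the integrand makes sense for forms which are only weakly differentiable, and is
a quadratic function of `(β, μ, ν)`. -/
noncomputable def bochnerForm (G : EuclideanSpace ℝ (Fin n) → Matrix (Fin r) (Fin r) ℝ)
    (x : EuclideanSpace ℝ (Fin n)) (β : EForm n r (q + 1)) (μ : EForm n r (q + 2))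
    (ν : EForm n r q) : ℝ :=
  formInner (G x) μ μ +
    formInner (G x) (ν - ∑ i, matrixAct (connection G i x) (contract (coordVec i) β))
      (ν - ∑ i, matrixAct (connection G i x) (contract (coordVec i) β)) -
    formInner (G x) (curvatureOp G x β) β

/-- The algebra behind the Bochner identity at a point. Here `a`, `a' i` stand for the value and
the partial derivatives of a form, `Γ i` for the connection matrices and `Γ' j i` for `∂_j Γ_i`.
The anticommutators of `dx_i ∧` and `∂_j ⌟` leave `∑ |a' i|²` and terms in which two contractions
occur. -/
theorem bochner_algebra (G : Matrix (Fin r) (Fin r) ℝ)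
    (Γ : Fin n → Matrix (Fin r) (Fin r) ℝ) (Γ' : Fin n → Fin n → Matrix (Fin r) (Fin r) ℝ)
    (a : EForm n r (q + 1)) (a' : Fin n → EForm n r (q + 1)) :
    formInner G (∑ i, wedgeCovector (EuclideanSpace.proj i) (a' i))
        (∑ i, wedgeCovector (EuclideanSpace.proj i) (a' i)) +
      formInner G
        (-(∑ i, contract (coordVec i) (a' i)) - ∑ i, matrixAct (Γ i) (contract (coordVec i) a))
        (-(∑ i, contract (coordVec i) (a' i)) - ∑ i, matrixAct (Γ i) (contract (coordVec i) a)) -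
      formInner G (-∑ i, ∑ j, matrixAct (Γ' i j)
        (wedgeCovector (EuclideanSpace.proj i) (contract (coordVec j) a))) a =
    ∑ i, formInner G (a' i) (a' i) +
      ∑ i, ∑ j, (flatInner (contract (coordVec i) (matrixAct (Γ' j i) a))
          (matrixAct G (contract (coordVec j) a)) +
        flatInner (contract (coordVec i) (a' i + matrixAct (Γ i) a))
          (matrixAct G (contract (coordVec j) (a' j + matrixAct (Γ j) a))) -
        flatInner (contract (coordVec i) (a' j)) (matrixAct G (contract (coordVec j) (a' i)))) := by
  have h1 : formInner G (∑ i, wedgeCovector (EuclideanSpace.proj i) (a' i))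
        (∑ i, wedgeCovector (EuclideanSpace.proj i) (a' i)) =
      ∑ i, formInner G (a' i) (a' i) - ∑ i, ∑ j, flatInner (contract (coordVec i) (a' j))
        (matrixAct G (contract (coordVec j) (a' i))) := by
    have h2 : ∀ i j : Fin n, flatInner (wedgeCovector (EuclideanSpace.proj i) (a' i))
          (matrixAct G (wedgeCovector (EuclideanSpace.proj j) (a' j))) =
        (if i = j then formInner G (a' i) (a' i) else 0) -
          flatInner (contract (coordVec j) (a' i)) (matrixAct G (contract (coordVec i) (a' j))) := by
      intro i j
      rw [matrixAct_wedgeCovector, flatInner_wedgeCovector_proj, contract_wedgeCovector,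
        flatInner_sub_right, flatInner_smul_right, ← matrixAct_contract,
        flatInner_comm (a' i) (wedgeCovector _ _), flatInner_wedgeCovector_proj,
        flatInner_comm (matrixAct G _)]
      congr 1
      by_cases hij : i = j
      · subst hij
        simp [coordVec, formInner_eq]
      · have : j ≠ i := fun h => hij h.symm
        simp [coordVec, hij, this]
    rw [formInner_eq, matrixAct_sum, flatInner_sum_left]
    simp only [flatInner_sum_right, h2, Finset.sum_sub_distrib]
    congr 1
    · simp
    · exact Finset.sum_comm
  have h3 : formInner G
        (-(∑ i, contract (coordVec i) (a' i)) - ∑ i, matrixAct (Γ i) (contract (coordVec i) a))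
        (-(∑ i, contract (coordVec i) (a' i)) - ∑ i, matrixAct (Γ i) (contract (coordVec i) a)) =
      ∑ i, ∑ j, flatInner (contract (coordVec i) (a' i + matrixAct (Γ i) a))
          (matrixAct G (contract (coordVec j) (a' j + matrixAct (Γ j) a))) := by
    have h4 : -(∑ i, contract (coordVec i) (a' i)) - ∑ i, matrixAct (Γ i) (contract (coordVec i) a)
        = -∑ i, contract (coordVec i) (a' i + matrixAct (Γ i) a) := by
      simp only [contract_add, matrixAct_contract, Finset.sum_add_distrib]
      abel
    rw [h4, formInner_eq, matrixAct_neg, flatInner_neg_left, flatInner_neg_right, neg_neg,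
      matrixAct_sum, flatInner_sum_left]
    simp only [flatInner_sum_right]
  have h5 : formInner G (-∑ i, ∑ j, matrixAct (Γ' i j)
        (wedgeCovector (EuclideanSpace.proj i) (contract (coordVec j) a))) a =
      -∑ i, ∑ j, flatInner (contract (coordVec i) (matrixAct (Γ' j i) a))
          (matrixAct G (contract (coordVec j) a)) := by
    rw [formInner_eq, flatInner_neg_left, flatInner_sum_left]
    simp only [flatInner_sum_left]
    rw [Finset.sum_comm]
    simp only [matrixAct_wedgeCovector, flatInner_wedgeCovector_proj, ← matrixAct_contract]
  rw [h1, h3, h5]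
  simp only [Finset.sum_add_distrib, Finset.sum_sub_distrib]
  ring

/-- The Bochner inequality: for a compactly supported form `α`,
`∫ |dα|²_G + |d*_G α|²_G - ⟨Θ_G α, α⟩_G ≥ 0`. The left-hand side is the integral of
`∑_j |∂_j α|²_G` plus a divergence. -/
theorem integral_bochnerForm_nonneg {D : Set (EuclideanSpace ℝ (Fin n))} (hD : IsOpen D)
    {G : EuclideanSpace ℝ (Fin n) → Matrix (Fin r) (Fin r) ℝ} (hG : IsC2Metric D G)
    {α : EuclideanSpace ℝ (Fin n) → EForm n r (q + 1)} (hα : ContDiff ℝ 2 α)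
    (hc : HasCompactSupport α) (hs : tsupport α ⊆ D) :
    0 ≤ ∫ x in D, bochnerForm G x (α x) (extDeriv α x) (codiff α x) := by
  have hG2 : ContDiffOn ℝ 2 G D := contDiffOn_matrix.2 hG.2
  have hG1 : ContDiffOn ℝ 1 G D := hG2.of_le (by norm_num)
  have hα2 : ContDiffOn ℝ 2 α D := hα.contDiffOn
  have hα1 : ContDiffOn ℝ 1 α D := hα2.of_le (by norm_num)
  have hα' : ∀ i, ContDiffOn ℝ 1 (partialDeriv i α) D := fun i =>
    contDiffOn_partialDeriv hD hα2 (by norm_num) i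
  have hΓ : ∀ i, ContDiffOn ℝ 1 (connection G i) D := contDiffOn_connection hD hG
  have hGα : ∀ j : Fin n, ContDiffOn ℝ 1
      (fun x => matrixAct (G x) (contract (coordVec j) (α x))) D := fun j =>
    contDiffOn_matrixAct hG1 (contDiffOn_contract _ hα1)
  -- the divergence in question is `∑_{i,j} (∂_j h_{ij} - ∂_i k_{ij})`; the second derivatives of `α`
  -- cancel in it because they commute
  let h : Fin n → Fin n → EuclideanSpace ℝ (Fin n) → ℝ := fun i j x =>
    flatInner (contract (coordVec i) (partialDeriv i α x + matrixAct (connection G i x) (α x)))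
      (matrixAct (G x) (contract (coordVec j) (α x)))
  let k : Fin n → Fin n → EuclideanSpace ℝ (Fin n) → ℝ := fun i j x =>
    flatInner (contract (coordVec i) (partialDeriv j α x))
      (matrixAct (G x) (contract (coordVec j) (α x)))
  have hh : ∀ i j, ContDiffOn ℝ 1 (h i j) D := fun i j =>
    contDiffOn_flatInner (contDiffOn_contract _ ((hα' i).add (contDiffOn_matrixAct (hΓ i) hα1)))
      (hGα j)
  have hk : ∀ i j, ContDiffOn ℝ 1 (k i j) D := fun i j =>
    contDiffOn_flatInner (contDiffOn_contract _ (hα' j)) (hGα j)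
  have hvan : ∀ (F : EuclideanSpace ℝ (Fin n) → ℝ), (∀ x, α x = 0 → F x = 0) →
      HasCompactSupport F ∧ tsupport F ⊆ D := by
    intro F hF
    have h1 : Function.support F ⊆ Function.support α := fun x hx hx' => hx (hF x hx')
    have h2 : tsupport F ⊆ tsupport α := closure_mono h1
    exact ⟨hc.mono h1, h2.trans hs⟩
  have hhv : ∀ i j, HasCompactSupport (h i j) ∧ tsupport (h i j) ⊆ D := fun i j =>
    hvan _ fun x hx => by simp only [h, hx, contract_zero, matrixAct_zero, flatInner_zero_right]
  have hkv : ∀ i j, HasCompactSupport (k i j) ∧ tsupport (k i j) ⊆ D := fun i j =>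
    hvan _ fun x hx => by simp only [k, hx, contract_zero, matrixAct_zero, flatInner_zero_right]
  have hhi := fun i j => setIntegral_partialDeriv_eq_zero hD (hh i j) (hhv i j).1 (hhv i j).2 j
  have hki := fun i j => setIntegral_partialDeriv_eq_zero hD (hk i j) (hkv i j).1 (hkv i j).2 i
  have hmain : ∀ x ∈ D, bochnerForm G x (α x) (extDeriv α x) (codiff α x) =
      ∑ i, formInner (G x) (partialDeriv i α x) (partialDeriv i α x) +
        ∑ i, ∑ j, (partialDeriv j (h i j) x - partialDeriv i (k i j) x) := by
    intro x hx
    have hnx := hD.mem_nhds hx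
    have dα : DifferentiableAt ℝ α x := (hα1.contDiffAt hnx).differentiableAt one_ne_zero
    have dα' : ∀ i, DifferentiableAt ℝ (partialDeriv i α) x := fun i =>
      ((hα' i).contDiffAt hnx).differentiableAt one_ne_zero
    have dG : DifferentiableAt ℝ G x := (hG1.contDiffAt hnx).differentiableAt one_ne_zero
    have dΓ : ∀ i, DifferentiableAt ℝ (connection G i) x := fun i =>
      ((hΓ i).contDiffAt hnx).differentiableAt one_ne_zero
    have hsymm : (G x).transpose = G x := by
      have := (hG.1 x hx).isHermitian
      rwa [Matrix.IsHermitian, Matrix.conjTranspose_eq_transpose_of_trivial] at this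
    have hunit : IsUnit (G x).det := (hG.1 x hx).det_pos.ne'.isUnit
    have hGΓ : ∀ i, partialDeriv i G x = G x * connection G i x := by
      intro i
      rw [connection, Matrix.mul_nonsing_inv_cancel_left _ _ hunit, matrixPartial_eq dG]
    have hGΓ' : ∀ i, (G x * connection G i x).transpose = G x * connection G i x := by
      intro i
      rw [← hGΓ, ← matrixPartial_eq dG]
      ext τ ξ
      rw [Matrix.transpose_apply]
      change fderiv ℝ (fun y => G y ξ τ) x _ = fderiv ℝ (fun y => G y τ ξ) x _
      congr 1
      apply Filter.EventuallyEq.fderiv_eq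
      filter_upwards [hnx] with y hy
      have := (hG.1 y hy).isHermitian.apply τ ξ
      simpa using this
    -- `Γ_i` is symmetric for `⟨·, ·⟩_G`, as `G Γ_i = ∂_i G` is a symmetric matrix
    have hswap : ∀ (i : Fin n) (u v : EForm n r q),
        flatInner u (matrixAct (G x) (matrixAct (connection G i x) v)) =
          flatInner (matrixAct (connection G i x) u) (matrixAct (G x) v) := by
      intro i u v
      rw [← matrixAct_mul, ← hGΓ', ← flatInner_matrixAct, matrixAct_mul, flatInner_matrixAct,
        hsymm]
    have dGα : ∀ i j, partialDeriv i (fun y => matrixAct (G y) (contract (coordVec j) (α y))) x =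
        matrixAct (G x) (contract (coordVec j)
          (partialDeriv i α x + matrixAct (connection G i x) (α x))) := by
      intro i j
      have d1 : DifferentiableAt ℝ (fun y => contract (coordVec j) (α y)) x :=
        (contractL (coordVec j)).differentiableAt.comp x dα
      rw [partialDeriv_matrixAct i dG d1, partialDeriv_contract i _ dα, hGΓ, matrixAct_mul,
        contract_add, matrixAct_add, ← matrixAct_contract]
    have dd : ∀ j, DifferentiableAt ℝ (fun y => matrixAct (G y) (contract (coordVec j) (α y))) x :=
      fun j => ((hGα j).contDiffAt hnx).differentiableAt one_ne_zero
    have dΓα : ∀ i, DifferentiableAt ℝ (fun y => matrixAct (connection G i y) (α y)) x := fun i =>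
      ((contDiffOn_matrixAct (hΓ i) hα1).contDiffAt hnx).differentiableAt one_ne_zero
    have dsum : ∀ i, DifferentiableAt ℝ
        (fun y => partialDeriv i α y + matrixAct (connection G i y) (α y)) x := fun i =>
      (dα' i).add (dΓα i)
    have hph : ∀ i j, partialDeriv j (h i j) x =
        flatInner (contract (coordVec i) (partialDeriv i α x + matrixAct (connection G i x) (α x)))
          (matrixAct (G x) (contract (coordVec j)
            (partialDeriv j α x + matrixAct (connection G j x) (α x)))) +
        flatInner (contract (coordVec i) (partialDeriv j (partialDeriv i α) x +
            (matrixAct (connection G i x) (partialDeriv j α x) +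
              matrixAct (partialDeriv j (connection G i) x) (α x))))
          (matrixAct (G x) (contract (coordVec j) (α x))) := by
      intro i j
      have d1 : DifferentiableAt ℝ (fun y => contract (coordVec i)
          (partialDeriv i α y + matrixAct (connection G i y) (α y))) x :=
        (contractL (coordVec i)).differentiableAt.comp x (dsum i)
      rw [partialDeriv_flatInner j d1 (dd j), dGα, partialDeriv_contract j _ (dsum i),
        ← partialDeriv_matrixAct j (dΓ i) dα]
      congr 3
      change fderiv ℝ _ x _ = _
      rw [fderiv_fun_add (dα' i) (dΓα i)]
      rfl
    have hpk : ∀ i j, partialDeriv i (k i j) x =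
        flatInner (contract (coordVec i) (partialDeriv j α x))
          (matrixAct (G x) (contract (coordVec j) (partialDeriv i α x))) +
        flatInner (matrixAct (connection G i x) (contract (coordVec i) (partialDeriv j α x)))
          (matrixAct (G x) (contract (coordVec j) (α x))) +
        flatInner (contract (coordVec i) (partialDeriv i (partialDeriv j α) x))
          (matrixAct (G x) (contract (coordVec j) (α x))) := by
      intro i j
      have d1 : DifferentiableAt ℝ (fun y => contract (coordVec i) (partialDeriv j α y)) x :=
        (contractL (coordVec i)).differentiableAt.comp x (dα' j)
      rw [partialDeriv_flatInner i d1 (dd j), dGα, partialDeriv_contract i _ (dα' j), contract_add,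
        matrixAct_add, flatInner_add_right, ← matrixAct_contract (connection G i x), hswap]
    have hcurv : curvatureOp G x (α x) = -∑ i, ∑ j, matrixAct (partialDeriv i (connection G j) x)
        (wedgeCovector (EuclideanSpace.proj i) (contract (coordVec j) (α x))) := by
      unfold curvatureOp
      congr 1
      refine Finset.sum_congr rfl fun i _ => Finset.sum_congr rfl fun j _ => ?_
      congr 1
      exact matrixPartial_eq (dΓ j)
    unfold bochnerForm codiff
    rw [extDeriv_eq_sum, hcurv, bochner_algebra _ _ (fun i j =>
      partialDeriv i (connection G j) x)]
    congr 1
    refine Finset.sum_congr rfl fun i _ => Finset.sum_congr rfl fun j _ => ?_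
    rw [hph, hpk, partialDeriv_comm hD hα2 hx j i]
    simp only [contract_add, flatInner_add_left, matrixAct_contract]
    ring
  rw [setIntegral_congr_fun hD.measurableSet hmain]
  have hnn : ∀ x ∈ D, 0 ≤ ∑ i, formInner (G x) (partialDeriv i α x) (partialDeriv i α x) := by
    intro x hx
    exact Finset.sum_nonneg fun i _ => formInner_self_nonneg (hG.1 x hx).posSemidef _
  have hdiv : Integrable (fun x => ∑ i, ∑ j, (partialDeriv j (h i j) x - partialDeriv i (k i j) x))
      (volume.restrict D) :=
    integrable_finsetSum _ fun i _ => integrable_finsetSum _ fun j _ =>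
      ((hhi i j).1.sub (hki i j).1).integrableOn
  have hdiv0 : ∫ x in D, ∑ i, ∑ j, (partialDeriv j (h i j) x - partialDeriv i (k i j) x) = 0 := by
    have hij : ∀ i j, Integrable (fun x => partialDeriv j (h i j) x - partialDeriv i (k i j) x)
        (volume.restrict D) := fun i j => ((hhi i j).1.sub (hki i j).1).integrableOn
    rw [integral_finsetSum _ fun i _ => integrable_finsetSum _ fun j _ => hij i j]
    refine Finset.sum_eq_zero fun i _ => ?_
    rw [integral_finsetSum _ fun j _ => hij i j]
    refine Finset.sum_eq_zero fun j _ => ?_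
    rw [integral_sub (hhi i j).1.integrableOn (hki i j).1.integrableOn, (hhi i j).2, (hki i j).2,
      sub_zero]
  by_cases hint : Integrable (fun x => ∑ i, formInner (G x) (partialDeriv i α x)
      (partialDeriv i α x)) (volume.restrict D)
  · rw [integral_add hint hdiv, hdiv0, add_zero]
    exact setIntegral_nonneg hD.measurableSet hnn
  -- if the sum of squares were not integrable, neither would be the left-hand side, whose integral
  -- would then be `0` by convention
  · rw [integral_undef]
    intro h'
    apply hint
    refine (h'.sub hdiv).congr (Filter.Eventually.of_forall fun x => ?_)
    simp only [Pi.sub_apply, add_sub_cancel_right]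

end Bochner

/-! ### Passing to the limit in quadratic integrals of mollified functions -/

section Mollify

open Filter Topology Convolution

variable {n : ℕ} {Z : Type*} [NormedAddCommGroup Z] [NormedSpace ℝ Z]

/-- A continuous family of quadratic functions is bounded, uniformly over a compact set. -/
theorem exists_quadratic_bound [FiniteDimensional ℝ Z] {D K : Set (EuclideanSpace ℝ (Fin n))}
    (hK : IsCompact K) (hKD : K ⊆ D) {Φ : EuclideanSpace ℝ (Fin n) → Z → ℝ}
    (hΦ : ContinuousOn (fun p : EuclideanSpace ℝ (Fin n) × Z => Φ p.1 p.2) (D ×ˢ Set.univ))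
    (hΦ2 : ∀ x (c : ℝ) z, Φ x (c • z) = c ^ 2 * Φ x z) :
    ∃ C, 0 ≤ C ∧ ∀ x ∈ K, ∀ z, |Φ x z| ≤ C * ‖z‖ ^ 2 := by
  have hcomp : IsCompact (K ×ˢ Metric.closedBall (0 : Z) 1) :=
    hK.prod (isCompact_closedBall 0 1)
  obtain ⟨C, hC⟩ := (hcomp.image_of_continuousOn
    (hΦ.mono (Set.prod_mono hKD (Set.subset_univ _)))).isBounded.exists_norm_le
  refine ⟨max C 0, le_max_right _ _, fun x hx z => ?_⟩
  rcases eq_or_ne z 0 with rfl | hz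
  · have := hΦ2 x 0 0
    simp at this
    simp [this]
  · have hz' : ‖z‖ ≠ 0 := norm_ne_zero_iff.2 hz
    have h1 : z = ‖z‖ • (‖z‖⁻¹ • z) := by rw [smul_smul, mul_inv_cancel₀ hz', one_smul]
    have h2 : ‖Φ x (‖z‖⁻¹ • z)‖ ≤ C := by
      refine hC _ ⟨(x, ‖z‖⁻¹ • z), ⟨hx, ?_⟩, rfl⟩
      rw [mem_closedBall_zero_iff, norm_smul, norm_inv, norm_norm, inv_mul_cancel₀ hz']
    rw [h1, hΦ2, abs_mul, abs_of_nonneg (by positivity), ← h1, mul_comm]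
    gcongr
    exact h2.trans (le_max_left _ _)

/-- The mollification of `z` by a normalised bump function. -/
noncomputable def mollify (φ : ContDiffBump (0 : EuclideanSpace ℝ (Fin n)))
    (z : EuclideanSpace ℝ (Fin n) → Z) : EuclideanSpace ℝ (Fin n) → Z :=
  φ.normed volume ⋆[ContinuousLinearMap.lsmul ℝ ℝ, volume] z

theorem continuous_mollify (φ : ContDiffBump (0 : EuclideanSpace ℝ (Fin n)))
    {z : EuclideanSpace ℝ (Fin n) → Z} (hz : LocallyIntegrable z) : Continuous (mollify φ z) :=
  φ.hasCompactSupport_normed.continuous_convolution_left _ φ.continuous_normed hz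

theorem mollify_eq_zero (φ : ContDiffBump (0 : EuclideanSpace ℝ (Fin n)))
    {z : EuclideanSpace ℝ (Fin n) → Z} {x : EuclideanSpace ℝ (Fin n)}
    (hx : x ∉ Metric.cthickening φ.rOut (tsupport z)) : mollify φ z x = 0 := by
  unfold mollify
  rw [convolution_def]
  refine integral_eq_zero_of_ae (Eventually.of_forall fun t => ?_)
  by_cases ht : z (x - t) = 0
  · simp [ht]
  · have h1 : x - t ∈ tsupport z := subset_tsupport z ht
    have h2 : t ∉ Metric.ball (0 : EuclideanSpace ℝ (Fin n)) φ.rOut := by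
      intro h
      apply hx
      refine Metric.mem_cthickening_of_dist_le x (x - t) _ _ h1 ?_
      rw [dist_eq_norm, sub_sub_cancel]
      simpa using (mem_ball_zero_iff.1 h).le
    rw [← φ.support_normed_eq (μ := volume), Function.notMem_support] at h2
    simp [h2]

/-- Jensen's inequality for mollifications: the variance of `‖z‖` for the probability density
`t ↦ ρ(t)` around `x` is nonnegative. -/
theorem norm_mollify_sq_le (φ : ContDiffBump (0 : EuclideanSpace ℝ (Fin n)))
    {z : EuclideanSpace ℝ (Fin n) → Z} (hz : LocallyIntegrable z)
    (hz2 : LocallyIntegrable fun x => ‖z x‖ ^ 2) (x : EuclideanSpace ℝ (Fin n)) :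
    ‖mollify φ z x‖ ^ 2 ≤ mollify φ (fun x => ‖z x‖ ^ 2) x := by
  have e1 : Integrable (fun t => φ.normed volume t • ‖z (x - t)‖) := by
    have h := (φ.hasCompactSupport_normed.convolutionExists_left
      (ContinuousLinearMap.lsmul ℝ ℝ) (φ.continuous_normed (μ := volume)) hz x)
    refine (Integrable.norm h).congr (Eventually.of_forall fun t => ?_)
    simp only [ContinuousLinearMap.lsmul_apply, norm_smul, Real.norm_eq_abs, smul_eq_mul]
    rw [abs_of_nonneg (φ.nonneg_normed t)]
  have e2 : Integrable (fun t => φ.normed volume t • ‖z (x - t)‖ ^ 2) :=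
    φ.hasCompactSupport_normed.convolutionExists_left
      (ContinuousLinearMap.lsmul ℝ ℝ) (φ.continuous_normed (μ := volume)) hz2 x
  set m := ∫ t, φ.normed volume t • ‖z (x - t)‖ with hm
  have h1 : ‖mollify φ z x‖ ≤ m := by
    refine (norm_integral_le_integral_norm _).trans (le_of_eq (integral_congr_ae
      (Eventually.of_forall fun t => ?_)))
    simp only [ContinuousLinearMap.lsmul_apply, norm_smul, Real.norm_eq_abs, smul_eq_mul]
    rw [abs_of_nonneg (φ.nonneg_normed t)]
  have h2 : 0 ≤ ∫ t, φ.normed volume t * (‖z (x - t)‖ - m) ^ 2 :=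
    integral_nonneg fun t => mul_nonneg (φ.nonneg_normed t) (sq_nonneg _)
  have h3 : ∫ t, φ.normed volume t * (‖z (x - t)‖ - m) ^ 2 =
      mollify φ (fun x => ‖z x‖ ^ 2) x - 2 * m * m + m ^ 2 := by
    have : (fun t => φ.normed volume t * (‖z (x - t)‖ - m) ^ 2) = fun t =>
        φ.normed volume t • ‖z (x - t)‖ ^ 2 - (2 * m) * (φ.normed volume t • ‖z (x - t)‖) +
          φ.normed volume t * m ^ 2 := by
      ext t
      simp only [smul_eq_mul]
      ring
    have e4 : Integrable (fun t => φ.normed volume t • ‖z (x - t)‖ ^ 2 -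
        (2 * m) * (φ.normed volume t • ‖z (x - t)‖)) := e2.sub (e1.const_mul _)
    rw [this, integral_add e4 (φ.integrable_normed.mul_const _),
      integral_sub e2 (e1.const_mul _), integral_const_mul, integral_mul_const,
      φ.integral_normed, ← hm, one_mul]
    rfl
  have h4 : (0 : ℝ) ≤ ‖mollify φ z x‖ := norm_nonneg _
  nlinarith

theorem integral_mollify (φ : ContDiffBump (0 : EuclideanSpace ℝ (Fin n)))
    {h : EuclideanSpace ℝ (Fin n) → ℝ} (hh : Integrable h) :
    Integrable (mollify φ h) ∧ ∫ x, mollify φ h x = ∫ x, h x := by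
  refine ⟨φ.integrable_normed.integrable_convolution _ hh, ?_⟩
  unfold mollify
  rw [integral_convolution _ φ.integrable_normed hh, φ.integral_normed]
  simp

/-- If the integral of a continuous family of quadratic functions is nonnegative on all fine
mollifications of an `L²` function with compact support, then it is nonnegative on the function
itself. With `C` a bound for the quadratic functions, this is Fatou's lemma for
`C ρ_ε ⋆ ‖z‖² - Φ (ρ_ε ⋆ z)`, which is nonnegative by Jensen's inequality. -/
theorem setIntegral_nonneg_of_mollify [FiniteDimensional ℝ Z]
    {D : Set (EuclideanSpace ℝ (Fin n))} (hD : IsOpen D)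
    {Φ : EuclideanSpace ℝ (Fin n) → Z → ℝ}
    (hΦ : ContinuousOn (fun p : EuclideanSpace ℝ (Fin n) × Z => Φ p.1 p.2) (D ×ˢ Set.univ))
    (hΦ2 : ∀ x (c : ℝ) z, Φ x (c • z) = c ^ 2 * Φ x z)
    {z : EuclideanSpace ℝ (Fin n) → Z} (hz : Integrable z) (hz2 : Integrable fun x => ‖z x‖ ^ 2)
    (hc : HasCompactSupport z) (hs : tsupport z ⊆ D) {ε : ℝ} (hε : 0 < ε)
    (hmol : ∀ φ : ContDiffBump (0 : EuclideanSpace ℝ (Fin n)), φ.rOut < ε →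
      0 ≤ ∫ x in D, Φ x (mollify φ z x)) :
    IntegrableOn (fun x => Φ x (z x)) D ∧ 0 ≤ ∫ x in D, Φ x (z x) := by
  obtain ⟨δ, hδ, hδD⟩ := IsCompact.exists_cthickening_subset_open hc hD hs
  set K := Metric.cthickening δ (tsupport z) with hKdef
  have hK : IsCompact K := hc.cthickening
  -- all mollifications of radius less than `δ` vanish outside of the compact set `K`
  have hΦ0 : ∀ x, Φ x 0 = 0 := fun x => by simpa using hΦ2 x 0 0
  obtain ⟨C, hC0, hC⟩ := exists_quadratic_bound hK hδD hΦ hΦ2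
  have hz0 : ∀ x ∉ K, z x = 0 := fun x hx => by
    by_contra h
    exact hx (Metric.self_subset_cthickening _ (subset_tsupport z h))
  let φ : ℕ → ContDiffBump (0 : EuclideanSpace ℝ (Fin n)) := fun k =>
    { rIn := min ε δ / (k + 2) / 2
      rOut := min ε δ / (k + 2)
      rIn_pos := by positivity
      rIn_lt_rOut := half_lt_self (by positivity) }
  have hφlt : ∀ k, (φ k).rOut < min ε δ := fun k => by
    refine div_lt_self (by positivity) ?_
    have : (0 : ℝ) ≤ k := by positivity
    linarith
  have hφ0 : Tendsto (fun k => (φ k).rOut) atTop (𝓝 0) := by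
    refine Tendsto.div_atTop tendsto_const_nhds ?_
    exact tendsto_atTop_add_const_right _ _ tendsto_natCast_atTop_atTop
  have hφK : ∀ᶠ k in atTop, (φ k).rOut ≤ 2 * (φ k).rIn :=
    Eventually.of_forall fun k => by simp only [φ]; linarith
  have hae1 := ContDiffBump.ae_convolution_tendsto_right_of_locallyIntegrable (μ := volume) hφ0 hφK
    hz.locallyIntegrable
  have hae2 := ContDiffBump.ae_convolution_tendsto_right_of_locallyIntegrable (μ := volume) hφ0 hφK
    hz2.locallyIntegrable
  have hm0 : ∀ k, ∀ x ∉ K, mollify (φ k) z x = 0 := fun k x hx =>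
    mollify_eq_zero _ fun h => hx (Metric.cthickening_mono
      ((hφlt k).le.trans (min_le_right _ _)) _ h)
  have hDK : ∀ w : EuclideanSpace ℝ (Fin n) → Z, (∀ x ∉ K, w x = 0) →
      ∫ x in D, Φ x (w x) = ∫ x in K, Φ x (w x) := fun w hw => by
    refine (setIntegral_eq_of_subset_of_forall_sdiff_eq_zero hD.measurableSet hδD ?_)
    intro x hx
    rw [hw x hx.2, hΦ0]
  have hcm : ∀ k, IntegrableOn (fun x => Φ x (mollify (φ k) z x)) K := fun k => by
    refine ContinuousOn.integrableOn_compact hK ?_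
    refine hΦ.comp (f := fun x => (x, mollify (φ k) z x))
      (continuousOn_id.prodMk (continuous_mollify _ hz.locallyIntegrable).continuousOn) ?_
    exact fun x hx => ⟨hδD hx, Set.mem_univ _⟩
  have hlim : ∀ᵐ x ∂(volume.restrict K),
      Tendsto (fun k => Φ x (mollify (φ k) z x)) atTop (𝓝 (Φ x (z x))) := by
    filter_upwards [ae_restrict_of_ae hae1, ae_restrict_mem hK.measurableSet] with x hx hxK
    have h1 : ContinuousAt (fun w : Z => Φ x w) (z x) := by
      have h2 : ContinuousAt (fun p : EuclideanSpace ℝ (Fin n) × Z => Φ p.1 p.2) (x, z x) :=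
        hΦ.continuousAt ((hD.prod isOpen_univ).mem_nhds ⟨hδD hxK, Set.mem_univ _⟩)
      exact h2.comp (f := fun w : Z => (x, w)) (by fun_prop)
    exact h1.tendsto.comp hx
  have hmeas : AEStronglyMeasurable (fun x => Φ x (z x)) (volume.restrict K) :=
    aestronglyMeasurable_of_tendsto_ae atTop (fun k => (hcm k).aestronglyMeasurable) hlim
  have hintK : IntegrableOn (fun x => Φ x (z x)) K := by
    refine (hz2.integrableOn.const_mul C).mono' hmeas ?_
    filter_upwards [ae_restrict_mem hK.measurableSet] with x hx using hC x hx _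
  have hsq : IntegrableOn (fun x => C * ‖z x‖ ^ 2) K := hz2.integrableOn.const_mul C
  have hmsq : ∀ k, Integrable (mollify (φ k) fun x => ‖z x‖ ^ 2) ∧
      ∫ x, mollify (φ k) (fun x => ‖z x‖ ^ 2) x = ∫ x, ‖z x‖ ^ 2 := fun k =>
    integral_mollify (φ k) hz2
  have hfatou := lintegral_liminf_le' (u := (atTop : Filter ℕ)) (μ := volume.restrict K)
    (f := fun k x => ENNReal.ofReal (C * mollify (φ k) (fun x => ‖z x‖ ^ 2) x -
      Φ x (mollify (φ k) z x)))
    (fun k => (((hmsq k).1.integrableOn.const_mul C).sub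
      (hcm k)).aestronglyMeasurable.aemeasurable.ennreal_ofReal)
  have hL : ∫⁻ x in K, liminf (fun k => ENNReal.ofReal (C * mollify (φ k) (fun x => ‖z x‖ ^ 2) x -
      Φ x (mollify (φ k) z x))) atTop =
      ∫⁻ x in K, ENNReal.ofReal (C * ‖z x‖ ^ 2 - Φ x (z x)) := by
    refine lintegral_congr_ae ?_
    filter_upwards [ae_restrict_of_ae hae2, hlim] with x hx1 hx2
    refine Tendsto.liminf_eq ?_
    exact (ENNReal.continuous_ofReal.tendsto _).comp ((hx1.const_mul C).sub hx2)
  have hR : ∀ k, ∫⁻ x in K, ENNReal.ofReal (C * mollify (φ k) (fun x => ‖z x‖ ^ 2) x -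
      Φ x (mollify (φ k) z x)) ≤ ENNReal.ofReal (C * ∫ x, ‖z x‖ ^ 2) := by
    intro k
    have hI : Integrable (fun x => C * mollify (φ k) (fun x => ‖z x‖ ^ 2) x -
        Φ x (mollify (φ k) z x)) (volume.restrict K) :=
      ((hmsq k).1.integrableOn.const_mul C).sub (hcm k)
    rw [← ofReal_integral_eq_lintegral_ofReal hI]
    · apply ENNReal.ofReal_le_ofReal
      rw [integral_sub ((hmsq k).1.integrableOn.const_mul C) (hcm k), integral_const_mul,
        ← hDK _ (hm0 k)]
      have h1 := hmol (φ k) ((hφlt k).trans_le (min_le_left _ _))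
      have h2 : ∫ x in K, mollify (φ k) (fun x => ‖z x‖ ^ 2) x ≤ ∫ x, ‖z x‖ ^ 2 := by
        rw [← (hmsq k).2]
        refine setIntegral_le_integral (hmsq k).1 (Eventually.of_forall fun x => ?_)
        exact (sq_nonneg _).trans (norm_mollify_sq_le (φ k) hz.locallyIntegrable
          hz2.locallyIntegrable x)
      nlinarith
    · filter_upwards [ae_restrict_mem hK.measurableSet] with x hx
      have h1 := (abs_le.1 (hC x hx (mollify (φ k) z x))).2
      have h2 := norm_mollify_sq_le (φ k) hz.locallyIntegrable hz2.locallyIntegrable x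
      have h3 := mul_le_mul_of_nonneg_left h2 hC0
      simp only [Pi.zero_apply]
      linarith
  have hfin : ∫⁻ x in K, ENNReal.ofReal (C * ‖z x‖ ^ 2 - Φ x (z x)) ≤
      ENNReal.ofReal (C * ∫ x, ‖z x‖ ^ 2) := by
    rw [← hL]
    refine hfatou.trans ?_
    exact (liminf_le_liminf (Eventually.of_forall hR)).trans (by simp)
  have hI : Integrable (fun x => C * ‖z x‖ ^ 2 - Φ x (z x)) (volume.restrict K) := hsq.sub hintK
  rw [← ofReal_integral_eq_lintegral_ofReal hI] at hfin
  · rw [ENNReal.ofReal_le_ofReal_iff (mul_nonneg hC0 (integral_nonneg fun x => sq_nonneg _)),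
      integral_sub hsq hintK, integral_const_mul] at hfin
    have h1 : ∫ x in K, ‖z x‖ ^ 2 = ∫ x, ‖z x‖ ^ 2 :=
      setIntegral_eq_integral_of_forall_compl_eq_zero fun x hx => by simp [hz0 x hx]
    rw [h1] at hfin
    constructor
    · refine IntegrableOn.of_forall_sdiff_eq_zero hintK hD.measurableSet fun x hx => ?_
      rw [hz0 x hx.2, hΦ0]
    · rw [hDK z hz0]
      linarith
  · filter_upwards [ae_restrict_mem hK.measurableSet] with x hx
    have h1 := (abs_le.1 (hC x hx (z x))).2
    simp only [Pi.zero_apply]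
    linarith

end Mollify

/-! ### The Bochner inequality for weakly differentiable forms with compact support -/

section WeakBochner

open Filter Topology Convolution

variable {n r q : ℕ}

attribute [local instance] Matrix.normedAddCommGroup Matrix.normedSpace

/-- The vector dual to a covector for the Euclidean metric. -/
noncomputable def dualVec : (EuclideanSpace ℝ (Fin n) →L[ℝ] ℝ) →L[ℝ] EuclideanSpace ℝ (Fin n) :=
  ∑ i, (ContinuousLinearMap.apply ℝ ℝ (coordVec i)).smulRight (coordVec i)

theorem dualVec_apply (θ : EuclideanSpace ℝ (Fin n) →L[ℝ] ℝ) :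
    dualVec θ = ∑ i, θ (coordVec i) • coordVec i := by
  simp [dualVec, _root_.sum_apply]

theorem contract_dualVec (θ : EuclideanSpace ℝ (Fin n) →L[ℝ] ℝ) (α : EForm n r (q + 1)) :
    contract (dualVec θ) α = ∑ i, θ (coordVec i) • contract (coordVec i) α := by
  rw [dualVec_apply, ← contractL_apply, map_sum, _root_.sum_apply]
  simp only [map_smul, _root_.smul_apply, contractL_apply]

theorem flatInner_wedgeCovector (θ : EuclideanSpace ℝ (Fin n) →L[ℝ] ℝ) (β : EForm n r q)
    (α : EForm n r (q + 1)) :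
    flatInner (wedgeCovector θ β) α = flatInner β (contract (dualVec θ) α) := by
  rw [wedgeCovector_eq_sum, contract_dualVec, flatInner_sum_left, flatInner_sum_right]
  simp only [flatInner_smul_left, flatInner_smul_right, flatInner_wedgeCovector_proj]

/-- `|θ ∧ α|²_G + |θ ⌟ α|²_G = |θ|² |α|²_G`. -/
theorem formInner_wedge_add_contract (G : Matrix (Fin r) (Fin r) ℝ)
    (θ : EuclideanSpace ℝ (Fin n) →L[ℝ] ℝ) (α : EForm n r (q + 1)) :
    formInner G (wedgeCovector θ α) (wedgeCovector θ α) +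
        formInner G (contract (dualVec θ) α) (contract (dualVec θ) α) =
      θ (dualVec θ) * formInner G α α := by
  simp only [formInner_eq]
  rw [matrixAct_wedgeCovector, flatInner_wedgeCovector, contract_wedgeCovector,
    flatInner_sub_right, flatInner_smul_right, flatInner_comm α (wedgeCovector _ _),
    flatInner_wedgeCovector, ← matrixAct_contract, flatInner_comm (matrixAct G _)]
  ring

theorem mollify_clm {Z W : Type*} [NormedAddCommGroup Z] [NormedSpace ℝ Z] [CompleteSpace Z]
    [NormedAddCommGroup W] [NormedSpace ℝ W] [CompleteSpace W] (L : Z →L[ℝ] W)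
    (φ : ContDiffBump (0 : EuclideanSpace ℝ (Fin n))) {z : EuclideanSpace ℝ (Fin n) → Z}
    (hz : LocallyIntegrable z) (x : EuclideanSpace ℝ (Fin n)) :
    mollify φ (fun y => L (z y)) x = L (mollify φ z x) := by
  unfold mollify
  rw [convolution_def, convolution_def, ← L.integral_comp_comm
    (φ.hasCompactSupport_normed.convolutionExists_left
      (ContinuousLinearMap.lsmul ℝ ℝ) (φ.continuous_normed (μ := volume)) hz x)]
  simp

theorem contDiff_mollify {Z : Type*} [NormedAddCommGroup Z] [NormedSpace ℝ Z] [CompleteSpace Z]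
    (φ : ContDiffBump (0 : EuclideanSpace ℝ (Fin n))) {z : EuclideanSpace ℝ (Fin n) → Z}
    (hz : LocallyIntegrable z) (k : ℕ∞) : ContDiff ℝ k (mollify φ z) :=
  φ.hasCompactSupport_normed.contDiff_convolution_left _ φ.contDiff_normed hz

/-- The test function `y ↦ ρ(x - y)` for which the weak equations compute derivatives of
mollifications at `x`. -/
noncomputable def mollifierAt (φ : ContDiffBump (0 : EuclideanSpace ℝ (Fin n)))
    (x y : EuclideanSpace ℝ (Fin n)) : ℝ := φ.normed volume (x - y)

theorem contDiff_mollifierAt (φ : ContDiffBump (0 : EuclideanSpace ℝ (Fin n)))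
    (x : EuclideanSpace ℝ (Fin n)) : ContDiff ℝ ∞ (mollifierAt φ x) :=
  φ.contDiff_normed.comp (contDiff_const.sub contDiff_id)

theorem mollify_eq {Z : Type*} [NormedAddCommGroup Z] [NormedSpace ℝ Z]
    (φ : ContDiffBump (0 : EuclideanSpace ℝ (Fin n))) (z : EuclideanSpace ℝ (Fin n) → Z)
    (x : EuclideanSpace ℝ (Fin n)) : mollify φ z x = ∫ y, mollifierAt φ x y • z y := by
  unfold mollify
  rw [convolution_eq_swap]
  rfl

theorem partialDeriv_mollify {Z : Type*} [NormedAddCommGroup Z] [NormedSpace ℝ Z] [CompleteSpace Z]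
    (φ : ContDiffBump (0 : EuclideanSpace ℝ (Fin n))) {z : EuclideanSpace ℝ (Fin n) → Z}
    (hz : LocallyIntegrable z) (i : Fin n) (x : EuclideanSpace ℝ (Fin n)) :
    partialDeriv i (mollify φ z) x =
      -∫ y, fderiv ℝ (mollifierAt φ x) y (coordVec i) • z y := by
  have h1 : ContDiff ℝ 1 (φ.normed (volume : Measure (EuclideanSpace ℝ (Fin n)))) :=
    φ.contDiff_normed
  have h2 := (φ.hasCompactSupport_normed (μ := volume)).hasFDerivAt_convolution_left
    (ContinuousLinearMap.lsmul ℝ ℝ) h1 hz x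
  unfold partialDeriv
  rw [show mollify φ z = (φ.normed volume ⋆[ContinuousLinearMap.lsmul ℝ ℝ, volume] z) from rfl,
    h2.fderiv, convolution_eq_swap]
  have h3 : Integrable (fun t => ((ContinuousLinearMap.lsmul ℝ ℝ).precompL
      (EuclideanSpace ℝ (Fin n)) (fderiv ℝ (φ.normed volume) (x - t))) (z t)) := by
    have h4 := ((φ.hasCompactSupport_normed (μ := volume)).fderiv (𝕜 := ℝ)).convolutionExists_left
      ((ContinuousLinearMap.lsmul ℝ ℝ).precompL (EuclideanSpace ℝ (Fin n)))
      (h1.continuous_fderiv one_ne_zero) hz x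
    simpa using h4.integrable_swap
  rw [ContinuousLinearMap.integral_apply h3, ← integral_neg]
  refine integral_congr_ae (Eventually.of_forall fun y => ?_)
  have h5 : HasFDerivAt (mollifierAt φ x)
      ((fderiv ℝ (φ.normed volume) (x - y)).comp
        (-(ContinuousLinearMap.id ℝ (EuclideanSpace ℝ (Fin n))))) y := by
    have h6 : HasFDerivAt (φ.normed volume) (fderiv ℝ (φ.normed volume) (x - y)) (x - y) :=
      (h1.differentiable one_ne_zero _).hasFDerivAt
    exact h6.comp y ((hasFDerivAt_id y).const_sub x)
  simp only [h5.fderiv]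
  simp

theorem continuousOn_bilin {S X Y Z : Type*} [TopologicalSpace S]
    [NormedAddCommGroup X] [NormedSpace ℝ X]
    [NormedAddCommGroup Y] [NormedSpace ℝ Y] [NormedAddCommGroup Z] [NormedSpace ℝ Z]
    (B : X →L[ℝ] Y →L[ℝ] Z) {s : Set S} {F : S → X} {H : S → Y}
    (hF : ContinuousOn F s) (hH : ContinuousOn H s) :
    ContinuousOn (fun x => B (F x) (H x)) s :=
  (B.continuous.comp_continuousOn hF).clm_apply hH

theorem continuousOn_curvature {D : Set (EuclideanSpace ℝ (Fin n))} (hD : IsOpen D)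
    {G : EuclideanSpace ℝ (Fin n) → Matrix (Fin r) (Fin r) ℝ} (hG : IsC2Metric D G)
    {S : Type*} [TopologicalSpace S] {s : Set S} {f : S → EuclideanSpace ℝ (Fin n)}
    {h : S → EForm n r (q + 1)} (hf : ContinuousOn f s) (hs : Set.MapsTo f s D)
    (hh : ContinuousOn h s) : ContinuousOn (fun p => curvatureOp G (f p) (h p)) s := by
  unfold curvatureOp
  refine ContinuousOn.neg (continuousOn_finsetSum _ fun i _ => continuousOn_finsetSum _
    fun j _ => ?_)
  refine continuousOn_bilin matrixActL ?_ ?_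
  · exact (contDiffOn_matrixPartial (k := 1) (m := 0) hD (contDiffOn_connection hD hG j)
      (by norm_num) i).continuousOn.comp hf hs
  · exact ((wedgeL _).continuous.comp (contractL _).continuous).comp_continuousOn hh

theorem continuousOn_bochnerForm {D : Set (EuclideanSpace ℝ (Fin n))} (hD : IsOpen D)
    {G : EuclideanSpace ℝ (Fin n) → Matrix (Fin r) (Fin r) ℝ} (hG : IsC2Metric D G) :
    ContinuousOn (fun p : EuclideanSpace ℝ (Fin n) ×
      (EForm n r (q + 1) × EForm n r (q + 2) × EForm n r q) =>
        bochnerForm G p.1 p.2.1 p.2.2.1 p.2.2.2) (D ×ˢ Set.univ) := by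
  have hfst : Set.MapsTo (fun p : EuclideanSpace ℝ (Fin n) ×
      (EForm n r (q + 1) × EForm n r (q + 2) × EForm n r q) => p.1) (D ×ˢ Set.univ) D :=
    fun p hp => hp.1
  have cG : ContinuousOn G D := (contDiffOn_matrix.2 hG.2).continuousOn
  have cG' : ContinuousOn (fun p : EuclideanSpace ℝ (Fin n) ×
      (EForm n r (q + 1) × EForm n r (q + 2) × EForm n r q) => G p.1) (D ×ˢ Set.univ) :=
    cG.comp continuous_fst.continuousOn hfst
  have key : ∀ {k : ℕ} {a b : EuclideanSpace ℝ (Fin n) ×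
      (EForm n r (q + 1) × EForm n r (q + 2) × EForm n r q) → EForm n r k},
      ContinuousOn a (D ×ˢ Set.univ) → ContinuousOn b (D ×ˢ Set.univ) →
      ContinuousOn (fun p => formInner (G p.1) (a p) (b p)) (D ×ˢ Set.univ) := by
    intro k a b ha hb
    simp only [formInner_eq]
    exact continuousOn_bilin flatInnerL ha (continuousOn_bilin matrixActL cG' hb)
  have c3 : ContinuousOn (fun p : EuclideanSpace ℝ (Fin n) ×
      (EForm n r (q + 1) × EForm n r (q + 2) × EForm n r q) =>
      p.2.2.2 - ∑ i, matrixAct (connection G i p.1) (contract (coordVec i) p.2.1))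
      (D ×ˢ Set.univ) := by
    refine ContinuousOn.sub (by fun_prop) (continuousOn_finsetSum _ fun i _ => ?_)
    refine continuousOn_bilin matrixActL ?_ ?_
    · exact (contDiffOn_connection hD hG i).continuousOn.comp continuous_fst.continuousOn hfst
    · exact ((contractL (coordVec i)).continuous.comp
        (continuous_fst.comp continuous_snd)).continuousOn
  unfold bochnerForm
  refine ((key (by fun_prop) (by fun_prop)).add (key c3 c3)).sub (key ?_ (by fun_prop))
  exact continuousOn_curvature hD hG (by fun_prop) hfst (by fun_prop)

theorem formInner_smul_smul (G : Matrix (Fin r) (Fin r) ℝ) (c : ℝ) (α β : EForm n r q) :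
    formInner G (c • α) (c • β) = c ^ 2 * formInner G α β := by
  rw [formInner_eq, formInner_eq, matrixAct_smul, flatInner_smul_left, flatInner_smul_right]
  ring

theorem curvatureOp_smul (G : EuclideanSpace ℝ (Fin n) → Matrix (Fin r) (Fin r) ℝ)
    (x : EuclideanSpace ℝ (Fin n)) (c : ℝ) (α : EForm n r (q + 1)) :
    curvatureOp G x (c • α) = c • curvatureOp G x α := by
  simp only [curvatureOp, contract_smul, wedgeCovector_smul, matrixAct_smul, smul_neg,
    Finset.smul_sum]

theorem bochnerForm_smul (G : EuclideanSpace ℝ (Fin n) → Matrix (Fin r) (Fin r) ℝ)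
    (x : EuclideanSpace ℝ (Fin n)) (c : ℝ) (β : EForm n r (q + 1)) (μ : EForm n r (q + 2))
    (ν : EForm n r q) :
    bochnerForm G x (c • β) (c • μ) (c • ν) = c ^ 2 * bochnerForm G x β μ ν := by
  have h : c • ν - ∑ i, matrixAct (connection G i x) (contract (coordVec i) (c • β)) =
      c • (ν - ∑ i, matrixAct (connection G i x) (contract (coordVec i) β)) := by
    rw [smul_sub, Finset.smul_sum]
    simp only [contract_smul, matrixAct_smul]
  unfold bochnerForm
  rw [h, curvatureOp_smul]
  simp only [formInner_smul_smul]
  ring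

theorem integrable_of_memLp_two {Z : Type*} [NormedAddCommGroup Z]
    {K : Set (EuclideanSpace ℝ (Fin n))} (hK : IsCompact K) {z : EuclideanSpace ℝ (Fin n) → Z}
    (hz : MemLp z 2) (hzK : ∀ x ∉ K, z x = 0) : Integrable z := by
  have : IsFiniteMeasure (volume.restrict K) := ⟨by simpa using hK.measure_lt_top⟩
  have h1 : IntegrableOn z K := (hz.restrict K).integrable (by norm_num)
  exact h1.integrable_of_forall_notMem_eq_zero hzK

theorem integrable_mollifierAt_smul {K : Set (EuclideanSpace ℝ (Fin n))} (hK : IsCompact K)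
    {Z : Type*} [NormedAddCommGroup Z] [NormedSpace ℝ Z]
    {β : EuclideanSpace ℝ (Fin n) → Z} (hβ : Integrable β) (hβK : ∀ x ∉ K, β x = 0)
    (φ : ContDiffBump (0 : EuclideanSpace ℝ (Fin n))) (x : EuclideanSpace ℝ (Fin n)) (i : Fin n) :
    Integrable fun y => fderiv ℝ (mollifierAt φ x) y (coordVec i) • β y := by
  have hcont : Continuous fun y => fderiv ℝ (mollifierAt φ x) y (coordVec i) :=
    ((contDiff_mollifierAt φ x).continuous_fderiv (by simp)).clm_apply continuous_const
  have h1 : IntegrableOn (fun y => fderiv ℝ (mollifierAt φ x) y (coordVec i) • β y) K :=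
    hβ.integrableOn.continuousOn_smul hcont.continuousOn hK
  exact h1.integrable_of_forall_notMem_eq_zero fun y hy => by simp [hβK y hy]

theorem extDeriv_mollify {K : Set (EuclideanSpace ℝ (Fin n))} (hK : IsCompact K)
    {β : EuclideanSpace ℝ (Fin n) → EForm n r q} {μ : EuclideanSpace ℝ (Fin n) → EForm n r (q + 1)}
    (hβ : Integrable β) (hβK : ∀ x ∉ K, β x = 0)
    (hd : ∀ φ : EuclideanSpace ℝ (Fin n) → ℝ, ContDiff ℝ ∞ φ →
      ∫ x, φ x • μ x = -∫ x, wedgeCovector (fderiv ℝ φ x) (β x))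
    (φ : ContDiffBump (0 : EuclideanSpace ℝ (Fin n))) (x : EuclideanSpace ℝ (Fin n)) :
    mollify φ μ x = extDeriv (mollify φ β) x := by
  have hint := integrable_mollifierAt_smul hK hβ hβK φ x
  rw [mollify_eq, hd _ (contDiff_mollifierAt φ x), extDeriv_eq_sum]
  have h1 : ∀ i : Fin n, wedgeCovector (EuclideanSpace.proj i) (partialDeriv i (mollify φ β) x) =
      -∫ y, wedgeL (EuclideanSpace.proj i)
        (fderiv ℝ (mollifierAt φ x) y (coordVec i) • β y) := by
    intro i
    rw [partialDeriv_mollify φ hβ.locallyIntegrable, ← wedgeL_apply, map_neg,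
      ContinuousLinearMap.integral_comp_comm _ (hint i)]
  simp only [h1]
  rw [Finset.sum_neg_distrib, ← integral_finsetSum _ fun i _ => (wedgeL _).integrable_comp (hint i)]
  congr 1
  refine integral_congr_ae (Eventually.of_forall fun y => ?_)
  simp only [wedgeL_apply, wedgeCovector_smul]
  exact wedgeCovector_eq_sum _ _

theorem codiff_mollify {K : Set (EuclideanSpace ℝ (Fin n))} (hK : IsCompact K)
    {β : EuclideanSpace ℝ (Fin n) → EForm n r (q + 1)} {ν : EuclideanSpace ℝ (Fin n) → EForm n r q}
    (hβ : Integrable β) (hβK : ∀ x ∉ K, β x = 0)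
    (hδ : ∀ φ : EuclideanSpace ℝ (Fin n) → ℝ, ContDiff ℝ ∞ φ →
      ∫ x, φ x • ν x = ∫ x, contract (dualVec (fderiv ℝ φ x)) (β x))
    (φ : ContDiffBump (0 : EuclideanSpace ℝ (Fin n))) (x : EuclideanSpace ℝ (Fin n)) :
    mollify φ ν x = codiff (mollify φ β) x := by
  have hint := integrable_mollifierAt_smul hK hβ hβK φ x
  rw [mollify_eq, hδ _ (contDiff_mollifierAt φ x), codiff]
  have h1 : ∀ i : Fin n, contract (coordVec i) (partialDeriv i (mollify φ β) x) =
      -∫ y, contractL (coordVec i) (fderiv ℝ (mollifierAt φ x) y (coordVec i) • β y) := by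
    intro i
    rw [partialDeriv_mollify φ hβ.locallyIntegrable, ← contractL_apply, map_neg,
      ContinuousLinearMap.integral_comp_comm _ (hint i)]
  simp only [h1]
  rw [Finset.sum_neg_distrib, neg_neg,
    ← integral_finsetSum _ fun i _ => (contractL _).integrable_comp (hint i)]
  refine integral_congr_ae (Eventually.of_forall fun y => ?_)
  simp only [contractL_apply, contract_smul]
  exact contract_dualVec _ _

theorem memLp_prodMk {X Y : Type*} [NormedAddCommGroup X] [NormedAddCommGroup Y]
    {f : EuclideanSpace ℝ (Fin n) → X} {g : EuclideanSpace ℝ (Fin n) → Y} (hf : MemLp f 2)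
    (hg : MemLp g 2) : MemLp (fun x => (f x, g x)) 2 := by
  refine (hf.norm.add hg.norm).mono (hf.1.prodMk hg.1) (Eventually.of_forall fun x => ?_)
  have e1 := norm_nonneg (f x)
  have e2 := norm_nonneg (g x)
  rw [Prod.norm_mk, Pi.add_apply, Real.norm_of_nonneg (by positivity)]
  exact max_le (by linarith) (by linarith)

/-- The Bochner inequality for an `L²` form `β` of compact support whose derivatives `dβ = μ` and
`δβ = ν` in the sense of distributions are in `L²`. As the coefficients of `d` and `δ` are constant,
mollification commutes with them, and no commutator has to be estimated. -/
theorem setIntegral_bochnerForm_nonneg_of_weak {D : Set (EuclideanSpace ℝ (Fin n))} (hD : IsOpen D)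
    {G : EuclideanSpace ℝ (Fin n) → Matrix (Fin r) (Fin r) ℝ} (hG : IsC2Metric D G)
    {K : Set (EuclideanSpace ℝ (Fin n))} (hK : IsCompact K) (hKD : K ⊆ D)
    {β : EuclideanSpace ℝ (Fin n) → EForm n r (q + 1)}
    {μ : EuclideanSpace ℝ (Fin n) → EForm n r (q + 2)}
    {ν : EuclideanSpace ℝ (Fin n) → EForm n r q}
    (hβ : MemLp β 2) (hμ : MemLp μ 2) (hν : MemLp ν 2)
    (hβK : ∀ x ∉ K, β x = 0) (hμK : ∀ x ∉ K, μ x = 0) (hνK : ∀ x ∉ K, ν x = 0)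
    (hd : ∀ φ : EuclideanSpace ℝ (Fin n) → ℝ, ContDiff ℝ ∞ φ →
      ∫ x, φ x • μ x = -∫ x, wedgeCovector (fderiv ℝ φ x) (β x))
    (hδ : ∀ φ : EuclideanSpace ℝ (Fin n) → ℝ, ContDiff ℝ ∞ φ →
      ∫ x, φ x • ν x = ∫ x, contract (dualVec (fderiv ℝ φ x)) (β x)) :
    IntegrableOn (fun x => bochnerForm G x (β x) (μ x) (ν x)) D ∧
      0 ≤ ∫ x in D, bochnerForm G x (β x) (μ x) (ν x) := by
  -- the triple `(β, dβ, δβ)` is mollified as a single function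
  obtain ⟨z, hz⟩ : ∃ z : EuclideanSpace ℝ (Fin n) →
      EForm n r (q + 1) × EForm n r (q + 2) × EForm n r q, z = fun x => (β x, μ x, ν x) := ⟨_, rfl⟩
  have z1 : (fun x => (z x).1) = β := by rw [hz]
  have z2 : (fun x => (z x).2.1) = μ := by rw [hz]
  have z3 : (fun x => (z x).2.2) = ν := by rw [hz]
  have hz2 : MemLp z 2 := hz ▸ memLp_prodMk hβ (memLp_prodMk hμ hν)
  have hzK : ∀ x ∉ K, z x = 0 := fun x hx => by
    simp [hz, hβK x hx, hμK x hx, hνK x hx]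
  have hzs : tsupport z ⊆ K := by
    refine closure_minimal (fun x hx => ?_) hK.isClosed
    by_contra h
    exact hx (hzK x h)
  have hzc : HasCompactSupport z := hK.of_isClosed_subset (isClosed_tsupport z) hzs
  have hz1 : Integrable z := integrable_of_memLp_two hK hz2 hzK
  have hzsq : Integrable fun x => ‖z x‖ ^ 2 := (memLp_two_iff_integrable_sq_norm hz2.1).1 hz2
  have hzl : LocallyIntegrable z := hz1.locallyIntegrable
  have hβ1 : Integrable β := integrable_of_memLp_two hK hβ hβK
  have hβl : LocallyIntegrable β := hβ1.locallyIntegrable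
  obtain ⟨ε, hε, hεD⟩ := IsCompact.exists_cthickening_subset_open hzc hD (hzs.trans hKD)
  have hβt : tsupport β ⊆ tsupport z := closure_mono fun x hx hx' => hx (by
    rw [← congrFun z1 x, hx']; rfl)
  have hmol : ∀ φ : ContDiffBump (0 : EuclideanSpace ℝ (Fin n)), φ.rOut < ε →
      0 ≤ ∫ x in D, bochnerForm G x (mollify φ z x).1 (mollify φ z x).2.1 (mollify φ z x).2.2 := by
    intro φ hφ
    have e1 : ∀ x, (mollify φ z x).1 = mollify φ β x := fun x => by
      rw [← z1]
      exact (mollify_clm (ContinuousLinearMap.fst ℝ _ _) φ hzl x).symm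
    have e2 : ∀ x, (mollify φ z x).2.1 = extDeriv (mollify φ β) x := fun x => by
      rw [← extDeriv_mollify hK hβ1 hβK hd φ, ← z2]
      exact (mollify_clm ((ContinuousLinearMap.fst ℝ _ _).comp (ContinuousLinearMap.snd ℝ _ _)) φ
        hzl x).symm
    have e3 : ∀ x, (mollify φ z x).2.2 = codiff (mollify φ β) x := fun x => by
      rw [← codiff_mollify hK hβ1 hβK hδ φ, ← z3]
      exact (mollify_clm ((ContinuousLinearMap.snd ℝ _ _).comp (ContinuousLinearMap.snd ℝ _ _)) φ
        hzl x).symm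
    have hm0 : ∀ x ∉ Metric.cthickening ε (tsupport z), mollify φ β x = 0 := fun x hx =>
      mollify_eq_zero φ fun h => hx (Metric.cthickening_mono hφ.le _
        (Metric.cthickening_subset_of_subset _ hβt h))
    have hmt : tsupport (mollify φ β) ⊆ Metric.cthickening ε (tsupport z) := by
      refine closure_minimal (fun x hx => ?_) Metric.isClosed_cthickening
      by_contra h
      exact hx (hm0 x h)
    simp only [e1, e2, e3]
    exact integral_bochnerForm_nonneg hD hG (α := mollify φ β) (contDiff_mollify φ hβl 2)
      (hzc.cthickening.of_isClosed_subset (isClosed_tsupport _) hmt) (hmt.trans hεD)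
  have hsm : ∀ x (c : ℝ) (w : EForm n r (q + 1) × EForm n r (q + 2) × EForm n r q),
      bochnerForm G x (c • w).1 (c • w).2.1 (c • w).2.2 =
        c ^ 2 * bochnerForm G x w.1 w.2.1 w.2.2 := fun x c w => by
    rw [Prod.smul_snd, Prod.smul_fst, Prod.smul_fst, Prod.smul_snd, bochnerForm_smul]
  have key := setIntegral_nonneg_of_mollify (z := z)
    (Φ := fun x (w : EForm n r (q + 1) × EForm n r (q + 2) × EForm n r q) =>
      bochnerForm G x w.1 w.2.1 w.2.2) hD (continuousOn_bochnerForm hD hG) hsm hz1 hzsq hzc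
    (hzs.trans hKD) hε hmol
  simpa only [hz] using key

end WeakBochner

/-! ### Test forms, local bounds for the metric, and weak solutions -/

section Cutoff

open Filter Topology

variable {n r q : ℕ}

attribute [local instance] Matrix.normedAddCommGroup Matrix.normedSpace

/-- `C²` forms with compact support in `D`. With `C²` in place of smooth test forms, products of a
cut-off function with the inverse of a `C²` metric may be used as test forms. -/
def IsTestForm (D : Set (EuclideanSpace ℝ (Fin n)))
    (γ : EuclideanSpace ℝ (Fin n) → EForm n r q) : Prop :=
  ContDiff ℝ 2 γ ∧ HasCompactSupport γ ∧ tsupport γ ⊆ D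

theorem contDiff_of_tsupport_subset {X : Type*} [NormedAddCommGroup X] [NormedSpace ℝ X]
    {k : ℕ∞ω} {D : Set (EuclideanSpace ℝ (Fin n))} (hD : IsOpen D)
    {F : EuclideanSpace ℝ (Fin n) → X} (hF : ContDiffOn ℝ k F D) (hs : tsupport F ⊆ D) :
    ContDiff ℝ k F := by
  refine contDiff_iff_contDiffAt.2 fun x => ?_
  by_cases hx : x ∈ D
  · exact hF.contDiffAt (hD.mem_nhds hx)
  · have : F =ᶠ[𝓝 x] fun _ => 0 := notMem_tsupport_iff_eventuallyEq.1 fun hx' => hx (hs hx')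
    exact contDiffAt_const.congr_of_eventuallyEq this

theorem tsupport_smul_subset {X : Type*} [NormedAddCommGroup X] [NormedSpace ℝ X]
    (ψ : EuclideanSpace ℝ (Fin n) → ℝ) (F : EuclideanSpace ℝ (Fin n) → X) :
    tsupport (fun x => ψ x • F x) ⊆ tsupport ψ :=
  closure_mono fun x hx hx' => hx (by
    have : ψ x = 0 := hx'
    simp [this])

theorem contDiff_smul_of_tsupport {X : Type*} [NormedAddCommGroup X] [NormedSpace ℝ X]
    {k : ℕ∞ω} {D : Set (EuclideanSpace ℝ (Fin n))} (hD : IsOpen D)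
    {ψ : EuclideanSpace ℝ (Fin n) → ℝ} (hψ : ContDiff ℝ k ψ) (hs : tsupport ψ ⊆ D)
    {F : EuclideanSpace ℝ (Fin n) → X} (hF : ContDiffOn ℝ k F D) :
    ContDiff ℝ k (fun x => ψ x • F x) :=
  contDiff_of_tsupport_subset hD (hψ.contDiffOn.smul hF) ((tsupport_smul_subset ψ F).trans hs)

theorem continuous_smul_of_tsupport {X : Type*} [NormedAddCommGroup X] [NormedSpace ℝ X]
    {D : Set (EuclideanSpace ℝ (Fin n))} (hD : IsOpen D)
    {ψ : EuclideanSpace ℝ (Fin n) → ℝ} (hψ : Continuous ψ) (hs : tsupport ψ ⊆ D)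
    {F : EuclideanSpace ℝ (Fin n) → X} (hF : ContinuousOn F D) :
    Continuous (fun x => ψ x • F x) :=
  contDiff_zero.1 (contDiff_smul_of_tsupport hD (contDiff_zero.2 hψ) hs
    (contDiffOn_zero.2 hF))

theorem integrableOn_of_continuousOn {X : Type*} [NormedAddCommGroup X] [NormedSpace ℝ X]
    {D K : Set (EuclideanSpace ℝ (Fin n))}
    (hK : IsCompact K) (hKD : K ⊆ D) {F : EuclideanSpace ℝ (Fin n) → X} (hF : ContinuousOn F D)
    (hFK : ∀ x ∉ K, F x = 0) : IntegrableOn F D :=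
  (((hF.mono hKD).integrableOn_compact hK).integrable_of_forall_notMem_eq_zero hFK).integrableOn

theorem partialDeriv_eq_zero {X : Type*} [NormedAddCommGroup X] [NormedSpace ℝ X]
    {F : EuclideanSpace ℝ (Fin n) → X} {x : EuclideanSpace ℝ (Fin n)} (hx : x ∉ tsupport F)
    (i : Fin n) : partialDeriv i F x = 0 := by
  have : F =ᶠ[𝓝 x] fun _ => 0 := notMem_tsupport_iff_eventuallyEq.1 hx
  simp [partialDeriv, this.fderiv_eq]

theorem codiff_eq_zero {γ : EuclideanSpace ℝ (Fin n) → EForm n r (q + 1)}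
    {x : EuclideanSpace ℝ (Fin n)} (hx : x ∉ tsupport γ) : codiff γ x = 0 := by
  simp [codiff, partialDeriv_eq_zero hx, contract_zero]

theorem contDiffOn_codiff {D : Set (EuclideanSpace ℝ (Fin n))} (hD : IsOpen D) {k m : ℕ∞ω}
    {γ : EuclideanSpace ℝ (Fin n) → EForm n r (q + 1)} (hγ : ContDiffOn ℝ k γ D)
    (hk : m + 1 ≤ k) : ContDiffOn ℝ m (codiff γ) D :=
  (ContDiffOn.sum fun i _ => contDiffOn_contract _ (contDiffOn_partialDeriv hD hγ hk i)).neg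

theorem contDiffOn_extDeriv {D : Set (EuclideanSpace ℝ (Fin n))} (hD : IsOpen D) {k m : ℕ∞ω}
    {γ : EuclideanSpace ℝ (Fin n) → EForm n r q} (hγ : ContDiffOn ℝ k γ D)
    (hk : m + 1 ≤ k) : ContDiffOn ℝ m (extDeriv γ) D := by
  have : extDeriv γ = fun x =>
      ∑ i, wedgeCovector (EuclideanSpace.proj i) (partialDeriv i γ x) :=
    funext fun x => extDeriv_eq_sum γ x
  rw [this]
  exact ContDiffOn.sum fun i _ => contDiffOn_wedgeCovector _ (contDiffOn_partialDeriv hD hγ hk i)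

/-- The codifferential is the formal adjoint of the exterior derivative. -/
theorem setIntegral_extDeriv_codiff {D : Set (EuclideanSpace ℝ (Fin n))} (hD : IsOpen D)
    {f : EuclideanSpace ℝ (Fin n) → EForm n r q} (hf : ContDiffOn ℝ 1 f D)
    {γ : EuclideanSpace ℝ (Fin n) → EForm n r (q + 1)} (hγ : ContDiffOn ℝ 1 γ D)
    {K : Set (EuclideanSpace ℝ (Fin n))} (hK : IsCompact K) (hKD : K ⊆ D)
    (hfγ : tsupport f ⊆ K ∨ tsupport γ ⊆ K) :
    ∫ x in D, flatInner (extDeriv f x) (γ x) = ∫ x in D, flatInner (f x) (codiff γ x) := by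
  let h : Fin n → EuclideanSpace ℝ (Fin n) → ℝ := fun i x =>
    flatInner (wedgeCovector (EuclideanSpace.proj i) (f x)) (γ x)
  have hh : ∀ i, ContDiffOn ℝ 1 (h i) D := fun i =>
    contDiffOn_flatInner (contDiffOn_wedgeCovector _ hf) hγ
  have hsub : ∀ i, tsupport (h i) ⊆ K := by
    intro i
    rcases hfγ with hs | hs
    · have : Function.support (h i) ⊆ Function.support f := fun x hx hx' =>
        hx (by simp only [h, hx', wedgeCovector_zero, flatInner_zero_left])
      exact (closure_mono this).trans hs
    · have : Function.support (h i) ⊆ Function.support γ := fun x hx hx' =>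
        hx (by simp only [h, hx', flatInner_zero_right])
      exact (closure_mono this).trans hs
  have hi := fun i => setIntegral_partialDeriv_eq_zero hD (hh i)
    (hK.of_isClosed_subset (isClosed_tsupport _) (hsub i)) ((hsub i).trans hKD) i
  have hzero : ∀ x ∉ K, (f x = 0 ∧ extDeriv f x = 0) ∨ (γ x = 0 ∧ codiff γ x = 0) := by
    intro x hx
    rcases hfγ with hs | hs
    · refine Or.inl ⟨image_eq_zero_of_notMem_tsupport fun h' => hx (hs h'), ?_⟩
      rw [extDeriv_eq_sum]
      exact Finset.sum_eq_zero fun i _ => by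
        rw [partialDeriv_eq_zero fun h' => hx (hs h'), wedgeCovector_zero]
    · exact Or.inr ⟨image_eq_zero_of_notMem_tsupport fun h' => hx (hs h'),
        codiff_eq_zero fun h' => hx (hs h')⟩
  have hI1 : IntegrableOn (fun x => flatInner (extDeriv f x) (γ x)) D := by
    refine integrableOn_of_continuousOn hK hKD (contDiffOn_flatInner (k := 0)
      (contDiffOn_extDeriv hD hf (by norm_num)) (hγ.of_le (by norm_num))).continuousOn ?_
    intro x hx
    rcases hzero x hx with h' | h' <;> simp [h', flatInner_zero_left, flatInner_zero_right]
  have hI2 : IntegrableOn (fun x => flatInner (f x) (codiff γ x)) D := by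
    refine integrableOn_of_continuousOn hK hKD (contDiffOn_flatInner (k := 0)
      (hf.of_le (by norm_num)) (contDiffOn_codiff hD hγ (by norm_num))).continuousOn ?_
    intro x hx
    rcases hzero x hx with h' | h' <;> simp [h', flatInner_zero_left, flatInner_zero_right]
  rw [← sub_eq_zero, ← integral_sub hI1 hI2]
  have hx : ∀ x ∈ D, flatInner (extDeriv f x) (γ x) - flatInner (f x) (codiff γ x) =
      ∑ i, partialDeriv i (h i) x := by
    intro x hx
    have df : DifferentiableAt ℝ f x :=
      (hf.contDiffAt (hD.mem_nhds hx)).differentiableAt one_ne_zero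
    have dγ : DifferentiableAt ℝ γ x :=
      (hγ.contDiffAt (hD.mem_nhds hx)).differentiableAt one_ne_zero
    have h1 : ∀ i, partialDeriv i (h i) x =
        flatInner (f x) (contract (coordVec i) (partialDeriv i γ x)) +
          flatInner (wedgeCovector (EuclideanSpace.proj i) (partialDeriv i f x)) (γ x) := by
      intro i
      have d1 : DifferentiableAt ℝ (fun y => wedgeCovector
          (EuclideanSpace.proj i : EuclideanSpace ℝ (Fin n) →L[ℝ] ℝ) (f y)) x :=
        (wedgeL (EuclideanSpace.proj i)).differentiableAt.comp x df
      rw [partialDeriv_flatInner i d1 dγ, partialDeriv_wedgeCovector i _ df,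
        flatInner_wedgeCovector_proj]
    simp only [h1]
    rw [extDeriv_eq_sum, codiff, flatInner_sum_left, flatInner_neg_right, flatInner_sum_right,
      Finset.sum_add_distrib]
    ring
  rw [setIntegral_congr_fun hD.measurableSet hx,
    integral_finsetSum _ fun i _ => (hi i).1.integrableOn]
  exact Finset.sum_eq_zero fun i _ => (hi i).2

theorem continuousOn_formInner {S : Type*} [TopologicalSpace S] {s : Set S}
    {D : Set (EuclideanSpace ℝ (Fin n))}
    {G : EuclideanSpace ℝ (Fin n) → Matrix (Fin r) (Fin r) ℝ} (hG : ContinuousOn G D)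
    {f : S → EuclideanSpace ℝ (Fin n)} (hf : ContinuousOn f s) (hs : Set.MapsTo f s D)
    {a b : S → EForm n r q} (ha : ContinuousOn a s) (hb : ContinuousOn b s) :
    ContinuousOn (fun p => formInner (G (f p)) (a p) (b p)) s := by
  simp only [formInner_eq]
  exact continuousOn_bilin flatInnerL ha (continuousOn_bilin matrixActL (hG.comp hf hs) hb)

/-- A metric is uniformly positive definite on compact sets. -/
theorem exists_norm_sq_le_formInner {D K : Set (EuclideanSpace ℝ (Fin n))} (hK : IsCompact K)
    (hKD : K ⊆ D) {G : EuclideanSpace ℝ (Fin n) → Matrix (Fin r) (Fin r) ℝ}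
    (hG : ContinuousOn G D) (hpos : ∀ x ∈ D, (G x).PosDef) :
    ∃ c, 0 < c ∧ ∀ x ∈ K, ∀ α : EForm n r q, ‖α‖ ^ 2 ≤ c * formInner (G x) α α := by
  have hS : IsCompact (K ×ˢ Metric.sphere (0 : EForm n r q) 1) := hK.prod (isCompact_sphere 0 1)
  have hcont : ContinuousOn (fun p : EuclideanSpace ℝ (Fin n) × EForm n r q =>
      formInner (G p.1) p.2 p.2) (K ×ˢ Metric.sphere (0 : EForm n r q) 1) :=
    continuousOn_formInner hG continuous_fst.continuousOn (fun p hp => hKD hp.1)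
      continuous_snd.continuousOn continuous_snd.continuousOn
  obtain ⟨m, hm, hmin⟩ : ∃ m : ℝ, 0 < m ∧ ∀ p ∈ K ×ˢ Metric.sphere (0 : EForm n r q) 1,
      m ≤ formInner (G p.1) p.2 p.2 := by
    rcases (K ×ˢ Metric.sphere (0 : EForm n r q) 1).eq_empty_or_nonempty with h | h
    · exact ⟨1, one_pos, by simp [h]⟩
    · obtain ⟨p, hp, hpm⟩ := hS.exists_isMinOn h hcont
      refine ⟨_, formInner_self_pos (hpos _ (hKD hp.1)) ?_, hpm⟩
      intro h0
      have := hp.2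
      simp [h0] at this
  refine ⟨m⁻¹, inv_pos.2 hm, fun x hx α => ?_⟩
  rcases eq_or_ne α 0 with rfl | hα
  · simpa using mul_nonneg (inv_pos.2 hm).le
      (formInner_self_nonneg (hpos x (hKD hx)).posSemidef (0 : EForm n r q))
  · have hα' : ‖α‖ ≠ 0 := norm_ne_zero_iff.2 hα
    have h1 : α = ‖α‖ • (‖α‖⁻¹ • α) := by rw [smul_smul, mul_inv_cancel₀ hα', one_smul]
    have h2 : m ≤ formInner (G x) (‖α‖⁻¹ • α) (‖α‖⁻¹ • α) := by
      refine hmin (x, ‖α‖⁻¹ • α) ⟨hx, ?_⟩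
      rw [mem_sphere_zero_iff_norm, norm_smul, norm_inv, norm_norm, inv_mul_cancel₀ hα']
    rw [inv_mul_eq_div, le_div_iff₀ hm, h1, formInner_smul_smul, ← h1]
    gcongr

theorem memLp_bilin {X Y Z : Type*} [NormedAddCommGroup X] [NormedSpace ℝ X]
    [NormedAddCommGroup Y] [NormedSpace ℝ Y] [NormedAddCommGroup Z] [NormedSpace ℝ Z]
    (B : X →L[ℝ] Y →L[ℝ] Z) {A : EuclideanSpace ℝ (Fin n) → X} (hA : Continuous A)
    (hAc : HasCompactSupport A) {w : EuclideanSpace ℝ (Fin n) → Y} (hw : MemLp w 2) :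
    MemLp (fun x => B (A x) (w x)) 2 := by
  obtain ⟨C, hC⟩ := hA.bounded_above_of_compact_support hAc
  refine hw.of_le_mul (c := ‖B‖ * C)
    (B.aestronglyMeasurable_comp₂ hA.aestronglyMeasurable hw.1) (Eventually.of_forall fun x => ?_)
  refine (B.le_opNorm₂ _ _).trans ?_
  gcongr
  exact hC x

theorem partialDeriv_congr {X : Type*} [NormedAddCommGroup X] [NormedSpace ℝ X]
    {F H : EuclideanSpace ℝ (Fin n) → X} {x : EuclideanSpace ℝ (Fin n)} (h : F =ᶠ[𝓝 x] H)
    (i : Fin n) : partialDeriv i F x = partialDeriv i H x := by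
  simp [partialDeriv, h.fderiv_eq]

theorem partialDeriv_const {X : Type*} [NormedAddCommGroup X] [NormedSpace ℝ X]
    (c : X) (i : Fin n) (x : EuclideanSpace ℝ (Fin n)) : partialDeriv i (fun _ => c) x = 0 := by
  simp [partialDeriv]

theorem partialDeriv_transpose {M : EuclideanSpace ℝ (Fin n) → Matrix (Fin r) (Fin r) ℝ}
    {x : EuclideanSpace ℝ (Fin n)} (hM : DifferentiableAt ℝ M x)
    (hs : ∀ᶠ y in 𝓝 x, (M y).transpose = M y) (i : Fin n) :
    (partialDeriv i M x).transpose = partialDeriv i M x := by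
  have h1 := partialDeriv_clm (LinearMap.toContinuousLinearMap
    (Matrix.transposeLinearEquiv (Fin r) (Fin r) ℝ ℝ).toLinearMap) i hM
  have h2 : (fun y => (LinearMap.toContinuousLinearMap
    (Matrix.transposeLinearEquiv (Fin r) (Fin r) ℝ ℝ).toLinearMap) (M y)) =ᶠ[𝓝 x] M := hs
  exact h1.symm.trans (partialDeriv_congr h2 i)

theorem IsC2Metric.transpose_eq {D : Set (EuclideanSpace ℝ (Fin n))}
    {G : EuclideanSpace ℝ (Fin n) → Matrix (Fin r) (Fin r) ℝ} (hG : IsC2Metric D G)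
    {x : EuclideanSpace ℝ (Fin n)} (hx : x ∈ D) : (G x).transpose = G x := by
  have := (hG.1 x hx).isHermitian
  rwa [Matrix.IsHermitian, Matrix.conjTranspose_eq_transpose_of_trivial] at this

theorem IsC2Metric.isUnit_det {D : Set (EuclideanSpace ℝ (Fin n))}
    {G : EuclideanSpace ℝ (Fin n) → Matrix (Fin r) (Fin r) ℝ} (hG : IsC2Metric D G)
    {x : EuclideanSpace ℝ (Fin n)} (hx : x ∈ D) : IsUnit (G x).det :=
  (hG.1 x hx).det_pos.ne'.isUnit

theorem IsC2Metric.contDiffOn {D : Set (EuclideanSpace ℝ (Fin n))}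
    {G : EuclideanSpace ℝ (Fin n) → Matrix (Fin r) (Fin r) ℝ} (hG : IsC2Metric D G) :
    ContDiffOn ℝ 2 G D := contDiffOn_matrix.2 hG.2

theorem IsC2Metric.contDiffOn_inv {D : Set (EuclideanSpace ℝ (Fin n))}
    {G : EuclideanSpace ℝ (Fin n) → Matrix (Fin r) (Fin r) ℝ} (hG : IsC2Metric D G) :
    ContDiffOn ℝ 2 (fun x => (G x)⁻¹) D :=
  contDiffOn_matrix_inv hG.contDiffOn fun x hx => (hG.1 x hx).det_pos.ne'

/-- `∂_i (G⁻¹) G = -Γ_i`. -/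
theorem partialDeriv_inv_mul {D : Set (EuclideanSpace ℝ (Fin n))} (hD : IsOpen D)
    {G : EuclideanSpace ℝ (Fin n) → Matrix (Fin r) (Fin r) ℝ} (hG : IsC2Metric D G)
    {x : EuclideanSpace ℝ (Fin n)} (hx : x ∈ D) (i : Fin n) :
    partialDeriv i (fun y => (G y)⁻¹) x * G x = -connection G i x := by
  have dG : DifferentiableAt ℝ G x :=
    (hG.contDiffOn.contDiffAt (hD.mem_nhds hx)).differentiableAt two_ne_zero
  have dI : DifferentiableAt ℝ (fun y => (G y)⁻¹) x :=
    (hG.contDiffOn_inv.contDiffAt (hD.mem_nhds hx)).differentiableAt two_ne_zero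
  have h2 : (fun y => matrixMulL (G y)⁻¹ (G y)) =ᶠ[𝓝 x] fun _ => 1 := by
    filter_upwards [hD.mem_nhds hx] with y hy
    exact Matrix.nonsing_inv_mul _ (hG.isUnit_det hy)
  have h3 : partialDeriv i (fun y => matrixMulL (G y)⁻¹ (G y)) x = 0 :=
    (partialDeriv_congr h2 i).trans (partialDeriv_const _ i x)
  have h1 : 0 = (G x)⁻¹ * partialDeriv i G x + partialDeriv i (fun y => (G y)⁻¹) x * G x :=
    h3.symm.trans (partialDeriv_bilin matrixMulL i dI dG)
  rw [connection, matrixPartial_eq dG]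
  exact (neg_eq_of_add_eq_zero_right h1.symm).symm

/-- Data produced by the orthogonal projection: a square integrable form `α` on `D` with `dα = 0`
and `δ(G α) = δγ` in the sense of distributions. -/
structure IsWeakSolution (D : Set (EuclideanSpace ℝ (Fin n)))
    (G : EuclideanSpace ℝ (Fin n) → Matrix (Fin r) (Fin r) ℝ)
    (γ α : EuclideanSpace ℝ (Fin n) → EForm n r (q + 1)) : Prop where
  aestronglyMeasurable : AEStronglyMeasurable α (volume.restrict D)
  integrableOn : IntegrableOn (fun x => formInner (G x) (α x) (α x)) D
  closed : ∀ γ' : EuclideanSpace ℝ (Fin n) → EForm n r (q + 2), IsTestForm D γ' →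
    ∫ x in D, flatInner (α x) (codiff γ' x) = 0
  codiff_eq : ∀ ζ : EuclideanSpace ℝ (Fin n) → EForm n r q, IsTestForm D ζ →
    ∫ x in D, flatInner (matrixAct (G x) (α x)) (extDeriv ζ x) =
      ∫ x in D, flatInner (codiff γ x) (ζ x)

theorem memLp_indicator_of_restrict {Z : Type*} [NormedAddCommGroup Z]
    {K : Set (EuclideanSpace ℝ (Fin n))} (hK : MeasurableSet K)
    {z : EuclideanSpace ℝ (Fin n) → Z} (hz : MemLp z 2 (volume.restrict K)) :
    MemLp (K.indicator z) 2 :=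
  (memLp_indicator_iff_restrict hK).2 hz

/-- A form which is square integrable for `G` is square integrable on compact sets for the Euclidean
metric. -/
theorem memLp_indicator {D K : Set (EuclideanSpace ℝ (Fin n))} (hK : IsCompact K)
    (hKD : K ⊆ D) {G : EuclideanSpace ℝ (Fin n) → Matrix (Fin r) (Fin r) ℝ}
    (hG : IsC2Metric D G) {α : EuclideanSpace ℝ (Fin n) → EForm n r q}
    (hm : AEStronglyMeasurable α (volume.restrict D))
    (hi : IntegrableOn (fun x => formInner (G x) (α x) (α x)) D) :
    MemLp (K.indicator α) 2 := by
  have hm' : AEStronglyMeasurable α (volume.restrict K) :=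
    hm.mono_measure (Measure.restrict_mono hKD le_rfl)
  refine memLp_indicator_of_restrict hK.measurableSet ?_
  refine (memLp_two_iff_integrable_sq_norm hm').2 ?_
  obtain ⟨c, hc, hcK⟩ := exists_norm_sq_le_formInner (q := q) hK hKD hG.contDiffOn.continuousOn hG.1
  refine ((hi.mono_set hKD).const_mul c).mono' (hm'.norm.pow 2) ?_
  filter_upwards [ae_restrict_mem hK.measurableSet] with x hx
  simpa using hcK x hx (α x)

theorem eq_zero_of_forall_integral_flatInner {μ : Measure (EuclideanSpace ℝ (Fin n))}
    {F : EuclideanSpace ℝ (Fin n) → EForm n r q}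
    (hF : Integrable F μ) (h : ∀ b, ∫ x, flatInner (F x) b ∂μ = 0) : ∫ x, F x ∂μ = 0 := by
  apply eq_zero_of_flatInner_self
  rw [← h (∫ x, F x ∂μ)]
  exact ((flatInnerL.flip (∫ x, F x ∂μ)).integral_comp_comm hF).symm

theorem partialDeriv_smul_const {X : Type*} [NormedAddCommGroup X] [NormedSpace ℝ X]
    {ψ : EuclideanSpace ℝ (Fin n) → ℝ} {x : EuclideanSpace ℝ (Fin n)}
    (hψ : DifferentiableAt ℝ ψ x) (b : X) (i : Fin n) :
    partialDeriv i (fun y => ψ y • b) x = fderiv ℝ ψ x (coordVec i) • b := by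
  unfold partialDeriv
  rw [fderiv_smul_const hψ b]
  rfl

theorem codiff_smul_const {ψ : EuclideanSpace ℝ (Fin n) → ℝ} {x : EuclideanSpace ℝ (Fin n)}
    (hψ : DifferentiableAt ℝ ψ x) (b : EForm n r (q + 1)) :
    codiff (fun y => ψ y • b) x = -contract (dualVec (fderiv ℝ ψ x)) b := by
  simp only [codiff, partialDeriv_smul_const hψ, contract_smul, contract_dualVec]

end Cutoff

/-! ### The curvature inequality for a weak solution, with a cut-off function -/

section CutoffInequality

open Filter Topology

variable {n r q : ℕ}

attribute [local instance] Matrix.normedAddCommGroup Matrix.normedSpace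

theorem flatInner_indicator (K : Set (EuclideanSpace ℝ (Fin n)))
    (α w : EuclideanSpace ℝ (Fin n) → EForm n r q) {x : EuclideanSpace ℝ (Fin n)}
    (hw : x ∉ K → w x = 0) :
    flatInner (K.indicator α x) (w x) = flatInner (α x) (w x) := by
  by_cases hx : x ∈ K
  · rw [Set.indicator_of_mem hx]
  · rw [hw hx, flatInner_zero_right, flatInner_zero_right]

theorem fderiv_eq_zero_of_notMem {X : Type*} [NormedAddCommGroup X] [NormedSpace ℝ X]
    {ψ : EuclideanSpace ℝ (Fin n) → X} {x : EuclideanSpace ℝ (Fin n)} (hx : x ∉ tsupport ψ) :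
    fderiv ℝ ψ x = 0 := by
  have : ψ =ᶠ[𝓝 x] fun _ => 0 := notMem_tsupport_iff_eventuallyEq.1 hx
  simp [this.fderiv_eq]

theorem smul_neg_wedge (c : ℝ) (θ : EuclideanSpace ℝ (Fin n) →L[ℝ] ℝ) (β : EForm n r q) :
    c • wedgeCovector θ (-β) = -(c • wedgeCovector θ β) := by
  have h : wedgeCovector θ (-β) = -wedgeCovector θ β := map_neg (wedgeL θ) β
  rw [h, smul_neg]

theorem hasCompactSupport_smul {X : Type*} [NormedAddCommGroup X] [NormedSpace ℝ X]
    {ψ : EuclideanSpace ℝ (Fin n) → ℝ} (hc : HasCompactSupport ψ)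
    (F : EuclideanSpace ℝ (Fin n) → X) : HasCompactSupport (fun x => ψ x • F x) :=
  hc.of_isClosed_subset (isClosed_tsupport _) (tsupport_smul_subset ψ F)

theorem memLp_contract_dualVec {ψ : EuclideanSpace ℝ (Fin n) → ℝ} (hψ : ContDiff ℝ ∞ ψ)
    (hc : HasCompactSupport ψ) {w : EuclideanSpace ℝ (Fin n) → EForm n r (q + 1)}
    (hw : MemLp w 2) : MemLp (fun x => contract (dualVec (fderiv ℝ ψ x)) (w x)) 2 :=
  memLp_bilin (contractL ∘L dualVec) (hψ.continuous_fderiv (by simp)) (hc.fderiv ℝ) hw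

theorem memLp_wedgeCovector {ψ : EuclideanSpace ℝ (Fin n) → ℝ} (hψ : ContDiff ℝ ∞ ψ)
    (hc : HasCompactSupport ψ) {w : EuclideanSpace ℝ (Fin n) → EForm n r q}
    (hw : MemLp w 2) : MemLp (fun x => wedgeCovector (fderiv ℝ ψ x) (w x)) 2 :=
  memLp_bilin wedgeL (hψ.continuous_fderiv (by simp)) (hc.fderiv ℝ) hw

theorem memLp_two_finsetSum {ι Z : Type*} [NormedAddCommGroup Z] (s : Finset ι)
    {f : ι → EuclideanSpace ℝ (Fin n) → Z} (hf : ∀ i ∈ s, MemLp (f i) 2) :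
    MemLp (fun x => ∑ i ∈ s, f i x) 2 := memLp_finsetSum s hf

/-- Stated for a general normed space `Z`, like the following lemmas of this kind, because the topology
of `EForm n r q` is not reducibly the one of its norm, which obstructs unification. -/
theorem integrable_fun_add {Z : Type*} [NormedAddCommGroup Z]
    {μ : Measure (EuclideanSpace ℝ (Fin n))} {f g : EuclideanSpace ℝ (Fin n) → Z}
    (hf : Integrable f μ) (hg : Integrable g μ) : Integrable (fun x => f x + g x) μ := hf.add hg

theorem integrable_fun_sub {Z : Type*} [NormedAddCommGroup Z]
    {μ : Measure (EuclideanSpace ℝ (Fin n))} {f g : EuclideanSpace ℝ (Fin n) → Z}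
    (hf : Integrable f μ) (hg : Integrable g μ) : Integrable (fun x => f x - g x) μ := hf.sub hg

theorem memLp_connection {D : Set (EuclideanSpace ℝ (Fin n))} (hD : IsOpen D)
    {G : EuclideanSpace ℝ (Fin n) → Matrix (Fin r) (Fin r) ℝ} (hG : IsC2Metric D G)
    {ψ : EuclideanSpace ℝ (Fin n) → ℝ} (hψ : ContDiff ℝ ∞ ψ)
    (hc : HasCompactSupport ψ) (hs : tsupport ψ ⊆ D)
    {w : EuclideanSpace ℝ (Fin n) → EForm n r (q + 1)} (hw : MemLp w 2) :
    MemLp (fun x => ψ x • ∑ i, matrixAct (connection G i x) (contract (coordVec i) (w x))) 2 := by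
  have hterm : ∀ i, MemLp (fun x => matrixActL (ψ x • connection G i x)
      (contractL (coordVec i) (w x))) 2 := by
    intro i
    have h1 : Continuous (fun x => ψ x • connection G i x) :=
      continuous_smul_of_tsupport hD hψ.continuous hs
        (contDiffOn_connection hD hG i).continuousOn
    have h2 : HasCompactSupport (fun x => ψ x • connection G i x) := hasCompactSupport_smul hc _
    have h3 : MemLp (fun x => contractL (coordVec i) (w x)) 2 :=
      (contractL (coordVec i)).comp_memLp' hw
    exact memLp_bilin (matrixActL (n := n) (q := q)) h1 h2 h3
  refine (memLp_congr_ae (ae_of_all _ fun x => ?_)).2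
    (memLp_two_finsetSum Finset.univ fun i _ => hterm i)
  rw [Finset.smul_sum]
  exact Finset.sum_congr rfl fun i _ => (matrixAct_smul_left _ _ _).symm

theorem contDiff_two_of_infty {ψ : EuclideanSpace ℝ (Fin n) → ℝ} (hψ : ContDiff ℝ ∞ ψ) :
    ContDiff ℝ 2 ψ := by
  exact_mod_cast contDiff_infty.1 hψ 2

theorem isTestForm_smul {D : Set (EuclideanSpace ℝ (Fin n))} (hD : IsOpen D)
    {ψ : EuclideanSpace ℝ (Fin n) → ℝ} (hψ : ContDiff ℝ ∞ ψ) (hc : HasCompactSupport ψ)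
    (hs : tsupport ψ ⊆ D) {F : EuclideanSpace ℝ (Fin n) → EForm n r q}
    (hF : ContDiffOn ℝ 2 F D) : IsTestForm (r := r) (q := q) D (fun x => ψ x • F x) :=
  ⟨contDiff_smul_of_tsupport hD (contDiff_two_of_infty hψ) hs hF, hasCompactSupport_smul hc F,
    (tsupport_smul_subset ψ F).trans hs⟩

/-- The weak solution is closed, tested against scalar functions. -/
theorem IsWeakSolution.integral_wedgeCovector {D : Set (EuclideanSpace ℝ (Fin n))}
    (hD : IsOpen D)
    {G : EuclideanSpace ℝ (Fin n) → Matrix (Fin r) (Fin r) ℝ} (hG : IsC2Metric D G)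
    {γ α : EuclideanSpace ℝ (Fin n) → EForm n r (q + 1)} (h : IsWeakSolution D G γ α)
    {K : Set (EuclideanSpace ℝ (Fin n))} (hK : IsCompact K) (hKD : K ⊆ D)
    {ψ : EuclideanSpace ℝ (Fin n) → ℝ} (hψ : ContDiff ℝ ∞ ψ) (hψK : tsupport ψ ⊆ K) :
    ∫ x, wedgeCovector (fderiv ℝ ψ x) (K.indicator α x) = 0 := by
  have hc : HasCompactSupport ψ := hK.of_isClosed_subset (isClosed_tsupport _) hψK
  have hα : MemLp (K.indicator α) 2 := memLp_indicator hK hKD hG h.1 h.2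
  have hd0 : ∀ x ∉ K, fderiv ℝ ψ x = 0 := fun x hx => fderiv_eq_zero_of_notMem fun h' => hx (hψK h')
  refine eq_zero_of_forall_integral_flatInner (integrable_of_memLp_two hK
    (memLp_wedgeCovector hψ hc hα) fun x hx => by rw [hd0 x hx, wedgeCovector_zero_left]) ?_
  intro b
  have hcod : ∀ x, codiff (fun y => ψ y • b) x = -contract (dualVec (fderiv ℝ ψ x)) b := fun x =>
    codiff_smul_const (hψ.differentiable (by simp) x) b
  have h1 : ∀ x, flatInner (wedgeCovector (fderiv ℝ ψ x) (K.indicator α x)) b =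
      -flatInner (α x) (codiff (fun y => ψ y • b) x) := by
    intro x
    rw [hcod, flatInner_neg_right, neg_neg, flatInner_wedgeCovector]
    refine flatInner_indicator K α (fun x => contract (dualVec (fderiv ℝ ψ x)) b) fun hx => ?_
    rw [hd0 x hx, map_zero, ← contractL_apply, map_zero]
    rfl
  simp only [h1]
  rw [integral_neg, neg_eq_zero, ← setIntegral_eq_integral_of_forall_compl_eq_zero (s := D)]
  · exact h.closed _ (isTestForm_smul hD hψ hc (hψK.trans hKD) contDiffOn_const)
  · intro x hx
    rw [hcod, hd0 x fun h' => hx (hKD h'), map_zero, ← contractL_apply, map_zero]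
    simp [flatInner_zero_right]

/-- The weak codifferential of `α`: `δα = G⁻¹ δγ + ∑ Γ_i ι_i α`, tested against scalar functions. -/
theorem IsWeakSolution.integral_contract {D : Set (EuclideanSpace ℝ (Fin n))} (hD : IsOpen D)
    {G : EuclideanSpace ℝ (Fin n) → Matrix (Fin r) (Fin r) ℝ} (hG : IsC2Metric D G)
    {γ α : EuclideanSpace ℝ (Fin n) → EForm n r (q + 1)} (hγ : IsTestForm D γ)
    (h : IsWeakSolution D G γ α)
    {K : Set (EuclideanSpace ℝ (Fin n))} (hK : IsCompact K) (hKD : K ⊆ D)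
    {ψ : EuclideanSpace ℝ (Fin n) → ℝ} (hψ : ContDiff ℝ ∞ ψ) (hψK : tsupport ψ ⊆ K) :
    ∫ x, contract (dualVec (fderiv ℝ ψ x)) (K.indicator α x) =
      ∫ x, (ψ x • matrixAct (G x)⁻¹ (codiff γ x) +
        ψ x • ∑ i, matrixAct (connection G i x) (contract (coordVec i) (K.indicator α x))) := by
  have hc : HasCompactSupport ψ := hK.of_isClosed_subset (isClosed_tsupport _) hψK
  have hα : MemLp (K.indicator α) 2 := memLp_indicator hK hKD hG h.1 h.2
  have hd0 : ∀ x ∉ K, fderiv ℝ ψ x = 0 := fun x hx => fderiv_eq_zero_of_notMem fun h' => hx (hψK h')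
  have hψ0 : ∀ x ∉ K, ψ x = 0 := fun x hx => image_eq_zero_of_notMem_tsupport fun h' => hx (hψK h')
  have hcontr0 : ∀ x ∉ K, ∀ b : EForm n r (q + 1), contract (dualVec (fderiv ℝ ψ x)) b = 0 :=
    fun x hx b => by rw [hd0 x hx, map_zero, ← contractL_apply, map_zero]; rfl
  have hcodγ : ContDiffOn ℝ 0 (codiff γ) D :=
    contDiffOn_codiff hD hγ.1.contDiffOn (by norm_num)
  have hI1 : Integrable (fun x => contract (dualVec (fderiv ℝ ψ x)) (K.indicator α x)) :=
    integrable_of_memLp_two hK (memLp_contract_dualVec hψ hc hα) fun x hx => hcontr0 x hx _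
  have hI2 : Integrable (fun x => ψ x • matrixAct (G x)⁻¹ (codiff γ x)) := by
    refine (continuous_smul_of_tsupport hD hψ.continuous (hψK.trans hKD)
      (contDiffOn_matrixAct (k := 0) (hG.contDiffOn_inv.of_le (by norm_num))
        hcodγ).continuousOn).integrable_of_hasCompactSupport (hasCompactSupport_smul hc _)
  have hI3 : Integrable (fun x => ψ x • ∑ i, matrixAct (connection G i x)
      (contract (coordVec i) (K.indicator α x))) :=
    integrable_of_memLp_two hK (memLp_connection hD hG hψ hc (hψK.trans hKD) hα) fun x hx => by
      rw [hψ0 x hx, zero_smul]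
  have hI23 : Integrable (fun x => ψ x • matrixAct (G x)⁻¹ (codiff γ x) +
      ψ x • ∑ i, matrixAct (connection G i x) (contract (coordVec i) (K.indicator α x))) :=
    integrable_fun_add hI2 hI3
  rw [← sub_eq_zero, ← integral_sub hI1 hI23]
  refine eq_zero_of_forall_integral_flatInner (integrable_fun_sub hI1 hI23) fun b => ?_
  -- the factor `G⁻¹` in the test form compensates the factor `G` in `δ(G α)`
  have hζ : IsTestForm (r := r) (q := q) D (fun x => ψ x • matrixAct (G x)⁻¹ b) :=
    isTestForm_smul hD hψ hc (hψK.trans hKD)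
      (contDiffOn_matrixAct hG.contDiffOn_inv contDiffOn_const)
  have key := h.codiff_eq _ hζ
  have hζd : ∀ x ∈ D, matrixAct (G x) (extDeriv (fun x => ψ x • matrixAct (G x)⁻¹ b) x) =
      wedgeCovector (fderiv ℝ ψ x) b - ψ x • ∑ i, wedgeCovector (EuclideanSpace.proj i)
        (matrixAct (connection G i x).transpose b) := by
    intro x hx
    have dI : DifferentiableAt ℝ (fun y => (G y)⁻¹) x :=
      (hG.contDiffOn_inv.contDiffAt (hD.mem_nhds hx)).differentiableAt two_ne_zero
    have dIb : DifferentiableAt ℝ (fun y => matrixAct (G y)⁻¹ b) x :=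
      (matrixActL.flip b).differentiableAt.comp x dI
    have dψ : DifferentiableAt ℝ ψ x := hψ.differentiable (by simp) x
    have hinv : ∀ i, G x * partialDeriv i (fun y => (G y)⁻¹) x =
        -(connection G i x).transpose := by
      intro i
      have hsymm : ∀ᶠ y in 𝓝 x, ((G y)⁻¹).transpose = (G y)⁻¹ := by
        filter_upwards [hD.mem_nhds hx] with y hy
        rw [Matrix.transpose_nonsing_inv, hG.transpose_eq hy]
      rw [← Matrix.transpose_neg, ← partialDeriv_inv_mul hD hG hx i, Matrix.transpose_mul,
        hG.transpose_eq hx, partialDeriv_transpose dI hsymm]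
    have hp : ∀ i, partialDeriv i (fun y => ψ y • matrixAct (G y)⁻¹ b) x =
        ψ x • matrixAct (partialDeriv i (fun y => (G y)⁻¹) x) b +
          fderiv ℝ ψ x (coordVec i) • matrixAct (G x)⁻¹ b := by
      intro i
      have h1 := partialDeriv_bilin (ContinuousLinearMap.lsmul ℝ ℝ) i dψ dIb
      have h2 := partialDeriv_clm (matrixActL.flip b) i dI
      exact h1.trans (congrArg (fun w => ψ x • w +
        fderiv ℝ ψ x (coordVec i) • matrixAct (G x)⁻¹ b) h2)
    rw [extDeriv_eq_sum, matrixAct_sum, wedgeCovector_eq_sum (fderiv ℝ ψ x), Finset.smul_sum,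
      ← Finset.sum_sub_distrib]
    refine Finset.sum_congr rfl fun i _ => ?_
    rw [hp, matrixAct_wedgeCovector, matrixAct_add, matrixAct_smul, matrixAct_smul,
      ← matrixAct_mul, ← matrixAct_mul, hinv, Matrix.mul_nonsing_inv _ (hG.isUnit_det hx),
      matrixAct_one, matrixAct_neg_left, wedgeCovector_add, wedgeCovector_smul, wedgeCovector_smul,
      smul_neg_wedge]
    abel
  have hleft : ∀ x ∈ D, flatInner (matrixAct (G x) (α x))
      (extDeriv (fun x => ψ x • matrixAct (G x)⁻¹ b) x) =
      flatInner (contract (dualVec (fderiv ℝ ψ x)) (K.indicator α x)) b -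
        flatInner (ψ x • ∑ i, matrixAct (connection G i x)
          (contract (coordVec i) (K.indicator α x))) b := by
    intro x hx
    rw [flatInner_matrixAct, hG.transpose_eq hx, hζd x hx, flatInner_sub_right]
    congr 1
    · rw [← flatInner_indicator K α (fun x => wedgeCovector (fderiv ℝ ψ x) b), flatInner_comm,
        flatInner_wedgeCovector, flatInner_comm]
      intro hx'
      rw [hd0 x hx', wedgeCovector_zero_left]
    · rw [← flatInner_indicator K α (fun x => ψ x • ∑ i, wedgeCovector (EuclideanSpace.proj i)
        (matrixAct (connection G i x).transpose b)), flatInner_smul_right, flatInner_smul_left,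
        flatInner_sum_right, flatInner_sum_left]
      · congr 1
        refine Finset.sum_congr rfl fun i _ => ?_
        rw [flatInner_comm, flatInner_wedgeCovector_proj, flatInner_comm, flatInner_matrixAct]
      · intro hx'
        rw [hψ0 x hx', zero_smul]
  have hright : ∀ x ∈ D, flatInner (codiff γ x) (ψ x • matrixAct (G x)⁻¹ b) =
      flatInner (ψ x • matrixAct (G x)⁻¹ (codiff γ x)) b := by
    intro x hx
    rw [flatInner_smul_right, flatInner_smul_left, flatInner_matrixAct,
      Matrix.transpose_nonsing_inv, hG.transpose_eq hx]
  rw [setIntegral_congr_fun hD.measurableSet hleft,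
    setIntegral_congr_fun hD.measurableSet hright] at key
  have J1 : Integrable
      (fun x => flatInner (contract (dualVec (fderiv ℝ ψ x)) (K.indicator α x)) b) :=
    (flatInnerL.flip b).integrable_comp hI1
  have J2 : Integrable (fun x => flatInner (ψ x • matrixAct (G x)⁻¹ (codiff γ x)) b) :=
    (flatInnerL.flip b).integrable_comp hI2
  have J3 : Integrable (fun x => flatInner (ψ x • ∑ i, matrixAct (connection G i x)
      (contract (coordVec i) (K.indicator α x))) b) :=
    (flatInnerL.flip b).integrable_comp hI3
  have J13 : Integrable (fun x =>
      flatInner (contract (dualVec (fderiv ℝ ψ x)) (K.indicator α x)) b -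
        flatInner (ψ x • ∑ i, matrixAct (connection G i x)
          (contract (coordVec i) (K.indicator α x))) b) := J1.sub J3
  rw [setIntegral_eq_integral_of_forall_compl_eq_zero,
    setIntegral_eq_integral_of_forall_compl_eq_zero] at key
  · simp only [flatInner_sub_left, flatInner_add_left]
    have : ∀ x, flatInner (contract (dualVec (fderiv ℝ ψ x)) (K.indicator α x)) b -
        (flatInner (ψ x • matrixAct (G x)⁻¹ (codiff γ x)) b +
          flatInner (ψ x • ∑ i, matrixAct (connection G i x)
            (contract (coordVec i) (K.indicator α x))) b) =
        (flatInner (contract (dualVec (fderiv ℝ ψ x)) (K.indicator α x)) b -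
          flatInner (ψ x • ∑ i, matrixAct (connection G i x)
            (contract (coordVec i) (K.indicator α x))) b) -
          flatInner (ψ x • matrixAct (G x)⁻¹ (codiff γ x)) b := fun x => by ring
    simp only [this]
    rw [integral_sub J13 J2, key, sub_self]
  · intro x hx
    rw [hψ0 x fun h' => hx (hKD h'), zero_smul, flatInner_zero_left]
  · intro x hx
    have hx' : x ∉ K := fun h' => hx (hKD h')
    rw [hψ0 x hx', zero_smul, hcontr0 x hx', flatInner_zero_left, sub_zero]

theorem integrable_smul_of_memLp_two {Z : Type*} [NormedAddCommGroup Z] [NormedSpace ℝ Z]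
    {K : Set (EuclideanSpace ℝ (Fin n))} (hK : IsCompact K)
    {φ : EuclideanSpace ℝ (Fin n) → ℝ} (hφ : Continuous φ) {z : EuclideanSpace ℝ (Fin n) → Z}
    (hz : MemLp z 2) (hzK : ∀ x ∉ K, z x = 0) : Integrable (fun x => φ x • z x) := by
  have h1 : IntegrableOn z K := (integrable_of_memLp_two hK hz hzK).integrableOn
  exact (h1.continuousOn_smul hφ.continuousOn hK).integrable_of_forall_notMem_eq_zero
    fun x hx => by simp [hzK x hx]

theorem memLp_two_add {Z : Type*} [NormedAddCommGroup Z]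
    {f g : EuclideanSpace ℝ (Fin n) → Z} (hf : MemLp f 2) (hg : MemLp g 2) :
    MemLp (fun x => f x + g x) 2 := hf.add hg

theorem memLp_two_sub {Z : Type*} [NormedAddCommGroup Z]
    {f g : EuclideanSpace ℝ (Fin n) → Z} (hf : MemLp f 2) (hg : MemLp g 2) :
    MemLp (fun x => f x - g x) 2 := hf.sub hg

theorem memLp_two_of_continuous {Z : Type*} [NormedAddCommGroup Z]
    {f : EuclideanSpace ℝ (Fin n) → Z} (hf : Continuous f) (hc : HasCompactSupport f) :
    MemLp f 2 := hf.memLp_of_hasCompactSupport hc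

theorem memLp_two_smul {Z : Type*} [NormedAddCommGroup Z] [NormedSpace ℝ Z]
    {η : EuclideanSpace ℝ (Fin n) → ℝ} (hη : Continuous η) (hc : HasCompactSupport η)
    {w : EuclideanSpace ℝ (Fin n) → Z} (hw : MemLp w 2) : MemLp (fun x => η x • w x) 2 :=
  memLp_bilin (ContinuousLinearMap.lsmul ℝ ℝ) hη hc hw

/-- The Bochner inequality for the product `ηα`, where `α` solves `dα = 0` and `δ(Gα) = δγ` weakly and
the cut-off function `η` is `1` near the support of `γ`. The derivatives of `ηα` are
`d(ηα) = dη ∧ α` and `d*_G(ηα) = η G⁻¹ δγ - grad η ⌟ α`. The two terms of the latter have disjoint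
supports, and the squares of `dη ∧ α` and `grad η ⌟ α` add up to `|dη|² |α|²`, so that no constant is
lost: the term with `G⁻¹ δγ` keeps the factor `1`. -/
theorem IsWeakSolution.setIntegral_curvature_le {D : Set (EuclideanSpace ℝ (Fin n))}
    (hD : IsOpen D)
    {G : EuclideanSpace ℝ (Fin n) → Matrix (Fin r) (Fin r) ℝ} (hG : IsC2Metric D G)
    {γ α : EuclideanSpace ℝ (Fin n) → EForm n r (q + 1)} (hγ : IsTestForm D γ)
    (h : IsWeakSolution D G γ α)
    {η : EuclideanSpace ℝ (Fin n) → ℝ} (hη : ContDiff ℝ ∞ η) (hc : HasCompactSupport η)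
    (hs : tsupport η ⊆ D) (hη1 : ∀ x ∈ tsupport γ, η =ᶠ[𝓝 x] fun _ => 1) :
    IntegrableOn (fun x => fderiv ℝ η x (dualVec (fderiv ℝ η x)) * formInner (G x) (α x) (α x)) D ∧
    IntegrableOn (fun x => η x ^ 2 * formInner (G x) (curvatureOp G x (α x)) (α x)) D ∧
    ∫ x in D, η x ^ 2 * formInner (G x) (curvatureOp G x (α x)) (α x) ≤
      (∫ x in D, flatInner (codiff γ x) (matrixAct (G x)⁻¹ (codiff γ x))) +
        ∫ x in D, fderiv ℝ η x (dualVec (fderiv ℝ η x)) * formInner (G x) (α x) (α x) := by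
  obtain ⟨K, hKη⟩ : ∃ K, K = tsupport η := ⟨_, rfl⟩
  have hK : IsCompact K := hKη ▸ hc
  have hKD : K ⊆ D := hKη ▸ hs
  have hα : MemLp (K.indicator α) 2 := memLp_indicator hK hKD hG h.1 h.2
  obtain ⟨a, ha⟩ : ∃ a, a = K.indicator α := ⟨_, rfl⟩
  rw [← ha] at hα
  have hη0 : ∀ x ∉ K, η x = 0 := fun x hx => image_eq_zero_of_notMem_tsupport (hKη ▸ hx)
  have hdη0 : ∀ x ∉ K, fderiv ℝ η x = 0 := fun x hx => fderiv_eq_zero_of_notMem (hKη ▸ hx)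
  have hcontr0 : ∀ x ∉ K, ∀ b : EForm n r (q + 1), contract (dualVec (fderiv ℝ η x)) b = 0 :=
    fun x hx b => by rw [hdη0 x hx, map_zero, ← contractL_apply, map_zero]; rfl
  have hγK : ∀ x ∉ K, x ∉ tsupport γ := fun x hx hx' => by
    have := (hη1 x hx').self_of_nhds
    simp [hη0 x hx] at this
  -- `δα = P + Q` weakly
  obtain ⟨P, hP⟩ : ∃ P, P = fun x => matrixAct (G x)⁻¹ (codiff γ x) := ⟨_, rfl⟩
  obtain ⟨Q, hQ⟩ : ∃ Q, Q = fun x =>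
    ∑ i, matrixAct (connection G i x) (contract (coordVec i) (a x)) := ⟨_, rfl⟩
  have hPc : ContinuousOn P D := by
    rw [hP]
    exact (contDiffOn_matrixAct (k := 0) (hG.contDiffOn_inv.of_le (by norm_num))
      (contDiffOn_codiff hD hγ.1.contDiffOn (by norm_num))).continuousOn
  have hηP : MemLp (fun x => η x • P x) 2 :=
    memLp_two_of_continuous (continuous_smul_of_tsupport hD hη.continuous hs hPc)
      (hasCompactSupport_smul hc P)
  have hηQ : MemLp (fun x => η x • Q x) 2 := by
    rw [hQ]
    exact memLp_connection hD hG hη hc hs hα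
  have hR := memLp_two_add hηP hηQ
  have hι := memLp_contract_dualVec hη hc hα
  have hμ := memLp_wedgeCovector hη hc hα
  have hψ : ∀ φ : EuclideanSpace ℝ (Fin n) → ℝ, ContDiff ℝ ∞ φ →
      ContDiff ℝ ∞ (fun x => η x * φ x) ∧ tsupport (fun x => η x * φ x) ⊆ K ∧
      ∀ x, fderiv ℝ (fun x => η x * φ x) x = η x • fderiv ℝ φ x + φ x • fderiv ℝ η x :=
    fun φ hφ => ⟨hη.mul hφ, hKη ▸ tsupport_mul_subset_left, fun x =>
      fderiv_fun_mul (hη.differentiable (by simp) x) (hφ.differentiable (by simp) x)⟩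
  have hB := setIntegral_bochnerForm_nonneg_of_weak hD hG hK hKD
    (memLp_two_smul hη.continuous hc hα) hμ (memLp_two_sub hR hι)
    (fun x hx => by rw [hη0 x hx, zero_smul])
    (fun x hx => by rw [hdη0 x hx, wedgeCovector_zero_left])
    (fun x hx => by rw [hη0 x hx, zero_smul, zero_smul, hcontr0 x hx, add_zero, sub_zero])
    (fun φ hφ => by
      obtain ⟨h1, h2, h3⟩ := hψ φ hφ
      have hcψ : HasCompactSupport (fun x => η x * φ x) :=
        hK.of_isClosed_subset (isClosed_tsupport _) h2
      have hA0 := h.integral_wedgeCovector hD hG hK hKD h1 h2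
      rw [← ha] at hA0
      have hA : Integrable (fun x => wedgeCovector (fderiv ℝ (fun x => η x * φ x) x) (a x)) :=
        integrable_of_memLp_two hK (memLp_wedgeCovector h1 hcψ hα) fun x hx => by
          rw [h3, hη0 x hx, hdη0 x hx, zero_smul, smul_zero, add_zero, wedgeCovector_zero_left]
      have hB : Integrable (fun x => φ x • wedgeCovector (fderiv ℝ η x) (a x)) :=
        integrable_smul_of_memLp_two hK hφ.continuous hμ fun x hx => by
          rw [hdη0 x hx, wedgeCovector_zero_left]
      have hpt : ∀ x, wedgeCovector (fderiv ℝ φ x) (η x • a x) =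
          wedgeCovector (fderiv ℝ (fun x => η x * φ x) x) (a x) -
            φ x • wedgeCovector (fderiv ℝ η x) (a x) := fun x => by
        rw [h3, wedgeCovector_add_left, wedgeCovector_smul_left, wedgeCovector_smul_left,
          wedgeCovector_smul, add_sub_cancel_right]
      simp only [hpt]
      rw [integral_sub hA hB, hA0, zero_sub, neg_neg])
    (fun φ hφ => by
      obtain ⟨h1, h2, h3⟩ := hψ φ hφ
      have hcψ : HasCompactSupport (fun x => η x * φ x) :=
        hK.of_isClosed_subset (isClosed_tsupport _) h2
      have hA0 := h.integral_contract hD hG hγ hK hKD h1 h2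
      rw [← ha] at hA0
      have hA : Integrable (fun x =>
          contract (dualVec (fderiv ℝ (fun x => η x * φ x) x)) (a x)) :=
        integrable_of_memLp_two hK (memLp_contract_dualVec h1 hcψ hα) fun x hx => by
          rw [h3, hη0 x hx, hdη0 x hx, zero_smul, smul_zero, add_zero, map_zero,
            ← contractL_apply, map_zero]
          rfl
      have hB : Integrable (fun x => φ x • contract (dualVec (fderiv ℝ η x)) (a x)) :=
        integrable_smul_of_memLp_two hK hφ.continuous hι fun x hx => hcontr0 x hx _
      have hC : Integrable (fun x => φ x • (η x • P x + η x • Q x)) :=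
        integrable_smul_of_memLp_two hK hφ.continuous hR fun x hx => by
          rw [hη0 x hx, zero_smul, zero_smul, add_zero]
      have hpt : ∀ x, contract (dualVec (fderiv ℝ φ x)) (η x • a x) =
          contract (dualVec (fderiv ℝ (fun x => η x * φ x) x)) (a x) -
            φ x • contract (dualVec (fderiv ℝ η x)) (a x) := fun x => by
        rw [h3, map_add, map_smul, map_smul, contract_add_left, contract_smul_left,
          contract_smul_left, contract_smul, add_sub_cancel_right]
      have hpt2 : ∀ x, φ x • (η x • P x + η x • Q x - contract (dualVec (fderiv ℝ η x)) (a x)) =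
          φ x • (η x • P x + η x • Q x) - φ x • contract (dualVec (fderiv ℝ η x)) (a x) :=
        fun x => smul_sub _ _ _
      have hpt3 : ∀ x, φ x • (η x • P x + η x • Q x) =
          (η x * φ x) • matrixAct (G x)⁻¹ (codiff γ x) + (η x * φ x) •
            ∑ i, matrixAct (connection G i x) (contract (coordVec i) (a x)) := fun x => by
        rw [hP, hQ, smul_add, smul_smul, smul_smul, mul_comm]
      simp only [hpt, hpt2]
      rw [integral_sub hC hB, integral_sub hA hB, hA0]
      simp only [hpt3])
  have hmain : ∀ x ∈ D, bochnerForm G x (η x • a x) (wedgeCovector (fderiv ℝ η x) (a x))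
      (η x • P x + η x • Q x - contract (dualVec (fderiv ℝ η x)) (a x)) =
      flatInner (codiff γ x) (matrixAct (G x)⁻¹ (codiff γ x)) +
        fderiv ℝ η x (dualVec (fderiv ℝ η x)) * formInner (G x) (α x) (α x) -
        η x ^ 2 * formInner (G x) (curvatureOp G x (α x)) (α x) := by
    intro x hx
    by_cases hxK : x ∈ K
    -- the connection term of `d*_G` cancels `η Q`
    · have hax : a x = α x := by rw [ha, Set.indicator_of_mem hxK]
      have hQx : η x • Q x = ∑ i, matrixAct (connection G i x)
          (contract (coordVec i) (η x • a x)) := by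
        simp only [hQ, contract_smul, matrixAct_smul, Finset.smul_sum]
      have hν : η x • P x + η x • Q x - contract (dualVec (fderiv ℝ η x)) (a x) -
          ∑ i, matrixAct (connection G i x) (contract (coordVec i) (η x • a x)) =
          η x • P x - contract (dualVec (fderiv ℝ η x)) (a x) := by
        rw [← hQx]
        abel
      rw [bochnerForm, hν, curvatureOp_smul, formInner_smul_smul, hax]
      by_cases hxγ : x ∈ tsupport γ
      · have h1 := (hη1 x hxγ).self_of_nhds
        have h2 : fderiv ℝ η x = 0 := by rw [(hη1 x hxγ).fderiv_eq]; simp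
        have h3 : contract (dualVec (0 : EuclideanSpace ℝ (Fin n) →L[ℝ] ℝ)) (α x) = 0 := by
          rw [map_zero, ← contractL_apply, map_zero]
          rfl
        rw [h2, h1, wedgeCovector_zero_left, h3, one_smul, sub_zero, formInner_eq _ (P x), hP]
        simp only
        rw [← matrixAct_mul, Matrix.mul_nonsing_inv _ (hG.isUnit_det hx), matrixAct_one,
          flatInner_comm, formInner_eq, flatInner_zero_left]
        simp
      · have h1 : P x = 0 := by rw [hP]; simp only; rw [codiff_eq_zero hxγ, matrixAct_zero]
        rw [h1, smul_zero, zero_sub, codiff_eq_zero hxγ, flatInner_zero_left, zero_add,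
          ← formInner_wedge_add_contract]
        simp only [formInner_eq, matrixAct_neg, flatInner_neg_right, flatInner_neg_left, neg_neg]
    · have h0 := bochnerForm_smul G x 0 (0 : EForm n r (q + 1)) 0 0
      rw [hη0 x hxK, hdη0 x hxK, wedgeCovector_zero_left, ← hdη0 x hxK, hcontr0 x hxK,
        codiff_eq_zero (hγK x hxK), flatInner_zero_left, hdη0 x hxK]
      simpa using h0
  have hI1 : IntegrableOn (fun x => fderiv ℝ η x (dualVec (fderiv ℝ η x)) *
      formInner (G x) (α x) (α x)) D := by
    have hcd : Continuous (fderiv ℝ η) := hη.continuous_fderiv (by simp)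
    have hc1 : Continuous (fun x => fderiv ℝ η x (dualVec (fderiv ℝ η x))) :=
      hcd.clm_apply (dualVec.continuous.comp hcd)
    have hI0 := ((h.integrableOn.mono_set hKD).continuousOn_smul hc1.continuousOn hK)
    have hI0' : IntegrableOn (fun x => fderiv ℝ η x (dualVec (fderiv ℝ η x)) *
      formInner (G x) (α x) (α x)) K := hI0
    exact (hI0'.integrable_of_forall_notMem_eq_zero fun x hx => by
      rw [hdη0 x hx]; simp).integrableOn
  have hI2 : IntegrableOn (fun x => flatInner (codiff γ x) (matrixAct (G x)⁻¹ (codiff γ x))) D := by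
    refine integrableOn_of_continuousOn hK hKD (continuousOn_bilin flatInnerL
      (contDiffOn_codiff (m := 0) hD hγ.1.contDiffOn (by norm_num)).continuousOn (hP ▸ hPc)) ?_
    intro x hx
    rw [codiff_eq_zero (hγK x hx)]
    exact flatInner_zero_left _
  have hI12 : IntegrableOn (fun x => flatInner (codiff γ x) (matrixAct (G x)⁻¹ (codiff γ x)) +
      fderiv ℝ η x (dualVec (fderiv ℝ η x)) * formInner (G x) (α x) (α x)) D := hI2.add hI1
  have hI3 : IntegrableOn (fun x => η x ^ 2 *
      formInner (G x) (curvatureOp G x (α x)) (α x)) D := by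
    refine (hI12.sub hB.1).congr_fun (fun x hx => ?_) hD.measurableSet
    simp only [Pi.sub_apply]
    rw [hmain x hx]
    ring
  refine ⟨hI1, hI3, ?_⟩
  have := hB.2
  rw [setIntegral_congr_fun hD.measurableSet hmain, integral_sub hI12 hI3,
    integral_add hI2 hI1] at this
  linarith

end CutoffInequality

/-! ### Hilbert spaces of square integrable forms -/

section SquareRoot

open scoped Matrix.Norms.L2Operator MatrixOrder

/-- A continuous family of positive definite matrices has a continuous family of symmetric square
roots. -/
theorem exists_sqrt {r : ℕ} {X : Type*} [TopologicalSpace X] {D : Set X}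
    {G : X → Matrix (Fin r) (Fin r) ℝ}
    (hG : ContinuousOn G D) (hpos : ∀ x ∈ D, (G x).PosDef) :
    ∃ S : X → Matrix (Fin r) (Fin r) ℝ, ContinuousOn S D ∧
      ∀ x ∈ D, (S x).transpose = S x ∧ S x * S x = G x := by
  refine ⟨fun x => CFC.sqrt (G x), ?_, fun x hx => ⟨?_, ?_⟩⟩
  · refine CFC.continuousOn_sqrt.comp hG fun x hx => ?_
    exact (hpos x hx).posSemidef.nonneg
  · have := (Matrix.nonneg_iff_posSemidef.1 (CFC.sqrt_nonneg (G x))).isHermitian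
    rwa [Matrix.IsHermitian, Matrix.conjTranspose_eq_transpose_of_trivial] at this
  · exact CFC.sqrt_mul_sqrt_self _ (hpos x hx).posSemidef.nonneg

end SquareRoot

/-- A finite-dimensional space with a positive definite bilinear form is isometric to a Euclidean
space. -/
theorem exists_linearEquiv_inner {V : Type*} [AddCommGroup V] [Module ℝ V] [FiniteDimensional ℝ V]
    (B : V →ₗ[ℝ] V →ₗ[ℝ] ℝ) (hs : ∀ a b, B a b = B b a) (hn : ∀ a, 0 ≤ B a a)
    (h0 : ∀ a, B a a = 0 → a = 0) :
    ∃ (N : ℕ) (e : V ≃ₗ[ℝ] EuclideanSpace ℝ (Fin N)), ∀ a b, inner ℝ (e a) (e b) = B a b := by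
  let core : InnerProductSpace.Core ℝ V :=
    { inner := fun a b => B a b
      conj_inner_symm := fun a b => by simpa using hs b a
      re_inner_nonneg := fun a => by simpa using hn a
      add_left := fun a b c => by simp
      smul_left := fun a b c => by simp
      definite := h0 }
  let := core.toNormedAddCommGroup
  let : InnerProductSpace ℝ V := InnerProductSpace.ofCore core.toCore
  exact ⟨_, (stdOrthonormalBasis ℝ V).repr.toLinearEquiv,
    fun a b => (stdOrthonormalBasis ℝ V).repr.inner_map_map a b⟩

/-- The orthogonal projection `v` of `w` to the orthogonal complement of a set `T` of functions in
`L²`, expressed by integrals: `v` is not longer than `w`, orthogonal to `T`, and has the same inner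
products as `w` with all `s` orthogonal to `T`. -/
theorem exists_projection {X F : Type*} [MeasurableSpace X] [NormedAddCommGroup F]
    [InnerProductSpace ℝ F] [CompleteSpace F] {μ : Measure X} (T : Set (X → F))
    (hT : ∀ t ∈ T, MemLp t 2 μ) {w : X → F} (hw : MemLp w 2 μ) :
    ∃ v : X → F, MemLp v 2 μ ∧ ∫ x, inner ℝ (v x) (v x) ∂μ ≤ ∫ x, inner ℝ (w x) (w x) ∂μ ∧
      (∀ t ∈ T, ∫ x, inner ℝ (v x) (t x) ∂μ = 0) ∧
      ∀ s : X → F, MemLp s 2 μ → (∀ t ∈ T, ∫ x, inner ℝ (s x) (t x) ∂μ = 0) →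
        ∫ x, inner ℝ (v x) (s x) ∂μ = ∫ x, inner ℝ (w x) (s x) ∂μ := by
  have hin : ∀ {a b : X → F} (ha : MemLp a 2 μ) (hb : MemLp b 2 μ),
      inner ℝ (ha.toLp a) (hb.toLp b) = ∫ x, inner ℝ (a x) (b x) ∂μ := by
    intro a b ha hb
    rw [L2.inner_def]
    refine integral_congr_ae ?_
    filter_upwards [ha.coeFn_toLp, hb.coeFn_toLp] with x h1 h2
    rw [h1, h2]
  let K : Submodule ℝ (Lp F 2 μ) := (Submodule.span ℝ {t | ∃ a, ∃ h : a ∈ T, t = (hT a h).toLp a})ᗮ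
  have hmemK : ∀ u : Lp F 2 μ, u ∈ K ↔ ∀ a, ∀ h : a ∈ T, inner ℝ u ((hT a h).toLp a) = 0 := by
    intro u
    constructor
    · intro hu a h
      rw [real_inner_comm]
      exact hu _ (Submodule.subset_span ⟨a, h, rfl⟩)
    · intro hu
      refine (Submodule.mem_orthogonal _ _).2 fun z hz => ?_
      induction hz using Submodule.span_induction with
      | mem z hz => obtain ⟨a, h, rfl⟩ := hz; rw [real_inner_comm]; exact hu a h
      | zero => exact inner_zero_left _
      | add a b _ _ h1 h2 => rw [inner_add_left, h1, h2, add_zero]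
      | smul c a _ h1 => rw [inner_smul_left, h1, mul_zero]
  obtain ⟨p, hp⟩ : ∃ p, p = K.starProjection (hw.toLp w) := ⟨_, rfl⟩
  have hpK : p ∈ K := hp ▸ Submodule.starProjection_apply_mem _ _
  have hpm : MemLp p 2 μ := Lp.memLp p
  have hpp : hpm.toLp p = p := Lp.toLp_coeFn p hpm
  refine ⟨p, hpm, ?_, fun t ht => ?_, fun s hs hsT => ?_⟩
  · rw [← hin hpm hpm, ← hin hw hw, hpp, real_inner_self_eq_norm_sq, real_inner_self_eq_norm_sq, hp]
    gcongr
    exact Submodule.norm_starProjection_apply_le _ _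
  · rw [← hin hpm (hT t ht), hpp]
    exact (hmemK p).1 hpK t ht
  · have hsK : hs.toLp s ∈ K := (hmemK _).2 fun a h => by rw [hin hs (hT a h), hsT a h]
    rw [← hin hpm hs, ← hin hw hs, hpp, hp, Submodule.inner_starProjection_left_eq_right,
      Submodule.starProjection_eq_self_iff.2 hsK]

/-- If `|l t| ≤ √C ‖A t‖` then `l` factors through a bounded functional on the range of `A`. It
extends to all of `H` with the same norm and is represented by a vector. -/
theorem exists_inner_eq {T H : Type*} [AddCommGroup T] [Module ℝ T] [NormedAddCommGroup H]
    [InnerProductSpace ℝ H] [CompleteSpace H] (A : T →ₗ[ℝ] H) (l : T →ₗ[ℝ] ℝ) {C : ℝ} (hC : 0 ≤ C)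
    (h : ∀ t, l t ^ 2 ≤ C * ‖A t‖ ^ 2) :
    ∃ w : H, ‖w‖ ^ 2 ≤ C ∧ ∀ t, inner ℝ w (A t) = l t := by
  have habs : ∀ t, |l t| ≤ √C * ‖A t‖ := fun t => by
    rw [← Real.sqrt_sq_eq_abs, ← Real.sqrt_sq (norm_nonneg (A t)), ← Real.sqrt_mul hC]
    exact Real.sqrt_le_sqrt (h t)
  have hker : LinearMap.ker A ≤ LinearMap.ker l := fun t ht => by
    have := habs t
    rw [LinearMap.mem_ker.1 ht, norm_zero, mul_zero] at this
    exact abs_nonpos_iff.1 this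
  let φ : LinearMap.range A →ₗ[ℝ] ℝ := (Submodule.liftQ _ l hker).comp
    A.quotKerEquivRange.symm.toLinearMap
  have hφ : ∀ t, φ ⟨A t, t, rfl⟩ = l t := by
    intro t
    have : A.quotKerEquivRange.symm ⟨A t, t, rfl⟩ = Submodule.Quotient.mk t := by
      rw [LinearEquiv.symm_apply_eq]; rfl
    simp only [φ, LinearMap.comp_apply, LinearEquiv.coe_coe, this]
    exact Submodule.liftQ_apply _ _ _
  have hφb : ∀ z, ‖φ z‖ ≤ √C * ‖z‖ := by
    rintro ⟨_, t, rfl⟩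
    rw [hφ]
    exact habs t
  obtain ⟨ψ, hψ, hψn⟩ := exists_extension_norm_eq _ (φ.mkContinuous _ hφb)
  refine ⟨(InnerProductSpace.toDual ℝ H).symm ψ, ?_, fun t => ?_⟩
  · rw [LinearIsometryEquiv.norm_map, hψn]
    refine le_of_le_of_eq ?_ (Real.sq_sqrt hC)
    gcongr
    exact LinearMap.mkContinuous_norm_le _ (Real.sqrt_nonneg _) _
  · rw [InnerProductSpace.toDual_symm_apply, ← hφ t]
    exact hψ ⟨A t, t, rfl⟩

section WeightedL2

open Filter Topology

variable {n r q : ℕ}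

attribute [local instance] Matrix.normedAddCommGroup Matrix.normedSpace

/-- Measurable forms on `D` which are square integrable for the metric `G`. -/
def SqIntegrable (D : Set (EuclideanSpace ℝ (Fin n)))
    (G : EuclideanSpace ℝ (Fin n) → Matrix (Fin r) (Fin r) ℝ)
    (α : EuclideanSpace ℝ (Fin n) → EForm n r q) : Prop :=
  AEStronglyMeasurable α (volume.restrict D) ∧
    IntegrableOn (fun x => formInner (G x) (α x) (α x)) D

theorem aestronglyMeasurable_clm_apply {V W : Type*} [NormedAddCommGroup V] [NormedSpace ℝ V]
    [NormedAddCommGroup W] [NormedSpace ℝ W] {μ : Measure (EuclideanSpace ℝ (Fin n))}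
    {J : EuclideanSpace ℝ (Fin n) → V →L[ℝ] W} {v : EuclideanSpace ℝ (Fin n) → V}
    (hJ : AEStronglyMeasurable J μ) (hv : AEStronglyMeasurable v μ) :
    AEStronglyMeasurable (fun x => J x (v x)) μ :=
  (ContinuousLinearMap.id ℝ (V →L[ℝ] W)).aestronglyMeasurable_comp₂ hJ hv

/-- The fibre metric is isometric to a Euclidean space, continuously in the base point. Forms which
are square integrable for `G` thereby become elements of an `L²` space with values in a fixed
Hilbert space. The isometry is the action of `√G`, followed by orthonormal coordinates for the flat
pairing. -/
theorem exists_isometry {D : Set (EuclideanSpace ℝ (Fin n))}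
    {G : EuclideanSpace ℝ (Fin n) → Matrix (Fin r) (Fin r) ℝ}
    (hG : ContinuousOn G D) (hpos : ∀ x ∈ D, (G x).PosDef) :
    ∃ (N : ℕ) (J : EuclideanSpace ℝ (Fin n) → EForm n r q →L[ℝ] EuclideanSpace ℝ (Fin N))
      (J' : EuclideanSpace ℝ (Fin n) → EuclideanSpace ℝ (Fin N) →L[ℝ] EForm n r q),
      ContinuousOn J D ∧ ContinuousOn J' D ∧ ∀ x ∈ D,
        (∀ a b, inner ℝ (J x a) (J x b) = formInner (G x) a b) ∧ (∀ v, J x (J' x v) = v) ∧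
          ∀ a, J' x (J x a) = a := by
  obtain ⟨S, hS, hSD⟩ := exists_sqrt hG hpos
  obtain ⟨N, e, he⟩ := exists_linearEquiv_inner
    ((ContinuousLinearMap.coeLM ℝ).comp (flatInnerL (n := n) (r := r) (q := q)).toLinearMap)
    (fun a b => flatInner_comm a b) (fun a => flatInner_self_nonneg a)
    (fun a h => eq_zero_of_flatInner_self a h)
  have hdet : ∀ x ∈ D, IsUnit (S x).det := fun x hx => by
    have h1 : (S x).det * (S x).det = (G x).det := by rw [← Matrix.det_mul, (hSD x hx).2]
    have h2 := (hpos x hx).det_pos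
    rw [← h1] at h2
    exact (left_ne_zero_of_mul h2.ne').isUnit
  have hSi : ContinuousOn (fun x => (S x)⁻¹) D :=
    (contDiffOn_matrix_inv (contDiffOn_zero.2 hS) fun x hx => (hdet x hx).ne_zero).continuousOn
  let E := e.toContinuousLinearEquiv
  refine ⟨N, fun x => E.toContinuousLinearMap ∘L matrixActL (S x),
    fun x => matrixActL (S x)⁻¹ ∘L E.symm.toContinuousLinearMap, ?_, ?_, fun x hx => ⟨?_, ?_, ?_⟩⟩
  · exact continuousOn_const.clm_comp (matrixActL.continuous.comp_continuousOn hS)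
  · exact (matrixActL.continuous.comp_continuousOn hSi).clm_comp continuousOn_const
  · intro a b
    have h1 : inner ℝ (e (matrixAct (S x) a)) (e (matrixAct (S x) b)) =
        flatInner (matrixAct (S x) a) (matrixAct (S x) b) := he _ _
    refine h1.trans ?_
    rw [flatInner_matrixAct, (hSD x hx).1, ← matrixAct_mul, (hSD x hx).2, formInner_eq]
  · intro v
    have h1 : matrixAct (S x) (matrixAct (S x)⁻¹ (E.symm v)) = E.symm v := by
      rw [← matrixAct_mul, Matrix.mul_nonsing_inv _ (hdet x hx), matrixAct_one]
    exact (congrArg E h1).trans (E.apply_symm_apply v)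
  · intro a
    have h1 : E.symm (E (matrixAct (S x) a)) = matrixAct (S x) a := E.symm_apply_apply _
    refine (congrArg (matrixAct (S x)⁻¹) h1).trans ?_
    rw [← matrixAct_mul, Matrix.nonsing_inv_mul _ (hdet x hx), matrixAct_one]

theorem sqIntegrable_iff {D : Set (EuclideanSpace ℝ (Fin n))} (hD : IsOpen D)
    {G : EuclideanSpace ℝ (Fin n) → Matrix (Fin r) (Fin r) ℝ} {N : ℕ}
    {J : EuclideanSpace ℝ (Fin n) → EForm n r q →L[ℝ] EuclideanSpace ℝ (Fin N)}
    (hJ : ContinuousOn J D)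
    (hJD : ∀ x ∈ D, ∀ a b, inner ℝ (J x a) (J x b) = formInner (G x) a b)
    {α : EuclideanSpace ℝ (Fin n) → EForm n r q}
    (hα : AEStronglyMeasurable α (volume.restrict D)) :
    SqIntegrable D G α ↔ MemLp (fun x => J x (α x)) 2 (volume.restrict D) := by
  have h1 : AEStronglyMeasurable (fun x => J x (α x)) (volume.restrict D) :=
    aestronglyMeasurable_clm_apply (hJ.aestronglyMeasurable hD.measurableSet) hα
  rw [memLp_two_iff_integrable_sq_norm h1, SqIntegrable, and_iff_right hα]
  refine integrableOn_congr_fun (fun x hx => ?_) hD.measurableSet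
  exact (hJD x hx _ _).symm.trans (real_inner_self_eq_norm_sq _)

/-- Orthogonal projection to the orthogonal complement of `T`, in the space of forms which are square
integrable for `G`. -/
theorem exists_weighted_projection {D : Set (EuclideanSpace ℝ (Fin n))} (hD : IsOpen D)
    {G : EuclideanSpace ℝ (Fin n) → Matrix (Fin r) (Fin r) ℝ}
    (hG : ContinuousOn G D) (hpos : ∀ x ∈ D, (G x).PosDef)
    (T : Set (EuclideanSpace ℝ (Fin n) → EForm n r q)) (hT : ∀ t ∈ T, SqIntegrable D G t)
    {w : EuclideanSpace ℝ (Fin n) → EForm n r q} (hw : SqIntegrable D G w) :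
    ∃ v : EuclideanSpace ℝ (Fin n) → EForm n r q, SqIntegrable D G v ∧
      ∫ x in D, formInner (G x) (v x) (v x) ≤ ∫ x in D, formInner (G x) (w x) (w x) ∧
      (∀ t ∈ T, ∫ x in D, formInner (G x) (v x) (t x) = 0) ∧
      ∀ s, SqIntegrable D G s → (∀ t ∈ T, ∫ x in D, formInner (G x) (s x) (t x) = 0) →
        ∫ x in D, formInner (G x) (v x) (s x) = ∫ x in D, formInner (G x) (w x) (s x) := by
  obtain ⟨N, J, J', hJ, hJ', hJD⟩ := exists_isometry (q := q) hG hpos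
  have hiff := fun {α : EuclideanSpace ℝ (Fin n) → EForm n r q}
    (hα : AEStronglyMeasurable α (volume.restrict D)) =>
    sqIntegrable_iff hD hJ (fun x hx => (hJD x hx).1) hα
  have hint : ∀ a b : EuclideanSpace ℝ (Fin n) → EForm n r q,
      ∫ x in D, inner ℝ (J x (a x)) (J x (b x)) = ∫ x in D, formInner (G x) (a x) (b x) :=
    fun a b => setIntegral_congr_fun hD.measurableSet fun x hx => (hJD x hx).1 _ _
  obtain ⟨v, hv, hvw, hvT, hvs⟩ := exists_projection (μ := volume.restrict D)
    ((fun (t : EuclideanSpace ℝ (Fin n) → EForm n r q) x => J x (t x)) '' T)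
    (by rintro _ ⟨t, ht, rfl⟩; exact (hiff (hT t ht).1).1 (hT t ht)) ((hiff hw.1).1 hw)
  have hm : AEStronglyMeasurable (fun x => J' x (v x)) (volume.restrict D) :=
    aestronglyMeasurable_clm_apply (hJ'.aestronglyMeasurable hD.measurableSet) hv.1
  have hJv : ∀ x ∈ D, J x (J' x (v x)) = v x := fun x hx => (hJD x hx).2.1 _
  have hint' : ∀ b : EuclideanSpace ℝ (Fin n) → EuclideanSpace ℝ (Fin N),
      ∫ x in D, inner ℝ (J x (J' x (v x))) (b x) = ∫ x in D, inner ℝ (v x) (b x) :=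
    fun b => setIntegral_congr_fun hD.measurableSet fun x hx => by simp only [hJv x hx]
  refine ⟨fun x => J' x (v x), (hiff hm).2 ?_, ?_, fun t ht => ?_, fun s hs hsT => ?_⟩
  · refine (memLp_congr_ae ?_).2 hv
    filter_upwards [ae_restrict_mem hD.measurableSet] with x hx using hJv x hx
  · rw [← hint, ← hint, hint']
    refine le_of_eq_of_le (setIntegral_congr_fun hD.measurableSet fun x hx => ?_) hvw
    simp only [hJv x hx]
  · rw [← hint, hint']
    exact hvT _ ⟨t, ht, rfl⟩
  · rw [← hint, ← hint, hint']
    refine hvs _ ((hiff hs.1).1 hs) ?_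
    rintro _ ⟨t, ht, rfl⟩
    rw [hint, hsT t ht]

/-- Riesz representation in the space of forms which are square integrable for `G`. -/
theorem exists_weighted_riesz {D : Set (EuclideanSpace ℝ (Fin n))} (hD : IsOpen D)
    {G : EuclideanSpace ℝ (Fin n) → Matrix (Fin r) (Fin r) ℝ}
    (hG : ContinuousOn G D) (hpos : ∀ x ∈ D, (G x).PosDef)
    {T : Type*} [AddCommGroup T] [Module ℝ T]
    (A : T →ₗ[ℝ] EuclideanSpace ℝ (Fin n) → EForm n r q) (hA : ∀ t, SqIntegrable D G (A t))
    (l : T →ₗ[ℝ] ℝ) {C : ℝ} (hC : 0 ≤ C)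
    (h : ∀ t, l t ^ 2 ≤ C * ∫ x in D, formInner (G x) (A t x) (A t x)) :
    ∃ u : EuclideanSpace ℝ (Fin n) → EForm n r q, SqIntegrable D G u ∧
      ∫ x in D, formInner (G x) (u x) (u x) ≤ C ∧
      ∀ t, ∫ x in D, formInner (G x) (u x) (A t x) = l t := by
  obtain ⟨N, J, J', hJ, hJ', hJD⟩ := exists_isometry (q := q) hG hpos
  have hiff := fun {α : EuclideanSpace ℝ (Fin n) → EForm n r q}
    (hα : AEStronglyMeasurable α (volume.restrict D)) =>
    sqIntegrable_iff hD hJ (fun x hx => (hJD x hx).1) hα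
  have hint : ∀ a b : EuclideanSpace ℝ (Fin n) → EForm n r q,
      ∫ x in D, inner ℝ (J x (a x)) (J x (b x)) = ∫ x in D, formInner (G x) (a x) (b x) :=
    fun a b => setIntegral_congr_fun hD.measurableSet fun x hx => (hJD x hx).1 _ _
  have hM : ∀ t, MemLp (fun x => J x (A t x)) 2 (volume.restrict D) :=
    fun t => (hiff (hA t).1).1 (hA t)
  let B : T →ₗ[ℝ] Lp (EuclideanSpace ℝ (Fin N)) 2 (volume.restrict D) :=
    { toFun := fun t => (hM t).toLp _
      map_add' := fun s t => by
        rw [← MemLp.toLp_add]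
        exact MemLp.toLp_congr _ _ (ae_of_all _ fun x => by simp)
      map_smul' := fun c t => by
        rw [RingHom.id_apply, ← MemLp.toLp_const_smul]
        exact MemLp.toLp_congr _ _ (ae_of_all _ fun x => by simp) }
  have hBt : ∀ t, (B t : EuclideanSpace ℝ (Fin n) → EuclideanSpace ℝ (Fin N)) =ᵐ[volume.restrict D]
      fun x => J x (A t x) := fun t => (hM t).coeFn_toLp
  have hBn : ∀ t, ‖B t‖ ^ 2 = ∫ x in D, formInner (G x) (A t x) (A t x) := by
    intro t
    rw [← real_inner_self_eq_norm_sq, L2.inner_def, ← hint]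
    refine integral_congr_ae ?_
    filter_upwards [hBt t] with x hx
    rw [hx]
  obtain ⟨w, hw, hwl⟩ := exists_inner_eq B l hC fun t => by rw [hBn]; exact h t
  have hwm : MemLp w 2 (volume.restrict D) := Lp.memLp w
  have hm : AEStronglyMeasurable (fun x => J' x (w x)) (volume.restrict D) :=
    aestronglyMeasurable_clm_apply (hJ'.aestronglyMeasurable hD.measurableSet) hwm.1
  have hJw : ∀ x ∈ D, J x (J' x (w x)) = w x := fun x hx => (hJD x hx).2.1 _
  refine ⟨fun x => J' x (w x), (hiff hm).2 ?_, ?_, fun t => ?_⟩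
  · refine (memLp_congr_ae ?_).2 hwm
    filter_upwards [ae_restrict_mem hD.measurableSet] with x hx using hJw x hx
  · rw [← hint]
    refine le_of_eq_of_le (Eq.trans ?_ (L2.inner_def w w).symm)
      ((real_inner_self_eq_norm_sq w).trans_le hw)
    exact setIntegral_congr_fun hD.measurableSet fun x hx => by simp only [hJw x hx]
  · rw [← hint, ← hwl t, L2.inner_def]
    refine integral_congr_ae ?_
    filter_upwards [hBt t, ae_restrict_mem hD.measurableSet] with x hx hxD
    rw [hx, hJw x hxD]

end WeightedL2

/-! ### Existence of weak solutions by orthogonal projection -/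

section WeakSolutions

open Filter Topology

variable {n r q : ℕ}

attribute [local instance] Matrix.normedAddCommGroup Matrix.normedSpace

theorem formInner_inv_right {G : Matrix (Fin r) (Fin r) ℝ} (hG : IsUnit G.det)
    (α β : EForm n r q) : formInner G α (matrixAct G⁻¹ β) = flatInner α β := by
  rw [formInner_eq, ← matrixAct_mul, Matrix.mul_nonsing_inv _ hG, matrixAct_one]

theorem formInner_comm {G : Matrix (Fin r) (Fin r) ℝ} (hG : G.transpose = G)
    (α β : EForm n r q) : formInner G α β = formInner G β α := by
  rw [formInner_eq, flatInner_comm, flatInner_matrixAct, hG, ← formInner_eq]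

theorem sqIntegrable_of_continuousOn {D K : Set (EuclideanSpace ℝ (Fin n))} (hD : IsOpen D)
    {G : EuclideanSpace ℝ (Fin n) → Matrix (Fin r) (Fin r) ℝ} (hG : ContinuousOn G D)
    (hK : IsCompact K) (hKD : K ⊆ D) {α : EuclideanSpace ℝ (Fin n) → EForm n r q}
    (hα : ContinuousOn α D) (hαK : ∀ x ∉ K, α x = 0) : SqIntegrable D G α := by
  refine ⟨hα.aestronglyMeasurable hD.measurableSet, integrableOn_of_continuousOn hK hKD
    (continuousOn_formInner hG continuousOn_id (Set.mapsTo_id D) hα hα) fun x hx => ?_⟩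
  rw [hαK x hx, formInner_eq, flatInner_zero_left]

theorem extDeriv_eq_zero {ζ : EuclideanSpace ℝ (Fin n) → EForm n r q}
    {x : EuclideanSpace ℝ (Fin n)} (hx : x ∉ tsupport ζ) : extDeriv ζ x = 0 := by
  rw [extDeriv_eq_sum]
  exact Finset.sum_eq_zero fun i _ => by rw [partialDeriv_eq_zero hx, wedgeCovector_zero]

theorem sqIntegrable_inv_codiff {D : Set (EuclideanSpace ℝ (Fin n))} (hD : IsOpen D)
    {G : EuclideanSpace ℝ (Fin n) → Matrix (Fin r) (Fin r) ℝ} (hG : IsC2Metric D G)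
    {γ : EuclideanSpace ℝ (Fin n) → EForm n r (q + 1)} (hγ : IsTestForm D γ) :
    SqIntegrable D G (fun x => matrixAct (G x)⁻¹ (codiff γ x)) := by
  refine sqIntegrable_of_continuousOn hD hG.contDiffOn.continuousOn hγ.2.1 hγ.2.2
    (contDiffOn_matrixAct (k := 0) (hG.contDiffOn_inv.of_le (by norm_num))
      (contDiffOn_codiff hD hγ.1.contDiffOn (by norm_num))).continuousOn fun x hx => ?_
  rw [codiff_eq_zero hx, matrixAct_zero]

theorem setIntegral_flatInner_codiff_eq_zero {D : Set (EuclideanSpace ℝ (Fin n))} (hD : IsOpen D)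
    {f : EuclideanSpace ℝ (Fin n) → EForm n r q} (hf : ContDiffOn ℝ 1 f D)
    (hclosed : ∀ x ∈ D, extDeriv f x = 0)
    {γ : EuclideanSpace ℝ (Fin n) → EForm n r (q + 1)} (hγ : IsTestForm D γ) :
    ∫ x in D, flatInner (f x) (codiff γ x) = 0 := by
  rw [← setIntegral_extDeriv_codiff hD hf (hγ.1.contDiffOn.of_le (by norm_num)) hγ.2.1 hγ.2.2
    (Or.inr subset_rfl), setIntegral_congr_fun hD.measurableSet
    (g := fun _ => (0 : ℝ)) fun x hx => ?_, integral_zero]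
  simp only [hclosed x hx, flatInner_zero_left]

/-- The form `α` is the orthogonal projection of `G⁻¹ γ` to the weakly closed forms, which are the
orthogonal complement of the forms `G⁻¹ δγ'`. As `f` and all `dζ` are closed, `α` and `G⁻¹ γ` have the
same inner products with them; this gives `⟨⟨α, f⟩⟩_G = ∫ ⟨γ, f⟩` and `δ(Gα) = δγ`. -/
theorem exists_isWeakSolution {D : Set (EuclideanSpace ℝ (Fin n))} (hD : IsOpen D)
    {G : EuclideanSpace ℝ (Fin n) → Matrix (Fin r) (Fin r) ℝ} (hG : IsC2Metric D G)
    {f : EuclideanSpace ℝ (Fin n) → EForm n r (q + 1)} (hf : ContDiffOn ℝ 1 f D)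
    (hclosed : ∀ x ∈ D, extDeriv f x = 0) (hfi : SqIntegrable D G f)
    {γ : EuclideanSpace ℝ (Fin n) → EForm n r (q + 1)} (hγ : IsTestForm D γ) :
    ∃ α, IsWeakSolution D G γ α ∧
      ∫ x in D, formInner (G x) (α x) (α x) ≤ ∫ x in D, flatInner (matrixAct (G x)⁻¹ (γ x)) (γ x) ∧
      ∫ x in D, formInner (G x) (α x) (f x) = ∫ x in D, flatInner (γ x) (f x) := by
  have hcont := hG.contDiffOn.continuousOn
  have hinv : ∀ x ∈ D, ∀ a b : EForm n r (q + 1),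
      formInner (G x) a (matrixAct (G x)⁻¹ b) = flatInner a b :=
    fun x hx a b => formInner_inv_right (hG.isUnit_det hx) a b
  have hw : SqIntegrable D G (fun x => matrixAct (G x)⁻¹ (γ x)) := by
    refine sqIntegrable_of_continuousOn hD hcont hγ.2.1 hγ.2.2
      (contDiffOn_matrixAct (k := 2) hG.contDiffOn_inv hγ.1.contDiffOn).continuousOn fun x hx => ?_
    rw [image_eq_zero_of_notMem_tsupport hx, matrixAct_zero]
  obtain ⟨α, hα, hαw, hαT, hαs⟩ := exists_weighted_projection hD hcont hG.1
    {t | ∃ γ' : EuclideanSpace ℝ (Fin n) → EForm n r (q + 2), IsTestForm D γ' ∧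
      t = fun x => matrixAct (G x)⁻¹ (codiff γ' x)}
    (by rintro _ ⟨γ', hγ', rfl⟩; exact sqIntegrable_inv_codiff hD hG hγ') hw
  have hint : ∀ a b : EuclideanSpace ℝ (Fin n) → EForm n r (q + 1),
      ∫ x in D, formInner (G x) (a x) (matrixAct (G x)⁻¹ (b x)) =
        ∫ x in D, flatInner (a x) (b x) :=
    fun a b => setIntegral_congr_fun hD.measurableSet fun x hx => hinv x hx _ _
  have hint' : ∀ a b : EuclideanSpace ℝ (Fin n) → EForm n r (q + 1),
      ∫ x in D, formInner (G x) (matrixAct (G x)⁻¹ (a x)) (b x) =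
        ∫ x in D, flatInner (a x) (b x) :=
    fun a b => setIntegral_congr_fun hD.measurableSet fun x hx => by
      rw [formInner_comm (hG.transpose_eq hx), hinv x hx, flatInner_comm]
  refine ⟨α, ⟨hα.1, hα.2, fun γ' hγ' => ?_, fun ζ hζ => ?_⟩, ?_, ?_⟩
  · rw [← hint]
    exact hαT _ ⟨γ', hγ', rfl⟩
  · have hdζ : ContDiffOn ℝ 1 (extDeriv ζ) D :=
      contDiffOn_extDeriv hD hζ.1.contDiffOn (by norm_num)
    have h1 := hαs (extDeriv ζ) (sqIntegrable_of_continuousOn hD hcont hζ.2.1 hζ.2.2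
      hdζ.continuousOn fun x hx => extDeriv_eq_zero hx) (by
        rintro _ ⟨γ', hγ', rfl⟩
        rw [hint]
        refine setIntegral_flatInner_codiff_eq_zero hD hdζ (fun x _ => ?_) hγ'
        exact extDeriv_extDeriv_apply (r := 2) hζ.1.contDiffAt (by simp))
    rw [hint'] at h1
    have h2 := setIntegral_extDeriv_codiff hD (hζ.1.contDiffOn.of_le (by norm_num))
      (hγ.1.contDiffOn.of_le (by norm_num)) hγ.2.1 hγ.2.2 (Or.inr subset_rfl)
    calc ∫ x in D, flatInner (matrixAct (G x) (α x)) (extDeriv ζ x)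
        = ∫ x in D, formInner (G x) (α x) (extDeriv ζ x) :=
          setIntegral_congr_fun hD.measurableSet fun x hx => by
            rw [flatInner_matrixAct, hG.transpose_eq hx, formInner_eq]
      _ = ∫ x in D, flatInner (extDeriv ζ x) (γ x) := by
          rw [h1]; simp only [flatInner_comm]
      _ = ∫ x in D, flatInner (codiff γ x) (ζ x) := by
          rw [h2]; simp only [flatInner_comm]
  · rwa [hint] at hαw
  · rw [← hint' γ f]
    refine hαs f hfi ?_
    rintro _ ⟨γ', hγ', rfl⟩
    rw [hint]
    exact setIntegral_flatInner_codiff_eq_zero hD hf hclosed hγ'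

end WeakSolutions

/-! ### Curvature: symmetry, and the effect of a weight -/

section Weights

open Filter Topology

variable {n r q : ℕ}

attribute [local instance] Matrix.normedAddCommGroup Matrix.normedSpace

theorem partialDeriv_add {X : Type*} [NormedAddCommGroup X] [NormedSpace ℝ X]
    {F H : EuclideanSpace ℝ (Fin n) → X} {x : EuclideanSpace ℝ (Fin n)}
    (hF : DifferentiableAt ℝ F x) (hH : DifferentiableAt ℝ H x) (i : Fin n) :
    partialDeriv i (fun y => F y + H y) x = partialDeriv i F x + partialDeriv i H x := by
  simp [partialDeriv, fderiv_fun_add hF hH]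

theorem partialDeriv_sub {X : Type*} [NormedAddCommGroup X] [NormedSpace ℝ X]
    {F H : EuclideanSpace ℝ (Fin n) → X} {x : EuclideanSpace ℝ (Fin n)}
    (hF : DifferentiableAt ℝ F x) (hH : DifferentiableAt ℝ H x) (i : Fin n) :
    partialDeriv i (fun y => F y - H y) x = partialDeriv i F x - partialDeriv i H x := by
  simp [partialDeriv, fderiv_fun_sub hF hH]

theorem partialDeriv_smul {X : Type*} [NormedAddCommGroup X] [NormedSpace ℝ X]
    {ψ : EuclideanSpace ℝ (Fin n) → ℝ} {F : EuclideanSpace ℝ (Fin n) → X}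
    {x : EuclideanSpace ℝ (Fin n)}
    (hψ : DifferentiableAt ℝ ψ x) (hF : DifferentiableAt ℝ F x) (i : Fin n) :
    partialDeriv i (fun y => ψ y • F y) x = ψ x • partialDeriv i F x + partialDeriv i ψ x • F x := by
  simp [partialDeriv, fderiv_fun_smul hψ hF]

theorem partialDeriv_exp {h : EuclideanSpace ℝ (Fin n) → ℝ} {x : EuclideanSpace ℝ (Fin n)}
    (hh : DifferentiableAt ℝ h x) (i : Fin n) :
    partialDeriv i (fun y => Real.exp (h y)) x = Real.exp (h x) * partialDeriv i h x := by
  simp [partialDeriv, fderiv_exp hh]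

theorem contDiff_partialDeriv {F : EuclideanSpace ℝ (Fin n) → ℝ}
    (hF : ContDiff ℝ 2 F) (i : Fin n) : ContDiff ℝ 1 (partialDeriv i F) :=
  contDiffOn_univ.1 (contDiffOn_partialDeriv isOpen_univ hF.contDiffOn (by norm_num) i)

theorem IsC2Metric.differentiableAt {D : Set (EuclideanSpace ℝ (Fin n))} (hD : IsOpen D)
    {G : EuclideanSpace ℝ (Fin n) → Matrix (Fin r) (Fin r) ℝ} (hG : IsC2Metric D G)
    {x : EuclideanSpace ℝ (Fin n)} (hx : x ∈ D) : DifferentiableAt ℝ G x :=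
  (hG.contDiffOn.contDiffAt (hD.mem_nhds hx)).differentiableAt two_ne_zero

theorem IsC2Metric.differentiableAt_connection {D : Set (EuclideanSpace ℝ (Fin n))}
    (hD : IsOpen D)
    {G : EuclideanSpace ℝ (Fin n) → Matrix (Fin r) (Fin r) ℝ} (hG : IsC2Metric D G)
    {x : EuclideanSpace ℝ (Fin n)} (hx : x ∈ D) (i : Fin n) :
    DifferentiableAt ℝ (connection G i) x :=
  ((contDiffOn_connection hD hG i).contDiffAt (hD.mem_nhds hx)).differentiableAt one_ne_zero

theorem IsC2Metric.mul_connection {D : Set (EuclideanSpace ℝ (Fin n))} (hD : IsOpen D)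
    {G : EuclideanSpace ℝ (Fin n) → Matrix (Fin r) (Fin r) ℝ} (hG : IsC2Metric D G)
    {x : EuclideanSpace ℝ (Fin n)} (hx : x ∈ D) (i : Fin n) :
    G x * connection G i x = partialDeriv i G x := by
  rw [connection, matrixPartial_eq (hG.differentiableAt hD hx), ← mul_assoc,
    Matrix.mul_nonsing_inv _ (hG.isUnit_det hx), one_mul]

theorem curvatureOp_eq {D : Set (EuclideanSpace ℝ (Fin n))} (hD : IsOpen D)
    {G : EuclideanSpace ℝ (Fin n) → Matrix (Fin r) (Fin r) ℝ} (hG : IsC2Metric D G)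
    {x : EuclideanSpace ℝ (Fin n)} (hx : x ∈ D) (α : EForm n r (q + 1)) :
    curvatureOp G x α = -∑ i, ∑ j, matrixAct (partialDeriv i (connection G j) x)
      (wedgeCovector (EuclideanSpace.proj i) (contract (coordVec j) α)) := by
  unfold curvatureOp
  refine congrArg _ (Finset.sum_congr rfl fun i _ => Finset.sum_congr rfl fun j _ => ?_)
  congr 1
  exact matrixPartial_eq (hG.differentiableAt_connection hD hx j)

/-- The matrices `G ∂_i Γ_j` and `G ∂_j Γ_i` are transposes of each other. -/
theorem mul_partialDeriv_connection {D : Set (EuclideanSpace ℝ (Fin n))} (hD : IsOpen D)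
    {G : EuclideanSpace ℝ (Fin n) → Matrix (Fin r) (Fin r) ℝ} (hG : IsC2Metric D G)
    {x : EuclideanSpace ℝ (Fin n)} (hx : x ∈ D) (i j : Fin n) :
    G x * partialDeriv i (connection G j) x =
      (partialDeriv j (connection G i) x).transpose * G x := by
  have key : ∀ i j, G x * partialDeriv i (connection G j) x =
      partialDeriv i (partialDeriv j G) x - partialDeriv i G x * ((G x)⁻¹ * partialDeriv j G x) := by
    intro i j
    have h1 : partialDeriv i (fun y => matrixMulL (G y) (connection G j y)) x =
        G x * partialDeriv i (connection G j) x + partialDeriv i G x * connection G j x :=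
      partialDeriv_bilin matrixMulL i (hG.differentiableAt hD hx)
        (hG.differentiableAt_connection hD hx j)
    have h2 : partialDeriv i (fun y => matrixMulL (G y) (connection G j y)) x =
        partialDeriv i (partialDeriv j G) x := by
      refine partialDeriv_congr ?_ i
      filter_upwards [hD.mem_nhds hx] with y hy using hG.mul_connection hD hy j
    rw [← h2, h1, connection, matrixPartial_eq (hG.differentiableAt hD hx)]
    exact (add_sub_cancel_right _ _).symm
  have hT : ∀ y ∈ D, ∀ k, (partialDeriv k G y).transpose = partialDeriv k G y := fun y hy k =>
    partialDeriv_transpose (hG.differentiableAt hD hy)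
      (by filter_upwards [hD.mem_nhds hy] with z hz using hG.transpose_eq hz) k
  have hT2 : (partialDeriv i (partialDeriv j G) x).transpose = partialDeriv i (partialDeriv j G) x :=
    partialDeriv_transpose (((contDiffOn_partialDeriv (m := 1) hD hG.contDiffOn (by norm_num)
      j).contDiffAt (hD.mem_nhds hx)).differentiableAt one_ne_zero)
      (by filter_upwards [hD.mem_nhds hx] with z hz using hT z hz j) i
  have h3 : (partialDeriv j (connection G i) x).transpose * G x =
      (G x * partialDeriv j (connection G i) x).transpose := by
    rw [Matrix.transpose_mul, hG.transpose_eq hx]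
  rw [h3, key, key, Matrix.transpose_sub, Matrix.transpose_mul, Matrix.transpose_mul,
    Matrix.transpose_nonsing_inv, hG.transpose_eq hx, hT x hx, hT x hx,
    partialDeriv_comm hD hG.contDiffOn hx j i, hT2, mul_assoc]

/-- The curvature operator is symmetric. -/
theorem formInner_curvatureOp_comm {D : Set (EuclideanSpace ℝ (Fin n))} (hD : IsOpen D)
    {G : EuclideanSpace ℝ (Fin n) → Matrix (Fin r) (Fin r) ℝ} (hG : IsC2Metric D G)
    {x : EuclideanSpace ℝ (Fin n)} (hx : x ∈ D) (α β : EForm n r (q + 1)) :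
    formInner (G x) (curvatureOp G x α) β = formInner (G x) α (curvatureOp G x β) := by
  have key : ∀ a b : EForm n r (q + 1), formInner (G x) (curvatureOp G x a) b =
      -∑ i, ∑ j, flatInner (contract (coordVec j) a)
        (matrixAct ((partialDeriv i (connection G j) x).transpose * G x)
          (contract (coordVec i) b)) := by
    intro a b
    rw [curvatureOp_eq hD hG hx, formInner_eq, flatInner_neg_left, flatInner_sum_left]
    congr 1
    refine Finset.sum_congr rfl fun i _ => ?_
    rw [flatInner_sum_left]
    refine Finset.sum_congr rfl fun j _ => ?_
    rw [flatInner_matrixAct, flatInner_wedgeCovector_proj, ← matrixAct_mul, matrixAct_contract]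
  rw [formInner_comm (hG.transpose_eq hx) α, key, key, Finset.sum_comm]
  congr 1
  refine Finset.sum_congr rfl fun j _ => Finset.sum_congr rfl fun i _ => ?_
  rw [flatInner_comm, flatInner_matrixAct, Matrix.transpose_mul, Matrix.transpose_transpose,
    hG.transpose_eq hx, mul_partialDeriv_connection hD hG hx i j]

theorem curvatureOp_sub (G : EuclideanSpace ℝ (Fin n) → Matrix (Fin r) (Fin r) ℝ)
    (x : EuclideanSpace ℝ (Fin n)) (α β : EForm n r (q + 1)) :
    curvatureOp G x (α - β) = curvatureOp G x α - curvatureOp G x β := by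
  have h1 : ∀ i j : Fin n, matrixAct
      (matrixPartial (fun y => (G y)⁻¹ * matrixPartial G j y) i x)
      (wedgeCovector (EuclideanSpace.proj i) (contract (coordVec j) (α - β))) =
      matrixAct (matrixPartial (fun y => (G y)⁻¹ * matrixPartial G j y) i x)
        (wedgeCovector (EuclideanSpace.proj i) (contract (coordVec j) α)) -
      matrixAct (matrixPartial (fun y => (G y)⁻¹ * matrixPartial G j y) i x)
        (wedgeCovector (EuclideanSpace.proj i) (contract (coordVec j) β)) := fun i j => by
    rw [← contractL_apply, map_sub, ← wedgeL_apply, map_sub, matrixAct_sub]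
    rfl
  simp only [curvatureOp, h1, Finset.sum_sub_distrib]
  abel

/-- The pointwise inequality `2⟨β, α⟩ - ⟨Θα, α⟩ ≤ ⟨Θ⁻¹β, β⟩`: if `Θw = β` then the difference of the
two sides is `⟨Θ(w - α), w - α⟩`. -/
theorem ofReal_le_curvatureInvForm {D : Set (EuclideanSpace ℝ (Fin n))} (hD : IsOpen D)
    {g : EuclideanSpace ℝ (Fin n) → Matrix (Fin r) (Fin r) ℝ} (hg : IsC2Metric D g)
    (hpos : NakanoSemipositive q D g) {x : EuclideanSpace ℝ (Fin n)} (hx : x ∈ D)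
    (α β : EForm n r (q + 1)) :
    ENNReal.ofReal (2 * formInner (g x) α β - formInner (g x) (curvatureOp g x α) α) ≤
      curvatureInvForm g x β := by
  refine le_iInf₂ fun w hw => ENNReal.ofReal_le_ofReal ?_
  have h := hpos x hx (w - α)
  have h1 : formInner (g x) (curvatureOp g x (w - α)) (w - α) =
      formInner (g x) w β - 2 * formInner (g x) α β +
        formInner (g x) (curvatureOp g x α) α := by
    have h2 : formInner (g x) (curvatureOp g x α) w = formInner (g x) α β := by
      rw [formInner_curvatureOp_comm hD hg hx, hw]
    rw [formInner_eq, curvatureOp_sub, matrixAct_sub, flatInner_sub_left, flatInner_sub_right,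
      flatInner_sub_right, ← formInner_eq, ← formInner_eq, ← formInner_eq, ← formInner_eq, h2, hw,
      formInner_comm (hg.transpose_eq hx) β w, formInner_comm (hg.transpose_eq hx) β α]
    ring
  linarith

/-- The quadratic form induced on `α` by the Hessian of `p`. -/
noncomputable def hessForm (p : EuclideanSpace ℝ (Fin n) → ℝ) (x : EuclideanSpace ℝ (Fin n))
    (G : Matrix (Fin r) (Fin r) ℝ) (α : EForm n r (q + 1)) : ℝ :=
  ∑ i, ∑ j, partialDeriv i (partialDeriv j p) x *
    formInner G (contract (coordVec j) α) (contract (coordVec i) α)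

theorem partialDeriv_partialDeriv_add {F H : EuclideanSpace ℝ (Fin n) → ℝ} (hF : ContDiff ℝ 2 F)
    (hH : ContDiff ℝ 2 H) (x : EuclideanSpace ℝ (Fin n)) (i j : Fin n) :
    partialDeriv i (partialDeriv j fun y => F y + H y) x =
      partialDeriv i (partialDeriv j F) x + partialDeriv i (partialDeriv j H) x := by
  have h1 : (partialDeriv j fun y => F y + H y) = fun y => partialDeriv j F y + partialDeriv j H y :=
    funext fun y => partialDeriv_add (hF.differentiable two_ne_zero y)
      (hH.differentiable two_ne_zero y) j
  rw [h1, partialDeriv_add ((contDiff_partialDeriv hF j).differentiable one_ne_zero x)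
    ((contDiff_partialDeriv hH j).differentiable one_ne_zero x)]

theorem hessForm_add {F H : EuclideanSpace ℝ (Fin n) → ℝ} (hF : ContDiff ℝ 2 F)
    (hH : ContDiff ℝ 2 H) (x : EuclideanSpace ℝ (Fin n)) (G : Matrix (Fin r) (Fin r) ℝ)
    (α : EForm n r (q + 1)) :
    hessForm (fun y => F y + H y) x G α = hessForm F x G α + hessForm H x G α := by
  simp only [hessForm, partialDeriv_partialDeriv_add hF hH, add_mul, Finset.sum_add_distrib]

theorem hessForm_affine (L : EuclideanSpace ℝ (Fin n) →L[ℝ] ℝ) (b : ℝ)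
    (x : EuclideanSpace ℝ (Fin n)) (G : Matrix (Fin r) (Fin r) ℝ) (α : EForm n r (q + 1)) :
    hessForm (fun y => L y + b) x G α = 0 := by
  have h1 : ∀ j, (partialDeriv j fun y => L y + b) = fun _ => L (coordVec j) := fun j =>
    funext fun y => by simp [partialDeriv]
  simp [hessForm, h1, partialDeriv_const]

theorem sum_contract_smul_formInner (c : Fin n → ℝ) (G : Matrix (Fin r) (Fin r) ℝ)
    (α : EForm n r (q + 1)) :
    ∑ i, ∑ j, c i * c j * formInner G (contract (coordVec j) α) (contract (coordVec i) α) =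
      formInner G (∑ j, c j • contract (coordVec j) α) (∑ i, c i • contract (coordVec i) α) := by
  simp only [formInner_eq, flatInner_sum_left, matrixAct_sum, flatInner_sum_right, matrixAct_smul,
    flatInner_smul_left, flatInner_smul_right, Finset.mul_sum, mul_assoc]

/-- The Hessian of `exp h` is `exp h (Hess h + dh ⊗ dh)`, and `dh ⊗ dh` contributes the square of
`grad h ⌟ α`. -/
theorem exp_mul_hessForm_le {h : EuclideanSpace ℝ (Fin n) → ℝ} (hh : ContDiff ℝ 2 h)
    (x : EuclideanSpace ℝ (Fin n)) {G : Matrix (Fin r) (Fin r) ℝ} (hG : G.PosSemidef)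
    (α : EForm n r (q + 1)) :
    Real.exp (h x) * hessForm h x G α ≤ hessForm (fun y => Real.exp (h y)) x G α := by
  have h1 : ∀ j, (partialDeriv j fun y => Real.exp (h y)) =
      fun y => Real.exp (h y) • partialDeriv j h y := fun j =>
    funext fun y => partialDeriv_exp (hh.differentiable two_ne_zero y) j
  have h2 : ∀ i j, partialDeriv i (partialDeriv j fun y => Real.exp (h y)) x =
      Real.exp (h x) * (partialDeriv i (partialDeriv j h) x +
        partialDeriv i h x * partialDeriv j h x) := by
    intro i j
    have d : DifferentiableAt ℝ h x := hh.differentiable two_ne_zero x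
    rw [h1, partialDeriv_smul d.exp ((contDiff_partialDeriv hh j).differentiable one_ne_zero x),
      partialDeriv_exp d, smul_eq_mul, smul_eq_mul]
    ring
  have h3 : hessForm (fun y => Real.exp (h y)) x G α = Real.exp (h x) * (hessForm h x G α +
      ∑ i, ∑ j, partialDeriv i h x * partialDeriv j h x *
        formInner G (contract (coordVec j) α) (contract (coordVec i) α)) := by
    simp only [hessForm, h2, mul_add, Finset.mul_sum, ← Finset.sum_add_distrib]
    refine Finset.sum_congr rfl fun i _ => Finset.sum_congr rfl fun j _ => by ring
  rw [h3, sum_contract_smul_formInner, mul_add]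
  exact le_add_of_nonneg_right (mul_nonneg (Real.exp_nonneg _) (formInner_self_nonneg hG _))

theorem hessForm_const_mul (t : ℝ) {h : EuclideanSpace ℝ (Fin n) → ℝ} (hh : ContDiff ℝ 2 h)
    (x : EuclideanSpace ℝ (Fin n)) (G : Matrix (Fin r) (Fin r) ℝ)
    (α : EForm n r (q + 1)) :
    hessForm (fun y => t * h y) x G α = t * hessForm h x G α := by
  have h0 : ∀ {F : EuclideanSpace ℝ (Fin n) → ℝ}, Differentiable ℝ F → ∀ j y,
      partialDeriv j (fun y => t * F y) y = t * partialDeriv j F y := fun hF j y => by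
    simp [partialDeriv, fderiv_const_mul (hF y)]
  have h1 : ∀ j, (partialDeriv j fun y => t * h y) = fun y => t * partialDeriv j h y := fun j =>
    funext fun y => h0 (hh.differentiable two_ne_zero) j y
  simp only [hessForm, h1, h0 ((contDiff_partialDeriv hh _).differentiable one_ne_zero),
    Finset.mul_sum, mul_assoc]

/-- `∑ dx_i ∧ (∂_i ⌟ ·)` multiplies `(q + 1)`-forms by their degree. -/
theorem sum_flatInner_contract (α β : EForm n r (q + 1)) :
    ∑ i, flatInner (contract (coordVec i) α) (contract (coordVec i) β) =
      (q + 1) * flatInner α β := by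
  have h1 : ∀ {k : ℕ} (a b : EForm n r k), (k.factorial : ℝ) * flatInner a b =
      ∑ τ, ∑ K : Fin k → Fin n, a (fun k => coordVec (K k)) τ * b (fun k => coordVec (K k)) τ := by
    intro k a b
    rw [flatInner, Finset.mul_sum]
    exact Finset.sum_congr rfl fun τ _ => (sum_tuples_eq a b τ).symm
  have h2 : (q.factorial : ℝ) * ∑ i, flatInner (contract (coordVec i) α) (contract (coordVec i) β) =
      ((q + 1).factorial : ℝ) * flatInner α β := by
    rw [h1, Finset.mul_sum]
    simp only [h1]
    rw [Finset.sum_comm]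
    refine Finset.sum_congr rfl fun τ _ => ?_
    rw [← (Fin.consEquiv fun _ : Fin (q + 1) => Fin n).sum_comp, Fintype.sum_prod_type]
    refine Finset.sum_congr rfl fun i _ => Finset.sum_congr rfl fun K _ => ?_
    have h3 : (fun k => coordVec ((Fin.consEquiv fun _ : Fin (q + 1) => Fin n) (i, K) k)) =
        (Fin.cons (coordVec i) fun k => coordVec (K k) :
          Fin (q + 1) → EuclideanSpace ℝ (Fin n)) := by
      funext k
      refine Fin.cases ?_ (fun k => ?_) k <;> simp [Fin.consEquiv]
    rw [h3]
    rfl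
  have h4 : (q.factorial : ℝ) ≠ 0 := by positivity
  refine mul_left_cancel₀ h4 ?_
  rw [h2, Nat.factorial_succ]
  push_cast
  ring

/-- The Hessian of `|x|²` acts on `(q + 1)`-forms as `2 (q + 1)`. -/
theorem hessForm_norm_sq (x : EuclideanSpace ℝ (Fin n)) (G : Matrix (Fin r) (Fin r) ℝ)
    (α : EForm n r (q + 1)) :
    hessForm (fun y => ‖y‖ ^ 2) x G α = 2 * ((q + 1) * formInner G α α) := by
  have h1 : ∀ j, (partialDeriv j fun y : EuclideanSpace ℝ (Fin n) => ‖y‖ ^ 2) =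
      fun y => 2 * y j := fun j => funext fun y => by
    simp [partialDeriv, fderiv_norm_sq_apply, coordVec, EuclideanSpace.inner_single_right]
  have h2 : ∀ i j, partialDeriv i (fun y : EuclideanSpace ℝ (Fin n) => 2 * y j) x =
      if i = j then 2 else 0 := by
    intro i j
    have : (fun y : EuclideanSpace ℝ (Fin n) => 2 * y j) =
      fun y => ((2 : ℝ) • (EuclideanSpace.proj j : EuclideanSpace ℝ (Fin n) →L[ℝ] ℝ)) y := rfl
    rw [partialDeriv, this, ContinuousLinearMap.fderiv]
    simp [coordVec, eq_comm]
  simp only [hessForm, h1, h2, ite_mul, zero_mul, Finset.sum_ite_eq, Finset.mem_univ, if_true]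
  rw [← Finset.mul_sum]
  simp only [formInner_eq, matrixAct_contract, sum_flatInner_contract]

/-- Multiplying the metric with `exp (-χ)` adds the Hessian of `χ` to the curvature. -/
theorem formInner_curvatureOp_weight {D : Set (EuclideanSpace ℝ (Fin n))} (hD : IsOpen D)
    {g : EuclideanSpace ℝ (Fin n) → Matrix (Fin r) (Fin r) ℝ} (hg : IsC2Metric D g)
    {χ : EuclideanSpace ℝ (Fin n) → ℝ} (hχ : ContDiff ℝ 2 χ) :
    IsC2Metric D (fun x => Real.exp (-χ x) • g x) ∧ ∀ x ∈ D, ∀ α : EForm n r (q + 1),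
      formInner (g x) (curvatureOp (fun x => Real.exp (-χ x) • g x) x α) α =
        formInner (g x) (curvatureOp g x α) α + hessForm χ x (g x) α := by
  obtain ⟨G, hGdef⟩ : ∃ G, G = fun x => Real.exp (-χ x) • g x := ⟨_, rfl⟩
  have hG : IsC2Metric D G := by
    rw [hGdef]
    refine ⟨fun x hx => (hg.1 x hx).smul (Real.exp_pos _), fun τ ξ => ?_⟩
    exact (Real.contDiff_exp.comp hχ.neg).contDiffOn.mul (hg.2 τ ξ)
  have dχ : ∀ x, DifferentiableAt ℝ χ x := fun x => hχ.differentiable two_ne_zero x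
  have hconn : ∀ y ∈ D, ∀ j, connection G j y = connection g j y - partialDeriv j χ y • 1 := by
    intro y hy j
    have dn : DifferentiableAt ℝ (fun x => -χ x) y := (dχ y).neg
    have h1 : partialDeriv j G y =
        Real.exp (-χ y) • (partialDeriv j g y - partialDeriv j χ y • g y) := by
      have h2 : partialDeriv j (fun x => Real.exp (-χ x)) y =
          -(Real.exp (-χ y) * partialDeriv j χ y) := by
        have h3 : partialDeriv j (fun x => -χ x) y = -partialDeriv j χ y := by
          simp [partialDeriv, fderiv_fun_neg]
        rw [partialDeriv_exp dn, h3]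
        ring
      rw [hGdef]
      refine (partialDeriv_smul dn.exp (hg.differentiableAt hD hy) j).trans ?_
      rw [h2, smul_sub, smul_smul, neg_smul, sub_eq_add_neg]
    have h4 : (G y)⁻¹ = (Real.exp (-χ y))⁻¹ • (g y)⁻¹ := by
      refine Matrix.inv_eq_left_inv ?_
      rw [hGdef]
      simp only
      rw [Matrix.smul_mul, Matrix.mul_smul, smul_smul, inv_mul_cancel₀ (Real.exp_pos _).ne', one_smul,
        Matrix.nonsing_inv_mul _ (hg.isUnit_det hy)]
    rw [connection, matrixPartial_eq (hG.differentiableAt hD hy), h1, h4, Matrix.smul_mul,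
      Matrix.mul_smul, smul_smul, inv_mul_cancel₀ (Real.exp_pos _).ne', one_smul, Matrix.mul_sub,
      Matrix.mul_smul, Matrix.nonsing_inv_mul _ (hg.isUnit_det hy), connection,
      matrixPartial_eq (hg.differentiableAt hD hy)]
  rw [← hGdef]
  refine ⟨hG, fun x hx α => ?_⟩
  have hd : ∀ i j, partialDeriv i (connection G j) x =
      partialDeriv i (connection g j) x - partialDeriv i (partialDeriv j χ) x • 1 := by
    intro i j
    have dj : DifferentiableAt ℝ (partialDeriv j χ) x :=
      (contDiff_partialDeriv hχ j).differentiable one_ne_zero x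
    have h1 : connection G j =ᶠ[𝓝 x] fun y =>
        connection g j y - partialDeriv j χ y • (1 : Matrix (Fin r) (Fin r) ℝ) := by
      filter_upwards [hD.mem_nhds hx] with y hy using hconn y hy j
    refine (partialDeriv_congr h1 i).trans ?_
    refine (partialDeriv_sub (hg.differentiableAt_connection hD hx j)
      (dj.smul_const _) i).trans ?_
    congr 1
    exact partialDeriv_smul_const dj _ i
  have hterm : curvatureOp G x α = curvatureOp g x α + ∑ i, ∑ j,
      partialDeriv i (partialDeriv j χ) x •
        wedgeCovector (EuclideanSpace.proj i) (contract (coordVec j) α) := by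
    rw [curvatureOp_eq hD hG hx, curvatureOp_eq hD hg hx]
    simp only [hd, matrixAct_sub_left, matrixAct_smul_left, matrixAct_one, Finset.sum_sub_distrib]
    abel
  rw [hterm, formInner_eq, flatInner_add_left, ← formInner_eq, hessForm]
  congr 1
  rw [flatInner_sum_left]
  refine Finset.sum_congr rfl fun i _ => ?_
  rw [flatInner_sum_left]
  refine Finset.sum_congr rfl fun j _ => ?_
  rw [flatInner_smul_left, flatInner_wedgeCovector_proj, ← matrixAct_contract, formInner_eq]

end Weights

/-! ### Smooth exhaustions of convex sets and cut-off functions -/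

section Exhaustion

open Filter Topology

variable {n r q : ℕ}

theorem exists_cutoff {D K : Set (EuclideanSpace ℝ (Fin n))} (hD : IsOpen D) (hK : IsCompact K)
    (hKD : K ⊆ D) :
    ∃ η : EuclideanSpace ℝ (Fin n) → ℝ, ContDiff ℝ ∞ η ∧ HasCompactSupport η ∧ tsupport η ⊆ D ∧
      (∀ x, 0 ≤ η x ∧ η x ≤ 1) ∧ ∀ x ∈ K, η =ᶠ[𝓝 x] fun _ => 1 := by
  obtain ⟨L, hL, hKL, hLD⟩ := exists_compact_between hK hD hKD
  obtain ⟨η, h1, h0, h01⟩ := exists_contMDiffMap_one_nhds_of_subset_interior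
    (modelWithCornersSelf ℝ (EuclideanSpace ℝ (Fin n))) (n := ⊤) hK.isClosed hKL
  have hs : tsupport η ⊆ L := by
    refine closure_minimal (fun x hx => ?_) hL.isClosed
    by_contra h
    exact hx (h0 x h)
  refine ⟨η, η.contMDiff.contDiff, hL.of_isClosed_subset (isClosed_tsupport _) hs, hs.trans hLD,
    fun x => ⟨(h01 x).1, (h01 x).2⟩, fun x hx => ?_⟩
  exact (eventually_nhdsSet_iff_forall.1 h1) x hx

/-- An affine function separating a point outside of `D` from a compact subset of `D`, normalised to
be at most `-1` on the compact set. -/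
theorem exists_affine {D K : Set (EuclideanSpace ℝ (Fin n))} (hD : IsOpen D) (hDc : Convex ℝ D)
    (hK : IsCompact K) (hKD : K ⊆ D) {y : EuclideanSpace ℝ (Fin n)} (hy : y ∉ D) :
    ∃ (L : EuclideanSpace ℝ (Fin n) →L[ℝ] ℝ) (b : ℝ), 0 < L y + b ∧ ∀ x ∈ K, L x + b ≤ -1 := by
  obtain ⟨f, hf⟩ := geometric_hahn_banach_open_point hDc hD hy
  obtain ⟨c, hc, hcK⟩ : ∃ c, c < f y ∧ ∀ x ∈ K, f x ≤ c := by
    obtain ⟨c, hc, hcK⟩ := hK.exists_forall_le' (f := fun x => -f x)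
      f.continuous.neg.continuousOn (a := -f y) fun x hx => neg_lt_neg (hf x (hKD hx))
    exact ⟨-c, neg_lt.1 hc, fun x hx => le_neg.1 (hcK x hx)⟩
  have h2 : 0 < f y - c := sub_pos.2 hc
  refine ⟨(2 / (f y - c)) • f, -(f y + c) / (f y - c), ?_, fun x hx => ?_⟩
  · have : ((2 / (f y - c)) • f) y + -(f y + c) / (f y - c) = 1 := by
      simp only [_root_.smul_apply, smul_eq_mul]
      field_simp
      ring
    rw [this]
    exact one_pos
  · have : ((2 / (f y - c)) • f) x + -(f y + c) / (f y - c) = -1 - 2 * (c - f x) / (f y - c) := by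
      simp only [_root_.smul_apply, smul_eq_mul]
      field_simp
      ring
    rw [this]
    have := hcK x hx
    have : 0 ≤ 2 * (c - f x) / (f y - c) := div_nonneg (by linarith) h2.le
    linarith

/-- For a compact subset `K` of a convex open set `D` there is a strictly convex `C²` function `p` on
the whole space which is negative on `K` and positive outside of a larger compact subset `K'` of
`D`. It is `p = ε |x|² + ∑ exp (N l_y) - 1/2`, where the affine functions `l_y` separate `K` from
finitely many points `y` outside of `D`. -/
theorem exists_exhaustion {D K : Set (EuclideanSpace ℝ (Fin n))} (hD : IsOpen D)
    (hDc : Convex ℝ D) (hK : IsCompact K) (hKD : K ⊆ D) :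
    ∃ (p : EuclideanSpace ℝ (Fin n) → ℝ) (c : ℝ) (K' : Set (EuclideanSpace ℝ (Fin n))),
      ContDiff ℝ 2 p ∧ 0 < c ∧ IsCompact K' ∧ K' ⊆ D ∧ K ⊆ K' ∧
      (∀ x ∈ K, p x ≤ -(1 / 4)) ∧ (∀ x ∉ K', 1 / 4 ≤ p x) ∧
      ∀ (r q : ℕ) (x : EuclideanSpace ℝ (Fin n)) (G : Matrix (Fin r) (Fin r) ℝ), G.PosSemidef →
        ∀ α : EForm n r (q + 1), c * formInner G α α ≤ hessForm p x G α := by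
  -- `ε` is so small that the quadratic term hardly contributes on `K`; it takes care of the points far
  -- away, where it exceeds `3/4`
  obtain ⟨ε, hε, hεK⟩ : ∃ ε : ℝ, 0 < ε ∧ ∀ x ∈ K, ε * ‖x‖ ^ 2 ≤ 1 / 8 := by
    obtain ⟨R, hR⟩ := hK.isBounded.exists_norm_le
    refine ⟨1 / (8 * (R ^ 2 + 1)), by positivity, fun x hx => ?_⟩
    have h1 : ‖x‖ ^ 2 ≤ R ^ 2 := by gcongr; exact hR x hx
    rw [div_mul_eq_mul_div, div_le_div_iff₀ (by positivity) (by norm_num)]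
    linarith
  obtain ⟨B, hBdef⟩ : ∃ B, B = {x : EuclideanSpace ℝ (Fin n) | ε * ‖x‖ ^ 2 ≤ 3 / 4} := ⟨_, rfl⟩
  have hBc : IsClosed B := by
    rw [hBdef]
    exact isClosed_le (by fun_prop) (by fun_prop)
  have hB : IsCompact B := by
    refine Metric.isCompact_of_isClosed_isBounded hBc ?_
    refine Metric.isBounded_closedBall (x := (0 : EuclideanSpace ℝ (Fin n)))
      (r := √(3 / 4 / ε)) |>.subset fun x hx => ?_
    rw [mem_closedBall_zero_iff]
    refine Real.le_sqrt_of_sq_le ?_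
    rw [hBdef] at hx
    rw [le_div_iff₀ hε, mul_comm]
    exact hx
  have hA : ∀ y : EuclideanSpace ℝ (Fin n), ∃ L : (EuclideanSpace ℝ (Fin n) →L[ℝ] ℝ) × ℝ,
      (y ∉ D → 0 < L.1 y + L.2) ∧ ∀ x ∈ K, L.1 x + L.2 ≤ -1 := by
    intro y
    by_cases hy : y ∈ D
    · exact ⟨(0, -1), fun h => absurd hy h, fun x _ => by simp⟩
    · obtain ⟨L, b, h1, h2⟩ := exists_affine hD hDc hK hKD hy
      exact ⟨(L, b), fun _ => h1, h2⟩
  choose L hL1 hL2 using hA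
  -- the remaining points outside of `D` form a compact set, and finitely many of the half spaces
  -- `l_y > 0` cover it
  obtain ⟨s, hs, hcov⟩ := (hB.diff hD).elim_nhds_subcover
    (fun y => {x | 0 < (L y).1 x + (L y).2})
    fun y hy => (isOpen_lt continuous_const (by fun_prop)).mem_nhds (hL1 y hy.2)
  -- `N` is so large that the exponentials contribute at most `1/8` on `K`, where `l_y ≤ -1`
  obtain ⟨N, hN⟩ : ∃ N : ℝ, N = 8 * s.card := ⟨_, rfl⟩
  have hN0 : 0 ≤ N := by rw [hN]; positivity
  have hNs : s.card * Real.exp (-N) ≤ 1 / 8 := by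
    rw [Real.exp_neg, ← div_eq_mul_inv, div_le_iff₀ (Real.exp_pos _)]
    have := Real.add_one_le_exp N
    linarith
  obtain ⟨h, hh⟩ : ∃ h : EuclideanSpace ℝ (Fin n) → EuclideanSpace ℝ (Fin n) → ℝ,
      h = fun y x => N * ((L y).1 x + (L y).2) := ⟨_, rfl⟩
  have hh2 : ∀ y, ContDiff ℝ 2 (h y) := fun y => by rw [hh]; fun_prop
  have hsum2 : ∀ t : Finset (EuclideanSpace ℝ (Fin n)),
      ContDiff ℝ 2 (fun x => ∑ y ∈ t, Real.exp (h y x)) :=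
    fun t => ContDiff.sum fun y _ => (hh2 y).exp
  have hsq : ContDiff ℝ 2 (fun x : EuclideanSpace ℝ (Fin n) => ‖x‖ ^ 2) := contDiff_norm_sq ℝ
  have hεsq : ContDiff ℝ 2 (fun x : EuclideanSpace ℝ (Fin n) => ε * ‖x‖ ^ 2) :=
    contDiff_const.mul hsq
  have h12 := hεsq.add (hsum2 s)
  refine ⟨fun x => (ε * ‖x‖ ^ 2 + ∑ y ∈ s, Real.exp (h y x)) +
      ((0 : EuclideanSpace ℝ (Fin n) →L[ℝ] ℝ) x + -(1 / 2)), 2 * ε,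
    B ∩ {x | ∀ y ∈ s, (L y).1 x + (L y).2 ≤ 0}, ?_, by positivity, ?_, ?_, ?_, ?_, ?_, ?_⟩
  · exact h12.add (by fun_prop)
  · refine hB.inter_right ?_
    simp only [Set.ofPred_forall]
    exact isClosed_biInter fun y _ => isClosed_le (by fun_prop) continuous_const
  · rintro x ⟨hx, hxs⟩
    by_contra hxD
    obtain ⟨y, hy, hxy⟩ := Set.mem_iUnion₂.1 (hcov ⟨hx, hxD⟩)
    exact absurd hxy (not_lt.2 (hxs y hy))
  · intro x hx
    refine ⟨?_, fun y _ => (hL2 y x hx).trans (by norm_num)⟩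
    rw [hBdef]
    exact (hεK x hx).trans (by norm_num)
  · intro x hx
    have h1 : ∑ y ∈ s, Real.exp (h y x) ≤ 1 / 8 := by
      refine (Finset.sum_le_card_nsmul s _ (Real.exp (-N)) fun y _ => ?_).trans (by simpa using hNs)
      rw [Real.exp_le_exp, hh]
      have := mul_le_mul_of_nonneg_left (hL2 y x hx) hN0
      simpa using this
    have := hεK x hx
    simp only [_root_.zero_apply]
    linarith
  · intro x hx
    simp only [_root_.zero_apply]
    by_cases hxB : x ∈ B
    · have : ∃ y ∈ s, 0 < (L y).1 x + (L y).2 := by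
        by_contra! h'
        exact hx ⟨hxB, h'⟩
      obtain ⟨y, hy, hxy⟩ := this
      have h1 : Real.exp (h y x) ≤ ∑ y ∈ s, Real.exp (h y x) :=
        Finset.single_le_sum (f := fun y => Real.exp (h y x)) (fun y _ => (Real.exp_pos _).le) hy
      have h2 : 1 ≤ Real.exp (h y x) := by
        rw [Real.one_le_exp_iff, hh]
        exact mul_nonneg hN0 hxy.le
      have h3 : 0 ≤ ε * ‖x‖ ^ 2 := by positivity
      linarith
    · have h1 : 3 / 4 < ε * ‖x‖ ^ 2 := by
        rw [hBdef] at hxB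
        exact not_le.1 hxB
      have h2 : 0 ≤ ∑ y ∈ s, Real.exp (h y x) := Finset.sum_nonneg fun y _ => (Real.exp_pos _).le
      linarith
  · intro r q x G hG α
    have h1 : ∀ t : Finset (EuclideanSpace ℝ (Fin n)),
        0 ≤ hessForm (fun x => ∑ y ∈ t, Real.exp (h y x)) x G α := by
      intro t
      classical
      induction t using Finset.induction_on with
      | empty =>
        have := hessForm_affine (0 : EuclideanSpace ℝ (Fin n) →L[ℝ] ℝ) 0 x G α
        simp only [_root_.zero_apply, add_zero] at this
        simp [this]
      | insert y t hy ih =>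
        simp only [Finset.sum_insert hy]
        rw [hessForm_add (hh2 y).exp (hsum2 t)]
        refine add_nonneg (le_trans ?_ (exp_mul_hessForm_le (hh2 y) x hG α)) ih
        have h2 : hessForm (h y) x G α = 0 := by
          rw [hh]
          simp only
          rw [hessForm_const_mul N (by fun_prop), hessForm_affine, mul_zero]
        rw [h2, mul_zero]
    rw [hessForm_add h12 (by fun_prop), hessForm_add hεsq (hsum2 s), hessForm_affine,
      hessForm_const_mul ε hsq, hessForm_norm_sq]
    have h3 := formInner_self_nonneg hG α
    have h4 : 0 ≤ ε * (q * formInner G α α) := by positivity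
    have := h1 s
    nlinarith

end Exhaustion

/-! ### The weighted estimate -/

section WeightedEstimate

open Filter Topology

variable {n r q : ℕ}

attribute [local instance] Matrix.normedAddCommGroup Matrix.normedSpace

theorem formInner_smul_metric (c : ℝ) (G : Matrix (Fin r) (Fin r) ℝ) (α β : EForm n r q) :
    formInner (c • G) α β = c * formInner G α β := by
  rw [formInner_eq, formInner_eq, matrixAct_smul_left, flatInner_smul_right]

/-- Cauchy-Schwarz inequality with weights. -/
theorem two_mul_formInner_le {G : Matrix (Fin r) (Fin r) ℝ} (hG : G.PosDef) {t : ℝ} (ht : 0 < t)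
    (α β : EForm n r q) :
    2 * formInner G α β ≤ t * formInner G β β + t⁻¹ * formInner G α α := by
  have hs : G.transpose = G := by
    have := hG.isHermitian
    rwa [Matrix.IsHermitian, Matrix.conjTranspose_eq_transpose_of_trivial] at this
  have h := formInner_self_nonneg hG.posSemidef (α - t • β)
  have h1 : formInner G (α - t • β) (α - t • β) =
      formInner G α α - 2 * t * formInner G α β + t ^ 2 * formInner G β β := by
    have h2 := formInner_comm hs α β
    simp only [formInner_eq] at h2 ⊢
    rw [matrixAct_sub, matrixAct_smul, flatInner_sub_left, flatInner_sub_right, flatInner_sub_right,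
      flatInner_smul_left, flatInner_smul_right, flatInner_smul_right, flatInner_smul_left, ← h2]
    ring
  rw [h1] at h
  have h3 : t⁻¹ * (formInner G α α - 2 * t * formInner G α β + t ^ 2 * formInner G β β) =
      t⁻¹ * formInner G α α - 2 * formInner G α β + t * formInner G β β := by
    field_simp
  have := mul_nonneg (inv_pos.2 ht).le h
  rw [h3] at this
  linarith

theorem SqIntegrable.integrableOn_formInner {D : Set (EuclideanSpace ℝ (Fin n))} (hD : IsOpen D)
    {G : EuclideanSpace ℝ (Fin n) → Matrix (Fin r) (Fin r) ℝ} (hG : IsC2Metric D G)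
    {α β : EuclideanSpace ℝ (Fin n) → EForm n r q} (hα : SqIntegrable D G α)
    (hβ : SqIntegrable D G β) : IntegrableOn (fun x => formInner (G x) (α x) (β x)) D := by
  have hGm : AEStronglyMeasurable G (volume.restrict D) :=
    hG.contDiffOn.continuousOn.aestronglyMeasurable hD.measurableSet
  have h1 : AEStronglyMeasurable (fun x => matrixActL (G x) (β x)) (volume.restrict D) :=
    matrixActL.aestronglyMeasurable_comp₂ hGm hβ.1
  have h2 : AEStronglyMeasurable (fun x => flatInnerL (α x) (matrixActL (G x) (β x)))
      (volume.restrict D) := flatInnerL.aestronglyMeasurable_comp₂ hα.1 h1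
  have h3 : (fun x => formInner (G x) (α x) (β x)) =
      fun x => flatInnerL (α x) (matrixActL (G x) (β x)) := funext fun x => formInner_eq _ _ _
  rw [← h3] at h2
  have hsum : IntegrableOn (fun x => formInner (G x) (β x) (β x) + formInner (G x) (α x) (α x)) D :=
    hβ.2.add hα.2
  refine hsum.mono' h2 ?_
  filter_upwards [ae_restrict_mem hD.measurableSet] with x hx
  have i1 := two_mul_formInner_le (hG.1 x hx) one_pos (α x) (β x)
  have i2 := two_mul_formInner_le (hG.1 x hx) one_pos (-α x) (β x)
  have p1 := formInner_self_nonneg (hG.1 x hx).posSemidef (α x)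
  have p2 := formInner_self_nonneg (hG.1 x hx).posSemidef (β x)
  rw [show formInner (G x) (-α x) (β x) = -formInner (G x) (α x) (β x) by
      rw [formInner_eq, flatInner_neg_left, formInner_eq],
    show formInner (G x) (-α x) (-α x) = formInner (G x) (α x) (α x) by
      rw [formInner_eq, matrixAct_neg, flatInner_neg_left, flatInner_neg_right, neg_neg,
        formInner_eq]] at i2
  rw [inv_one] at i1 i2
  rw [Real.norm_eq_abs, abs_le]
  constructor <;> linarith

/-- No measurability of `F` is needed here, as the lower integral is monotone. -/
theorem setIntegral_le_toReal_lintegral {D : Set (EuclideanSpace ℝ (Fin n))} (hD : IsOpen D)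
    {h : EuclideanSpace ℝ (Fin n) → ℝ} (hh : IntegrableOn h D)
    {F : EuclideanSpace ℝ (Fin n) → ENNReal} (hF : ∫⁻ x in D, F x < ⊤)
    (hle : ∀ x ∈ D, ENNReal.ofReal (h x) ≤ F x) : ∫ x in D, h x ≤ (∫⁻ x in D, F x).toReal := by
  rw [integral_eq_lintegral_pos_part_sub_lintegral_neg_part hh]
  refine (sub_le_self _ ENNReal.toReal_nonneg).trans (ENNReal.toReal_mono hF.ne ?_)
  exact setLIntegral_mono' hD.measurableSet hle

theorem inv_weight {D : Set (EuclideanSpace ℝ (Fin n))}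
    {g : EuclideanSpace ℝ (Fin n) → Matrix (Fin r) (Fin r) ℝ} (hg : IsC2Metric D g)
    {x : EuclideanSpace ℝ (Fin n)} (hx : x ∈ D) (a : ℝ) :
    (Real.exp (-a) • g x)⁻¹ = Real.exp a • (g x)⁻¹ := by
  refine Matrix.inv_eq_left_inv ?_
  rw [Matrix.smul_mul, Matrix.mul_smul, smul_smul, ← Real.exp_add, add_neg_cancel, Real.exp_zero,
    one_smul, Matrix.nonsing_inv_mul _ (hg.isUnit_det hx)]

theorem flatInner_inv_nonneg {D : Set (EuclideanSpace ℝ (Fin n))}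
    {g : EuclideanSpace ℝ (Fin n) → Matrix (Fin r) (Fin r) ℝ} (hg : IsC2Metric D g)
    {x : EuclideanSpace ℝ (Fin n)} (hx : x ∈ D) (β : EForm n r q) :
    0 ≤ flatInner β (matrixAct (g x)⁻¹ β) := by
  rw [← formInner_eq]
  exact formInner_self_nonneg (hg.1 x hx).inv.posSemidef β

theorem setIntegral_inv_weight_le {D K : Set (EuclideanSpace ℝ (Fin n))} (hD : IsOpen D)
    (hK : IsCompact K) (hKD : K ⊆ D)
    {g : EuclideanSpace ℝ (Fin n) → Matrix (Fin r) (Fin r) ℝ} (hg : IsC2Metric D g)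
    {β : EuclideanSpace ℝ (Fin n) → EForm n r q} (hβ : ContinuousOn β D) (hβK : ∀ x ∉ K, β x = 0)
    {χ : EuclideanSpace ℝ (Fin n) → ℝ} {b : ℝ} (hχ : ∀ x ∈ K, χ x ≤ b) :
    ∫ x in D, flatInner (β x) (matrixAct (Real.exp (-χ x) • g x)⁻¹ (β x)) ≤
      Real.exp b * ∫ x in D, flatInner (β x) (matrixAct (g x)⁻¹ (β x)) := by
  rw [← integral_const_mul]
  have hEq : ∀ x ∈ D, flatInner (β x) (matrixAct (Real.exp (-χ x) • g x)⁻¹ (β x)) =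
      Real.exp (χ x) * flatInner (β x) (matrixAct (g x)⁻¹ (β x)) := fun x hx => by
    rw [inv_weight hg hx, matrixAct_smul_left, flatInner_smul_right]
  refine integral_mono_of_nonneg ?_ ?_ ?_
  · filter_upwards [ae_restrict_mem hD.measurableSet] with x hx
    rw [hEq x hx]
    exact mul_nonneg (Real.exp_nonneg _) (flatInner_inv_nonneg hg hx _)
  · refine Integrable.const_mul ?_ _
    refine integrableOn_of_continuousOn hK hKD (continuousOn_bilin flatInnerL hβ
      (continuousOn_bilin matrixActL hg.contDiffOn_inv.continuousOn hβ)) fun x hx => ?_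
    rw [hβK x hx]
    exact flatInner_zero_left _
  · filter_upwards [ae_restrict_mem hD.measurableSet] with x hx
    rw [hEq x hx]
    by_cases hxK : x ∈ K
    · exact mul_le_mul_of_nonneg_right (Real.exp_le_exp.2 (hχ x hxK))
        (flatInner_inv_nonneg hg hx _)
    · rw [hβK x hxK, flatInner_zero_left, mul_zero, mul_zero]

theorem exists_fderiv_dualVec_le {η : EuclideanSpace ℝ (Fin n) → ℝ} (hη : ContDiff ℝ ∞ η)
    (hc : HasCompactSupport η) :
    ∃ L, 0 ≤ L ∧ ∀ x, fderiv ℝ η x (dualVec (fderiv ℝ η x)) ≤ L := by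
  have hcd : Continuous (fderiv ℝ η) := hη.continuous_fderiv (by simp)
  obtain ⟨C, hC⟩ := hcd.bounded_above_of_compact_support (hc.fderiv ℝ)
  have hC0 : 0 ≤ C := (norm_nonneg _).trans (hC 0)
  refine ⟨C * (‖(dualVec : (EuclideanSpace ℝ (Fin n) →L[ℝ] ℝ) →L[ℝ] _)‖ * C), by positivity,
    fun x => ?_⟩
  refine (le_abs_self _).trans (((fderiv ℝ η x).le_opNorm _).trans ?_)
  gcongr
  · exact hC x
  · refine (ContinuousLinearMap.le_opNorm _ _).trans ?_
    gcongr
    exact hC x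

/-- The estimate obtained from the metric `G = exp (-χ) g` with `χ = exp (t p)`, where `p` is a strictly
convex function which is at most `-1/4` on the support of `γ` and at least `1/4` outside of the
compact set `K`. The first two terms on the right-hand side are the ones wanted, apart from a factor
which tends to `1` as `t → ∞`; all others tend to `0`.

The weak solution `α` for `G` satisfies `∫ ⟨γ, f⟩ = ⟨⟨α, f⟩⟩_G`. The part of this integral weighted
with `η²` is estimated by the pointwise inequality for `Θ⁻¹` and the curvature inequality with cut-off
function `η`. The latter has the error term `∫ |dη|² |α|²_G`. On the support of `dη`, where `p ≥ 1/4`,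
the curvature of `G` is at least `t c`, so that the curvature inequality with a second cut-off
function `η'`, equal to `1` near the support of `η`, bounds the error term by a multiple of
`1/(t c)`. Outside of `K` the weight is tiny, which takes care of the rest of the integral. -/
theorem two_mul_setIntegral_flatInner_le {D : Set (EuclideanSpace ℝ (Fin n))} (hD : IsOpen D)
    {g : EuclideanSpace ℝ (Fin n) → Matrix (Fin r) (Fin r) ℝ} (hg : IsC2Metric D g)
    (hpos : NakanoSemipositive q D g)
    {f : EuclideanSpace ℝ (Fin n) → EForm n r (q + 1)} (hf : ContDiffOn ℝ 1 f D)
    (hclosed : ∀ x ∈ D, extDeriv f x = 0) (hfi : SqIntegrable D g f)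
    (hfin : ∫⁻ x in D, curvatureInvForm g x (f x) < ⊤)
    {γ : EuclideanSpace ℝ (Fin n) → EForm n r (q + 1)} (hγ : IsTestForm D γ)
    {p : EuclideanSpace ℝ (Fin n) → ℝ} {c : ℝ} {K : Set (EuclideanSpace ℝ (Fin n))}
    (hp : ContDiff ℝ 2 p) (hc : 0 < c) (hγK : tsupport γ ⊆ K)
    (hpγ : ∀ x ∈ tsupport γ, p x ≤ -(1 / 4)) (hpK : ∀ x ∉ K, 1 / 4 ≤ p x)
    (hhess : ∀ x, ∀ G : Matrix (Fin r) (Fin r) ℝ, G.PosSemidef →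
        ∀ α : EForm n r (q + 1), c * formInner G α α ≤ hessForm p x G α)
    {η η' : EuclideanSpace ℝ (Fin n) → ℝ} {L L' : ℝ}
    (hη : ContDiff ℝ ∞ η) (hηc : HasCompactSupport η) (hηD : tsupport η ⊆ D)
    (hη01 : ∀ x, 0 ≤ η x ∧ η x ≤ 1) (hη1 : ∀ x ∈ K, η =ᶠ[𝓝 x] fun _ => 1)
    (hηL : ∀ x, fderiv ℝ η x (dualVec (fderiv ℝ η x)) ≤ L)
    (hη' : ContDiff ℝ ∞ η') (hηc' : HasCompactSupport η') (hηD' : tsupport η' ⊆ D)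
    (hη1' : ∀ x ∈ tsupport η, η' =ᶠ[𝓝 x] fun _ => 1)
    (hL : 0 ≤ L) (hL' : 0 ≤ L')
    (hηL' : ∀ x, fderiv ℝ η' x (dualVec (fderiv ℝ η' x)) ≤ L')
    {t : ℝ} (ht : 0 < t) :
    2 * ∫ x in D, flatInner (γ x) (f x) ≤
      (∫⁻ x in D, curvatureInvForm g x (f x)).toReal +
      Real.exp (Real.exp (-(t / 4))) *
        (∫ x in D, flatInner (codiff γ x) (matrixAct (g x)⁻¹ (codiff γ x))) +
      L / (t * c) * (Real.exp (Real.exp (-(t / 4))) *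
        (∫ x in D, flatInner (codiff γ x) (matrixAct (g x)⁻¹ (codiff γ x))) +
        L' * (Real.exp (Real.exp (-(t / 4))) *
          ∫ x in D, flatInner (γ x) (matrixAct (g x)⁻¹ (γ x)))) +
      t * Real.exp (-(t / 4)) * (∫ x in D, formInner (g x) (f x) (f x)) +
      t⁻¹ * (Real.exp (Real.exp (-(t / 4))) *
          ∫ x in D, flatInner (γ x) (matrixAct (g x)⁻¹ (γ x))) := by
  obtain ⟨χ, hχdef⟩ : ∃ χ : EuclideanSpace ℝ (Fin n) → ℝ, χ = fun x => Real.exp (t * p x) :=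
    ⟨_, rfl⟩
  have htp : ContDiff ℝ 2 (fun x => t * p x) := contDiff_const.mul hp
  have hχ : ContDiff ℝ 2 χ := by rw [hχdef]; exact htp.exp
  obtain ⟨hG, hGcurv⟩ := formInner_curvatureOp_weight (q := q) hD hg hχ
  obtain ⟨G, hGdef⟩ : ∃ G, G = fun x => Real.exp (-χ x) • g x := ⟨_, rfl⟩
  rw [← hGdef] at hG hGcurv
  have hGx : ∀ x, ∀ a b : EForm n r (q + 1),
      formInner (G x) a b = Real.exp (-χ x) * formInner (g x) a b := fun x a b => by
    rw [hGdef]; exact formInner_smul_metric _ _ _ _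
  have hχ0 : ∀ x, 0 ≤ χ x := fun x => by rw [hχdef]; exact Real.exp_nonneg _
  have hW1 : ∀ x, Real.exp (-χ x) ≤ 1 := fun x => Real.exp_le_one_iff.2 (neg_nonpos.2 (hχ0 x))
  have hgn : ∀ x ∈ D, ∀ a : EForm n r (q + 1), 0 ≤ formInner (g x) a a := fun x hx a =>
    formInner_self_nonneg (hg.1 x hx).posSemidef a
  have hGn : ∀ x ∈ D, ∀ a : EForm n r (q + 1), 0 ≤ formInner (G x) a a := fun x hx a =>
    formInner_self_nonneg (hG.1 x hx).posSemidef a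
  have hfG : SqIntegrable D G f := by
    refine ⟨hfi.1, hfi.2.mono' ?_ ?_⟩
    · simp only [hGx]
      exact ((Real.continuous_exp.comp hχ.continuous.neg).aestronglyMeasurable).mul hfi.2.1
    · filter_upwards [ae_restrict_mem hD.measurableSet] with x hx
      rw [Real.norm_eq_abs, abs_of_nonneg (hGn x hx _), hGx]
      exact mul_le_of_le_one_left (hgn x hx _) (hW1 x)
  obtain ⟨α, hα, hαM, hαf⟩ := exists_isWeakSolution hD hG hf hclosed hfG hγ
  have hαG : SqIntegrable D G α := ⟨hα.1, hα.2⟩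
  -- bounds for the norms of `γ` and `codiff γ` in the weighted metric
  obtain ⟨e, he⟩ : ∃ e, e = Real.exp (Real.exp (-(t / 4))) := ⟨_, rfl⟩
  obtain ⟨A, hA⟩ : ∃ A, A = ∫ x in D, flatInner (codiff γ x) (matrixAct (g x)⁻¹ (codiff γ x)) :=
    ⟨_, rfl⟩
  obtain ⟨M, hM⟩ : ∃ M, M = ∫ x in D, flatInner (γ x) (matrixAct (g x)⁻¹ (γ x)) := ⟨_, rfl⟩
  have hχγ : ∀ x ∈ tsupport γ, χ x ≤ Real.exp (-(t / 4)) := fun x hx => by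
    rw [hχdef]
    refine Real.exp_le_exp.2 ?_
    have := mul_le_mul_of_nonneg_left (hpγ x hx) ht.le
    linarith
  have hAt : ∫ x in D, flatInner (codiff γ x) (matrixAct (G x)⁻¹ (codiff γ x)) ≤ e * A := by
    rw [hGdef, hA, he]
    exact setIntegral_inv_weight_le hD hγ.2.1 hγ.2.2 hg
      (contDiffOn_codiff (m := 0) hD hγ.1.contDiffOn (by norm_num)).continuousOn
      (fun x hx => codiff_eq_zero hx) hχγ
  have hMt : ∫ x in D, formInner (G x) (α x) (α x) ≤ e * M := by
    refine hαM.trans ?_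
    simp only [flatInner_comm (matrixAct _ _) (γ _)]
    rw [hGdef, hM, he]
    exact setIntegral_inv_weight_le hD hγ.2.1 hγ.2.2 hg hγ.1.continuous.continuousOn
      (fun x hx => image_eq_zero_of_notMem_tsupport hx) hχγ
  rw [← hA, ← hM, ← he]
  -- the curvature of the weighted metric
  have hQ : ∀ x ∈ D, Real.exp (-χ x) * formInner (g x) (curvatureOp g x (α x)) (α x) +
      t * c * (Real.exp (t * p x) * formInner (G x) (α x) (α x)) ≤
        formInner (G x) (curvatureOp G x (α x)) (α x) := by
    intro x hx
    have h1 := exp_mul_hessForm_le htp x (hg.1 x hx).posSemidef (α x)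
    rw [hessForm_const_mul t hp] at h1
    have h2 := mul_le_mul_of_nonneg_left (hhess x (g x) (hg.1 x hx).posSemidef (α x)) ht.le
    have h3 := (mul_le_mul_of_nonneg_left h2 (Real.exp_nonneg (t * p x))).trans h1
    rw [← hχdef] at h3
    rw [hGx x (curvatureOp G x (α x)), hGcurv x hx, hGx, mul_add]
    have h4 := mul_le_mul_of_nonneg_left h3 (Real.exp_nonneg (-χ x))
    linarith
  have hR : ∀ x ∈ D, 0 ≤ Real.exp (-χ x) * formInner (g x) (curvatureOp g x (α x)) (α x) :=
    fun x hx => mul_nonneg (Real.exp_nonneg _) (hpos x hx _)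
  obtain ⟨h1i, h1Q, h1⟩ := hα.setIntegral_curvature_le hD hG hγ hη hηc hηD
    fun x hx => hη1 x (hγK hx)
  have hγη : tsupport γ ⊆ tsupport η := fun x hx => subset_tsupport η (by
    have := (hη1 x (hγK hx)).self_of_nhds
    simp [this])
  obtain ⟨h2i, h2Q, h2⟩ := hα.setIntegral_curvature_le hD hG hγ hη' hηc' hηD'
    fun x hx => hη1' x (hγη hx)
  have htc : 0 < t * c := mul_pos ht hc
  -- the second cut-off function controls the error term of the first
  have hS2 : ∫ x in D, fderiv ℝ η' x (dualVec (fderiv ℝ η' x)) * formInner (G x) (α x) (α x) ≤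
      L' * (e * M) := by
    refine le_trans ?_ (mul_le_mul_of_nonneg_left hMt hL')
    rw [← integral_const_mul]
    refine setIntegral_mono_on h2i (hαG.2.const_mul L') hD.measurableSet fun x hx => ?_
    exact mul_le_mul_of_nonneg_right (hηL' x) (hGn x hx _)
  have hS1 : ∫ x in D, fderiv ℝ η x (dualVec (fderiv ℝ η x)) * formInner (G x) (α x) (α x) ≤
      L / (t * c) * (e * A + L' * (e * M)) := by
    have h3 : ∫ x in D, η' x ^ 2 * formInner (G x) (curvatureOp G x (α x)) (α x) ≤
        e * A + L' * (e * M) := h2.trans (add_le_add hAt hS2)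
    refine le_trans ?_ (mul_le_mul_of_nonneg_left h3 (div_nonneg hL htc.le))
    rw [← integral_const_mul]
    refine setIntegral_mono_on h1i (h2Q.const_mul _) hD.measurableSet fun x hx => ?_
    have hQx := hQ x hx
    have hRx := hR x hx
    have hNx := hGn x hx (α x)
    by_cases hxη : x ∈ tsupport η
    · by_cases hxK : x ∈ K
      · have : fderiv ℝ η x = 0 := by rw [(hη1 x hxK).fderiv_eq]; simp
        rw [this]
        simp only [_root_.zero_apply, zero_mul]
        have : 0 ≤ formInner (G x) (curvatureOp G x (α x)) (α x) := by
          have : 0 ≤ t * c * (Real.exp (t * p x) * formInner (G x) (α x) (α x)) := by positivity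
          linarith
        positivity
      · rw [(hη1' x hxη).self_of_nhds, one_pow, one_mul]
        have hexp : 1 ≤ Real.exp (t * p x) := by
          rw [Real.one_le_exp_iff]
          have := hpK x hxK
          exact mul_nonneg ht.le (by linarith)
        have h4 : t * c * formInner (G x) (α x) (α x) ≤
            formInner (G x) (curvatureOp G x (α x)) (α x) := by
          have : t * c * formInner (G x) (α x) (α x) ≤
              t * c * (Real.exp (t * p x) * formInner (G x) (α x) (α x)) := by
            refine mul_le_mul_of_nonneg_left ?_ htc.le
            exact le_mul_of_one_le_left hNx hexp
          linarith
        calc _ ≤ L * formInner (G x) (α x) (α x) := mul_le_mul_of_nonneg_right (hηL x) hNx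
          _ = L / (t * c) * (t * c * formInner (G x) (α x) (α x)) := by field_simp
          _ ≤ _ := mul_le_mul_of_nonneg_left h4 (div_nonneg hL htc.le)
    · rw [fderiv_eq_zero_of_notMem hxη]
      simp only [_root_.zero_apply, zero_mul]
      have : 0 ≤ formInner (G x) (curvatureOp G x (α x)) (α x) := by
        have : 0 ≤ t * c * (Real.exp (t * p x) * formInner (G x) (α x) (α x)) := by positivity
        linarith
      positivity
  have hS : ∫ x in D, η x ^ 2 * formInner (G x) (curvatureOp G x (α x)) (α x) ≤
      e * A + L / (t * c) * (e * A + L' * (e * M)) := h1.trans (add_le_add hAt hS1)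
  -- the part of the integral weighted with `η²`
  have hαfi := hαG.integrableOn_formInner hD hG hfG
  have hηf : IntegrableOn (fun x => η x ^ 2 * (2 * formInner (G x) (α x) (f x))) D := by
    have h3 : IntegrableOn (fun x => 2 * formInner (G x) (α x) (f x)) D := hαfi.const_mul 2
    refine Integrable.mono h3 ((hη.continuous.pow 2).aestronglyMeasurable.mul h3.1)
      (ae_of_all _ fun x => ?_)
    rw [norm_mul]
    refine mul_le_of_le_one_left (norm_nonneg _) ?_
    rw [norm_pow, Real.norm_eq_abs, abs_of_nonneg (hη01 x).1]
    exact pow_le_one₀ (hη01 x).1 (hη01 x).2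
  have hmain : IntegrableOn (fun x => η x ^ 2 * (2 * formInner (G x) (α x) (f x)) -
      η x ^ 2 * formInner (G x) (curvatureOp G x (α x)) (α x)) D := hηf.sub h1Q
  have hC := setIntegral_le_toReal_lintegral hD hmain hfin fun x hx => by
    have hle : η x ^ 2 * (2 * formInner (G x) (α x) (f x)) -
        η x ^ 2 * formInner (G x) (curvatureOp G x (α x)) (α x) ≤
        max (2 * formInner (g x) (α x) (f x) -
          formInner (g x) (curvatureOp g x (α x)) (α x)) 0 := by
      have h3 : 0 ≤ t * c * (Real.exp (t * p x) * formInner (G x) (α x) (α x)) := by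
        have := hGn x hx (α x)
        positivity
      have h4 := hQ x hx
      have h5 : η x ^ 2 * (2 * formInner (G x) (α x) (f x)) -
          η x ^ 2 * formInner (G x) (curvatureOp G x (α x)) (α x) ≤
          (η x ^ 2 * Real.exp (-χ x)) * (2 * formInner (g x) (α x) (f x) -
            formInner (g x) (curvatureOp g x (α x)) (α x)) := by
        have : 0 ≤ η x ^ 2 := sq_nonneg _
        rw [hGx x (α x) (f x)]
        nlinarith
      refine h5.trans ((mul_le_mul_of_nonneg_left (le_max_left _ 0)
        (mul_nonneg (sq_nonneg _) (Real.exp_nonneg _))).trans ?_)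
      refine mul_le_of_le_one_left (le_max_right _ _) ?_
      exact mul_le_one₀ (pow_le_one₀ (hη01 x).1 (hη01 x).2) (Real.exp_nonneg _) (hW1 x)
    refine (ENNReal.ofReal_le_ofReal hle).trans ?_
    rw [ENNReal.ofReal_max, ENNReal.ofReal_zero, max_eq_left (zero_le)]
    exact ofReal_le_curvatureInvForm hD hg hpos hx (α x) (f x)
  rw [integral_sub hηf h1Q] at hC
  -- the part weighted with `1 - η²`, which lives where `exp (-χ) ≤ exp (-t/4)`
  have htail : ∫ x in D, (2 * formInner (G x) (α x) (f x) -
      η x ^ 2 * (2 * formInner (G x) (α x) (f x))) ≤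
      t * Real.exp (-(t / 4)) * (∫ x in D, formInner (g x) (f x) (f x)) + t⁻¹ * (e * M) := by
    refine le_trans ?_ (add_le_add le_rfl (mul_le_mul_of_nonneg_left hMt (inv_pos.2 ht).le))
    rw [← integral_const_mul, ← integral_const_mul,
      ← integral_add (hfi.2.const_mul _) (hαG.2.const_mul _)]
    refine setIntegral_mono_on ((hαfi.const_mul 2).sub hηf)
      ((hfi.2.const_mul _).add (hαG.2.const_mul _)) hD.measurableSet fun x hx => ?_
    have hNx := hGn x hx (α x)
    have hfx := hgn x hx (f x)
    by_cases hxK : x ∈ K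
    · rw [(hη1 x hxK).self_of_nhds, one_pow, one_mul, sub_self]
      positivity
    · have h3 := two_mul_formInner_le (hG.1 x hx) ht (α x) (f x)
      rw [hGx x (f x)] at h3
      have h4 : Real.exp (-χ x) ≤ Real.exp (-(t / 4)) := by
        refine Real.exp_le_exp.2 (neg_le_neg ?_)
        rw [hχdef]
        have h5 := Real.add_one_le_exp (t * p x)
        have h6 := mul_le_mul_of_nonneg_left (hpK x hxK) ht.le
        linarith
      have h5 : t * (Real.exp (-χ x) * formInner (g x) (f x) (f x)) ≤
          t * Real.exp (-(t / 4)) * formInner (g x) (f x) (f x) := by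
        rw [mul_assoc]
        gcongr
      have h6 : 0 ≤ t * Real.exp (-(t / 4)) * formInner (g x) (f x) (f x) +
          t⁻¹ * formInner (G x) (α x) (α x) := by positivity
      have h7 : 0 ≤ 1 - η x ^ 2 := sub_nonneg.2 (pow_le_one₀ (hη01 x).1 (hη01 x).2)
      have h8 : 1 - η x ^ 2 ≤ 1 := sub_le_self _ (sq_nonneg _)
      calc 2 * formInner (G x) (α x) (f x) - η x ^ 2 * (2 * formInner (G x) (α x) (f x))
          = (1 - η x ^ 2) * (2 * formInner (G x) (α x) (f x)) := by ring
        _ ≤ (1 - η x ^ 2) * (t * Real.exp (-(t / 4)) * formInner (g x) (f x) (f x) +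
          t⁻¹ * formInner (G x) (α x) (α x)) := by
            refine mul_le_mul_of_nonneg_left ?_ h7
            linarith
        _ ≤ _ := mul_le_of_le_one_left h6 h8
  rw [integral_sub (hαfi.const_mul 2) hηf, integral_const_mul, hαf] at htail
  linarith

end WeightedEstimate

/-! ### The dual inequality and the solution of the equation -/

section Solution

open Filter Topology

variable {n r q : ℕ}

attribute [local instance] Matrix.normedAddCommGroup Matrix.normedSpace

theorem tendsto_mul_exp_neg_div : Tendsto (fun t : ℝ => t * Real.exp (-(t / 4))) atTop (𝓝 0) := by
  have h1 := (Real.tendsto_pow_mul_exp_neg_atTop_nhds_zero 1).comp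
    (tendsto_id.atTop_div_const (show (0 : ℝ) < 4 by norm_num))
  have h2 := h1.const_mul 4
  rw [mul_zero] at h2
  refine h2.congr fun t => ?_
  simp only [Function.comp_apply, id_eq, pow_one]
  ring

/-- The limit `t → ∞` in the weighted estimate. The exhaustion function and the cut-off functions
depend on `γ` but not on `t`. -/
theorem two_mul_setIntegral_flatInner_le_add {D : Set (EuclideanSpace ℝ (Fin n))} (hD : IsOpen D)
    (hDc : Convex ℝ D)
    {g : EuclideanSpace ℝ (Fin n) → Matrix (Fin r) (Fin r) ℝ} (hg : IsC2Metric D g)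
    (hpos : NakanoSemipositive q D g)
    {f : EuclideanSpace ℝ (Fin n) → EForm n r (q + 1)} (hf : ContDiffOn ℝ 1 f D)
    (hclosed : ∀ x ∈ D, extDeriv f x = 0) (hfi : SqIntegrable D g f)
    (hfin : ∫⁻ x in D, curvatureInvForm g x (f x) < ⊤)
    {γ : EuclideanSpace ℝ (Fin n) → EForm n r (q + 1)} (hγ : IsTestForm D γ) :
    2 * ∫ x in D, flatInner (γ x) (f x) ≤
      (∫⁻ x in D, curvatureInvForm g x (f x)).toReal +
        ∫ x in D, flatInner (codiff γ x) (matrixAct (g x)⁻¹ (codiff γ x)) := by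
  obtain ⟨p, c, K, hp, hc, hK, hKD, hγK, hpγ, hpK, hhess⟩ := exists_exhaustion hD hDc hγ.2.1 hγ.2.2
  obtain ⟨η, hη, hηc, hηD, hη01, hη1⟩ := exists_cutoff hD hK hKD
  obtain ⟨η', hη', hηc', hηD', hη01', hη1'⟩ := exists_cutoff hD hηc hηD
  obtain ⟨L, hL, hηL⟩ := exists_fderiv_dualVec_le hη hηc
  obtain ⟨L', hL', hηL'⟩ := exists_fderiv_dualVec_le hη' hηc'
  have key := fun t (ht : (0 : ℝ) < t) => two_mul_setIntegral_flatInner_le hD hg hpos hf hclosed hfi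
    hfin hγ hp hc hγK hpγ hpK (fun x G hG α => hhess r q x G hG α) hη hηc hηD hη01 hη1 hηL
    hη' hηc' hηD' hη1' hL hL' hηL' ht
  have e1 : Tendsto (fun t : ℝ => Real.exp (Real.exp (-(t / 4)))) atTop (𝓝 1) := by
    have h1 : Tendsto (fun t : ℝ => Real.exp (-(t / 4))) atTop (𝓝 0) :=
      Real.tendsto_exp_neg_atTop_nhds_zero.comp
        (tendsto_id.atTop_div_const (show (0 : ℝ) < 4 by norm_num))
    have h2 := (Real.continuous_exp.tendsto 0).comp h1
    rwa [Real.exp_zero] at h2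
  have e2 : Tendsto (fun t : ℝ => L / (t * c)) atTop (𝓝 0) :=
    tendsto_const_nhds.div_atTop (tendsto_id.atTop_mul_const hc)
  have e3 : Tendsto (fun t : ℝ => t⁻¹) atTop (𝓝 0) := tendsto_inv_atTop_zero
  obtain ⟨A, hA⟩ : ∃ A, A = ∫ x in D, flatInner (codiff γ x) (matrixAct (g x)⁻¹ (codiff γ x)) :=
    ⟨_, rfl⟩
  obtain ⟨M, hM⟩ : ∃ M, M = ∫ x in D, flatInner (γ x) (matrixAct (g x)⁻¹ (γ x)) := ⟨_, rfl⟩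
  obtain ⟨F, hF⟩ : ∃ F, F = ∫ x in D, formInner (g x) (f x) (f x) := ⟨_, rfl⟩
  obtain ⟨C, hC⟩ : ∃ C, C = (∫⁻ x in D, curvatureInvForm g x (f x)).toReal := ⟨_, rfl⟩
  rw [← hA, ← hM, ← hF, ← hC] at key
  rw [← hA, ← hC]
  have hlim := ((((tendsto_const_nhds (x := C)).add (e1.mul_const A)).add
    (e2.mul ((e1.mul_const A).add ((e1.mul_const M).const_mul L')))).add
      (tendsto_mul_exp_neg_div.mul_const F)).add (e3.mul (e1.mul_const M))
  have h0 := ge_of_tendsto hlim ((eventually_gt_atTop 0).mono key)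
  simpa using h0

theorem codiff_add {D : Set (EuclideanSpace ℝ (Fin n))}
    {γ γ' : EuclideanSpace ℝ (Fin n) → EForm n r (q + 1)} (hγ : IsTestForm D γ)
    (hγ' : IsTestForm D γ') (x : EuclideanSpace ℝ (Fin n)) :
    codiff (γ + γ') x = codiff γ x + codiff γ' x := by
  have h1 : ∀ i, partialDeriv i (γ + γ') x = partialDeriv i γ x + partialDeriv i γ' x := fun i =>
    partialDeriv_add (hγ.1.differentiable two_ne_zero x) (hγ'.1.differentiable two_ne_zero x) i
  simp only [codiff, h1, contract_add, Finset.sum_add_distrib]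
  abel

theorem codiff_smul {D : Set (EuclideanSpace ℝ (Fin n))}
    {γ : EuclideanSpace ℝ (Fin n) → EForm n r (q + 1)} (hγ : IsTestForm D γ) (c : ℝ)
    (x : EuclideanSpace ℝ (Fin n)) :
    codiff (c • γ) x = c • codiff γ x := by
  have h1 : ∀ i, partialDeriv i (c • γ) x = c • partialDeriv i γ x := fun i => by
    have h2 := partialDeriv_clm (c • ContinuousLinearMap.id ℝ (EForm n r (q + 1))) i
      (hγ.1.differentiable two_ne_zero x)
    exact h2
  simp only [codiff, h1, contract_smul, smul_neg, Finset.smul_sum]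

theorem contDiff_fun_add {X : Type*} [NormedAddCommGroup X] [NormedSpace ℝ X]
    {F H : EuclideanSpace ℝ (Fin n) → X} (hF : ContDiff ℝ 2 F) (hH : ContDiff ℝ 2 H) :
    ContDiff ℝ 2 (F + H) := hF.add hH

theorem contDiff_fun_const_smul {X : Type*} [NormedAddCommGroup X] [NormedSpace ℝ X]
    {F : EuclideanSpace ℝ (Fin n) → X} (hF : ContDiff ℝ 2 F) (c : ℝ) :
    ContDiff ℝ 2 (c • F) := contDiff_const.smul hF

/-- The vector space of `C²` forms with compact support in `D`. -/
def testForms (n r q : ℕ) (D : Set (EuclideanSpace ℝ (Fin n))) :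
    Submodule ℝ (EuclideanSpace ℝ (Fin n) → EForm n r q) where
  carrier := {γ | IsTestForm D γ}
  zero_mem' := by
    have h0 : tsupport (0 : EuclideanSpace ℝ (Fin n) → EForm n r q) = ∅ := by
      simp [tsupport]
    refine ⟨contDiff_const, ?_, ?_⟩
    · rw [HasCompactSupport, h0]
      exact isCompact_empty
    · rw [h0]
      exact Set.empty_subset D
  add_mem' {a b} ha hb := by
    have hs : tsupport (a + b) ⊆ tsupport a ∪ tsupport b := tsupport_add a b
    exact ⟨contDiff_fun_add ha.1 hb.1,
      (ha.2.1.union hb.2.1).of_isClosed_subset (isClosed_tsupport _) hs,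
      hs.trans (Set.union_subset ha.2.2 hb.2.2)⟩
  smul_mem' c a ha := by
    have hs : tsupport (c • a) ⊆ tsupport a := closure_mono fun x hx hx' => hx (by
      have : a x = 0 := hx'
      simp [this])
    exact ⟨contDiff_fun_const_smul ha.1 c,
      ha.2.1.of_isClosed_subset (isClosed_tsupport _) hs, hs.trans ha.2.2⟩

/-- The dual inequality, obtained by applying the previous one to all multiples `τ γ`: a quadratic
polynomial in `τ` without negative values has discriminant at most `0`. -/
theorem sq_setIntegral_flatInner_le {D : Set (EuclideanSpace ℝ (Fin n))} (hD : IsOpen D)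
    (hDc : Convex ℝ D)
    {g : EuclideanSpace ℝ (Fin n) → Matrix (Fin r) (Fin r) ℝ} (hg : IsC2Metric D g)
    (hpos : NakanoSemipositive q D g)
    {f : EuclideanSpace ℝ (Fin n) → EForm n r (q + 1)} (hf : ContDiffOn ℝ 1 f D)
    (hclosed : ∀ x ∈ D, extDeriv f x = 0) (hfi : SqIntegrable D g f)
    (hfin : ∫⁻ x in D, curvatureInvForm g x (f x) < ⊤)
    {γ : EuclideanSpace ℝ (Fin n) → EForm n r (q + 1)} (hγ : IsTestForm D γ) :
    (∫ x in D, flatInner (γ x) (f x)) ^ 2 ≤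
      (∫⁻ x in D, curvatureInvForm g x (f x)).toReal *
        ∫ x in D, flatInner (codiff γ x) (matrixAct (g x)⁻¹ (codiff γ x)) := by
  obtain ⟨A, hA⟩ : ∃ A, A = ∫ x in D, flatInner (codiff γ x) (matrixAct (g x)⁻¹ (codiff γ x)) :=
    ⟨_, rfl⟩
  obtain ⟨B, hB⟩ : ∃ B, B = ∫ x in D, flatInner (γ x) (f x) := ⟨_, rfl⟩
  have key : ∀ τ : ℝ, 0 ≤ A * (τ * τ) + (-2 * B) * τ +
      (∫⁻ x in D, curvatureInvForm g x (f x)).toReal := by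
    intro τ
    have h1 := two_mul_setIntegral_flatInner_le_add hD hDc hg hpos hf hclosed hfi hfin
      (γ := τ • γ) ((testForms n r (q + 1) D).smul_mem τ hγ)
    simp only [codiff_smul hγ, Pi.smul_apply, flatInner_smul_left, matrixAct_smul,
      flatInner_smul_right] at h1
    rw [integral_const_mul, integral_const_mul, integral_const_mul, ← hA, ← hB] at h1
    linarith
  have h2 := discrim_le_zero key
  rw [discrim] at h2
  rw [← hA, ← hB]
  linarith

theorem MemL2.sqIntegrable {D : Set (EuclideanSpace ℝ (Fin n))} (hD : IsOpen D)
    {g : EuclideanSpace ℝ (Fin n) → Matrix (Fin r) (Fin r) ℝ} (hg : IsC2Metric D g)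
    {u : EuclideanSpace ℝ (Fin n) → EForm n r q} (hu : MemL2 D g u) : SqIntegrable D g u := by
  have hGm : AEStronglyMeasurable g (volume.restrict D) :=
    hg.contDiffOn.continuousOn.aestronglyMeasurable hD.measurableSet
  have h1 : AEStronglyMeasurable (fun x => matrixActL (g x) (u x)) (volume.restrict D) :=
    matrixActL.aestronglyMeasurable_comp₂ hGm hu.1
  have h2 : AEStronglyMeasurable (fun x => flatInnerL (u x) (matrixActL (g x) (u x)))
      (volume.restrict D) := flatInnerL.aestronglyMeasurable_comp₂ hu.1 h1
  have h3 : (fun x => formInner (g x) (u x) (u x)) =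
      fun x => flatInnerL (u x) (matrixActL (g x) (u x)) := funext fun x => formInner_eq _ _ _
  rw [← h3] at h2
  refine ⟨hu.1, (lintegral_ofReal_ne_top_iff_integrable h2 ?_).1 hu.2.ne⟩
  filter_upwards [ae_restrict_mem hD.measurableSet] with x hx using
    formInner_self_nonneg (hg.1 x hx).posSemidef _

theorem SqIntegrable.normSq_eq {D : Set (EuclideanSpace ℝ (Fin n))} (hD : IsOpen D)
    {g : EuclideanSpace ℝ (Fin n) → Matrix (Fin r) (Fin r) ℝ} (hg : IsC2Metric D g)
    {u : EuclideanSpace ℝ (Fin n) → EForm n r q} (hu : SqIntegrable D g u) :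
    normSq D g u = ENNReal.ofReal (∫ x in D, formInner (g x) (u x) (u x)) := by
  refine (ofReal_integral_eq_lintegral_ofReal hu.2 ?_).symm
  filter_upwards [ae_restrict_mem hD.measurableSet] with x hx using
    formInner_self_nonneg (hg.1 x hx).posSemidef _

theorem integrableOn_of_memLp_indicator {Z : Type*} [NormedAddCommGroup Z]
    {K : Set (EuclideanSpace ℝ (Fin n))} (hK : IsCompact K) {z : EuclideanSpace ℝ (Fin n) → Z}
    (hz : MemLp (K.indicator z) 2) : IntegrableOn z K :=
  (integrable_indicator_iff hK.measurableSet).1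
    (integrable_of_memLp_two hK hz fun _ hx => Set.indicator_of_notMem hx z)

/-- A square integrable form which satisfies `∫ ⟨u, δγ⟩ = ∫ ⟨f, γ⟩` for all test forms `γ` solves
`du = f`. -/
theorem isWeakD_of_forall_testForm {D : Set (EuclideanSpace ℝ (Fin n))} (hD : IsOpen D)
    {g : EuclideanSpace ℝ (Fin n) → Matrix (Fin r) (Fin r) ℝ} (hg : IsC2Metric D g)
    {f : EuclideanSpace ℝ (Fin n) → EForm n r (q + 1)} (hf : ContinuousOn f D)
    {u : EuclideanSpace ℝ (Fin n) → EForm n r q} (hu : SqIntegrable D g u)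
    (h : ∀ γ : EuclideanSpace ℝ (Fin n) → EForm n r (q + 1), IsTestForm D γ →
      ∫ x in D, flatInner (u x) (codiff γ x) = ∫ x in D, flatInner (γ x) (f x)) :
    IsWeakD D u f := by
  refine ⟨?_, hf.locallyIntegrableOn hD.measurableSet, fun φ hφ hc hs => ?_⟩
  · refine (locallyIntegrableOn_iff hD.isLocallyClosed).2 fun K hKD hK => ?_
    exact integrableOn_of_memLp_indicator hK (memLp_indicator hK hKD hg hu.1 hu.2)
  · obtain ⟨K, hKdef⟩ : ∃ K, K = tsupport φ := ⟨_, rfl⟩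
    have hK : IsCompact K := hKdef ▸ hc
    have hKD : K ⊆ D := hKdef ▸ hs
    have hφ0 : ∀ x ∉ K, φ x = 0 := fun x hx => image_eq_zero_of_notMem_tsupport (hKdef ▸ hx)
    have hdφ0 : ∀ x ∉ K, fderiv ℝ φ x = 0 := fun x hx => fderiv_eq_zero_of_notMem (hKdef ▸ hx)
    have hw : ∀ x, wedgeCovector (fderiv ℝ φ x) (K.indicator u x) =
        wedgeCovector (fderiv ℝ φ x) (u x) := fun x => by
      by_cases hx : x ∈ K
      · rw [Set.indicator_of_mem hx]
      · rw [hdφ0 x hx, wedgeCovector_zero_left, wedgeCovector_zero_left]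
    have hI1 : IntegrableOn (fun x => φ x • f x) D :=
      integrableOn_of_continuousOn hK hKD (continuous_smul_of_tsupport hD hφ.continuous hs
        hf).continuousOn fun x hx => by rw [hφ0 x hx, zero_smul]
    have hI2 : Integrable (fun x => wedgeCovector (fderiv ℝ φ x) (u x)) := by
      have h1 : Integrable (fun x => wedgeCovector (fderiv ℝ φ x) (K.indicator u x)) :=
        integrable_of_memLp_two hK (memLp_wedgeCovector hφ hc
          (memLp_indicator hK hKD hg hu.1 hu.2)) fun x hx => by
            rw [hdφ0 x hx, wedgeCovector_zero_left]
      exact h1.congr (ae_of_all _ hw)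
    have hI2' : IntegrableOn (fun x => wedgeCovector (fderiv ℝ φ x) (u x)) D := hI2.integrableOn
    rw [eq_neg_iff_add_eq_zero, ← integral_add hI1 hI2']
    refine eq_zero_of_forall_integral_flatInner (integrable_fun_add hI1 hI2') fun b => ?_
    have h1 := h _ (isTestForm_smul hD hφ hc hs (contDiffOn_const (c := b)))
    have h2 : ∀ x, flatInner (u x) (codiff (fun y => φ y • b) x) =
        -flatInner (wedgeCovector (fderiv ℝ φ x) (u x)) b := fun x => by
      rw [codiff_smul_const (hφ.differentiable (by simp) x), flatInner_neg_right,
        flatInner_wedgeCovector]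
    have h3 : ∀ x, flatInner (φ x • b) (f x) = flatInner (φ x • f x) b := fun x => by
      rw [flatInner_smul_left, flatInner_smul_left, flatInner_comm]
    simp only [h2, h3] at h1
    have J1 : IntegrableOn (fun x => flatInner (φ x • f x) b) D :=
      (flatInnerL.flip b).integrable_comp hI1
    have J2 : IntegrableOn (fun x => flatInner (wedgeCovector (fderiv ℝ φ x) (u x)) b) D :=
      (flatInnerL.flip b).integrable_comp hI2'
    simp only [flatInner_add_left]
    rw [integral_add J1 J2, ← h1, integral_neg, neg_add_cancel]

/-- The dual inequality says that `G⁻¹ δγ ↦ ∫ ⟨f, γ⟩` is a bounded functional. The form that represents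
it solves `du = f`. -/
theorem exists_solution {D : Set (EuclideanSpace ℝ (Fin n))} (hD : IsOpen D)
    {g : EuclideanSpace ℝ (Fin n) → Matrix (Fin r) (Fin r) ℝ} (hg : IsC2Metric D g)
    {f : EuclideanSpace ℝ (Fin n) → EForm n r (q + 1)} (hf : ContinuousOn f D)
    {C : ℝ} (hC : 0 ≤ C)
    (h : ∀ γ : EuclideanSpace ℝ (Fin n) → EForm n r (q + 1), IsTestForm D γ →
      (∫ x in D, flatInner (γ x) (f x)) ^ 2 ≤
        C * ∫ x in D, flatInner (codiff γ x) (matrixAct (g x)⁻¹ (codiff γ x))) :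
    ∃ u : EuclideanSpace ℝ (Fin n) → EForm n r q, SqIntegrable D g u ∧ IsWeakD D u f ∧
      ∫ x in D, formInner (g x) (u x) (u x) ≤ C := by
  have hI : ∀ γ : EuclideanSpace ℝ (Fin n) → EForm n r (q + 1), IsTestForm D γ →
      IntegrableOn (fun x => flatInner (γ x) (f x)) D := fun γ hγ =>
    integrableOn_of_continuousOn hγ.2.1 hγ.2.2
      (continuousOn_bilin flatInnerL hγ.1.continuous.continuousOn hf) fun x hx => by
        rw [image_eq_zero_of_notMem_tsupport hx]
        exact flatInner_zero_left _
  let A : testForms n r (q + 1) D →ₗ[ℝ] EuclideanSpace ℝ (Fin n) → EForm n r q :=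
    { toFun := fun γ x => matrixAct (g x)⁻¹ (codiff γ.1 x)
      map_add' := fun γ γ' => funext fun x => by
        change matrixAct (g x)⁻¹ (codiff (γ.1 + γ'.1) x) = _
        rw [codiff_add γ.2 γ'.2, matrixAct_add]
        rfl
      map_smul' := fun c γ => funext fun x => by
        change matrixAct (g x)⁻¹ (codiff (c • γ.1) x) = _
        rw [codiff_smul γ.2, matrixAct_smul]
        rfl }
  let l : testForms n r (q + 1) D →ₗ[ℝ] ℝ :=
    { toFun := fun γ => ∫ x in D, flatInner (γ.1 x) (f x)
      map_add' := fun γ γ' => by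
        rw [← integral_add (hI _ γ.2) (hI _ γ'.2)]
        refine integral_congr_ae (ae_of_all _ fun x => ?_)
        exact flatInner_add_left _ _ _
      map_smul' := fun c γ => by
        rw [RingHom.id_apply, smul_eq_mul, ← integral_const_mul]
        refine integral_congr_ae (ae_of_all _ fun x => ?_)
        exact flatInner_smul_left _ _ _ }
  obtain ⟨u, hu, huC, hul⟩ := exists_weighted_riesz
    (T := testForms n r (q + 1) D) hD hg.contDiffOn.continuousOn hg.1 A
    (fun γ => sqIntegrable_inv_codiff hD hg γ.2) l hC fun γ => by
      refine (h γ.1 γ.2).trans_eq ?_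
      congr 1
      refine setIntegral_congr_fun hD.measurableSet fun x hx => ?_
      exact (flatInner_comm _ _).trans (formInner_inv_right (hg.isUnit_det hx) _ _).symm
  refine ⟨u, hu, isWeakD_of_forall_testForm hD hg hf hu fun γ hγ => ?_, huC⟩
  refine Eq.trans ?_ (hul ⟨γ, hγ⟩)
  exact setIntegral_congr_fun hD.measurableSet fun x hx =>
    (formInner_inv_right (hg.isUnit_det hx) _ _).symm

end Solution

end FlatBundle

theorem theorem1p3 {n r q : ℕ} (hq : q + 1 ≤ n)
    (D : Set (EuclideanSpace ℝ (Fin n))) (hDo : IsOpen D) (hDc : Convex ℝ D)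
    (g : EuclideanSpace ℝ (Fin n) → Matrix (Fin r) (Fin r) ℝ)
    (hg : FlatBundle.IsC2Metric D g) (hpos : FlatBundle.NakanoSemipositive q D g)
    (f : EuclideanSpace ℝ (Fin n) → EForm n r (q + 1))
    (hf : ContDiffOn ℝ ∞ f (closure D)) (hclosed : ∀ x ∈ D, extDeriv f x = 0)
    (hdom : FlatBundle.MemDomAdjoint D g f)
    (hfin : ∫⁻ x in D, FlatBundle.curvatureInvForm g x (f x) < ⊤) :
    ∃ u : EuclideanSpace ℝ (Fin n) → EForm n r q,
      FlatBundle.MemL2 D g u ∧ FlatBundle.IsWeakD D u f ∧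
        FlatBundle.normSq D g u ≤ ∫⁻ x in D, FlatBundle.curvatureInvForm g x (f x) := by
  have hf1 : ContDiffOn ℝ 1 f D := (hf.mono subset_closure).of_le (by simp)
  obtain ⟨u, hu, hud, huC⟩ := FlatBundle.exists_solution hDo hg hf1.continuousOn
    ENNReal.toReal_nonneg fun γ hγ => FlatBundle.sq_setIntegral_flatInner_le hDo hDc hg hpos hf1
      hclosed (hdom.1.sqIntegrable hDo hg) hfin hγ
  have hnorm : FlatBundle.normSq D g u ≤ ∫⁻ x in D, FlatBundle.curvatureInvForm g x (f x) := by
    rw [hu.normSq_eq hDo hg]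
    exact ENNReal.ofReal_le_of_le_toReal huC
  exact ⟨u, ⟨hu.1, hnorm.trans_lt hfin⟩, hud, hnorm⟩
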